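/- **Setting.** Let $G$ be a finite connected graph with $|G|\ge 2$ vertices, and let $E=G\times\mathbb Z$ carry the product graph structure. Let $X$ and $Y$ be the discrete-time simple random walks on $E$ and $G$, with laws $P_x$ ($x\in E$) and $P^G_g$ ($g\in G$); at each step they jump to a uniformly chosen neighbour. Write $H_U$ and $T_U$ for the entrance time into $U$ and the exit time from $U$. A finite set $S\subseteq E$ *disconnects* $E$ if for all large $M$ the sets $G\times[M,\infty)$ and $G\times(-\infty,-M]$ are contained in two distinct connected components of $E\setminus S$. The disconnection time is $\mathcal T_G=\inf\{n\ge 0:\ X_{[0,n]}\text{ disconnects }E\}$. The spectral gap is $$\lambda_G=\inf_{f\text{ nonconstant}}\ \frac{\frac1{2|G|}\sum_{g,g'\in G,\ g\sim g'}(f(g')-f(g))^2}{\operatorname{var}(f)},$$ where $\operatorname{var}$ is the variance under the uniform distribution on $G$. With $[\cdot]$ the integer part, put $t_G=\lambda_G^{-1}\log(2|G|)$ and $h=2\big(\big[\sqrt{t_G}\,(\log|G|)^2\big]+1\big)$. **The class $\mathcal G_0$.** Let $d_0\ge2$ be an integer, $0<\delta<\tfrac12$, $0<\delta'<\tfrac{\delta}{8}$,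 $\gamma>1$ and $a>0$. Let $\mathcal G_0=\mathcal G_0(d_0,\delta,\delta',\gamma,a)$ be the class of finite connected graphs $G$ with $|G|\ge2$ and all degrees at most $d_0$ such that either $$\lambda_G\le |G|^{-2(1-\delta)}(\log|G|)^{-1},\tag{1}$$ or (1) fails and there are sets $V\subseteq A\subseteq G$, with $V$ connected, satisfying the following three conditions: $$|A|\ge\lambda_G^{-1/2}|G|^{15\delta/16},\qquad |G|^{\delta/8}\ge|V|\ge \tfrac1{d_0}|G|^{\delta'};$$ $$P^G_g[Y_n=g,\ n<T_A]\le \frac{a}{n^\gamma}\quad\text{for all } g\in A,\ n\ge1;$$ $$\frac{|G|^{1-\delta/8}}{h'}\ \sup_{x\in (G\setminus A)\times\mathbb Z}P_x[H_C<T_{\tilde B'}]\le1.$$ Here $h'=\big[(\sqrt{|A|}\,|G|^{-\delta/8})^{1/\gamma}\big]\wedge h$, $C=V\times[-v,v]$ with $v=|V|\wedge[h'/2]$, and $\tilde B'=G\times[-2h'+1,\,2h'-1]$. **Theorem 4.1 (transient pocket, $\gamma>1$).** For all such $d_0,\delta,\delta',\gamma,a$, $$\lim_{|G|\to\infty,\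 G\in\mathcal G_0}\ \sup_{x\in E}P_x\big[\mathcal T_G\le|G|^{2(1-\delta)}\big]=0 .$$ That is, for every $\varepsilon>0$ there is $N$, depending only on $\varepsilon,d_0,\delta,\delta',\gamma,a$, such that $\sup_{x\in E}P_x[\mathcal T_G\le|G|^{2(1-\delta)}]\le\varepsilon$ for every $G\in\mathcal G_0$ with $|G|\ge N$. -/

import Mathlib

open MeasureTheory ProbabilityTheory Filter
open scoped ENNReal

noncomputable section

namespace DisconnectionTime

/-! ### Simple random walk on a graph -/

section Walk

variable {V : Type*} [MeasurableSpace V] [MeasurableSingletonClass V]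

open Classical in
/-- The law of one step of the simple random walk from `x`: uniform on the set of neighbours of `x`.
(The walk stays put at a vertex that has no neighbour or infinitely many; there is no such vertex in
the graphs considered below.) -/
def stepMeasure (Γ : SimpleGraph V) (x : V) : Measure V :=
  if (Γ.neighborSet x).Finite ∧ (Γ.neighborSet x).Nonempty then uniformOn (Γ.neighborSet x)
  else Measure.dirac x

instance (Γ : SimpleGraph V) (x : V) : IsProbabilityMeasure (stepMeasure Γ x) := by
  unfold stepMeasure
  split_ifs with h
  · exact isProbabilityMeasure_uniformOn h.1 h.2
  · infer_instance

variable [Countable V]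

/-- The transition kernel of the simple random walk, given the path up to time `n`. -/
def stepKernel (Γ : SimpleGraph V) (n : ℕ) : Kernel (Finset.Iic n → V) V where
  toFun p := stepMeasure Γ (p ⟨n, Finset.mem_Iic.2 le_rfl⟩)
  measurable' := (measurable_of_countable (stepMeasure Γ)).comp (measurable_pi_apply _)

instance (Γ : SimpleGraph V) (n : ℕ) : IsMarkovKernel (stepKernel Γ n) :=
  ⟨fun _ => inferInstanceAs (IsProbabilityMeasure (stepMeasure Γ _))⟩

/-- The canonical law on `ℕ → V` of the simple random walk on the graph `Γ` started at `x`. -/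
def walkLaw (Γ : SimpleGraph V) (x : V) : Measure (ℕ → V) :=
  Kernel.traj (X := fun _ => V) (stepKernel Γ) 0 (fun _ => x)

end Walk

/-- Entrance time `H_U = inf {n ≥ 0 : ω n ∈ U}`, equal to `⊤` if the path never visits `U`. -/
def entranceTime {V : Type*} (U : Set V) (ω : ℕ → V) : ℕ∞ :=
  ⨅ (n : ℕ) (_ : ω n ∈ U), (n : ℕ∞)

/-- Exit time `T_U = inf {n ≥ 0 : ω n ∉ U}`. -/
def exitTime {V : Type*} (U : Set V) (ω : ℕ → V) : ℕ∞ :=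
  ⨅ (n : ℕ) (_ : ω n ∉ U), (n : ℕ∞)

/-! ### The cylinder and its disconnection time -/

/-- The cylinder `G × ℤ`, with its product graph structure (`hasse ℤ` is the graph on `ℤ` in which
`u` and `u'` are neighbours when they differ by one). -/
def cylinder {V : Type*} (G : SimpleGraph V) : SimpleGraph (V × ℤ) :=
  G.boxProd (SimpleGraph.hasse ℤ)

/-- `S` disconnects the cylinder: for large `M`, the sets `G × [M, ∞)` and `G × (-∞, -M]` are
contained in two distinct connected components of the complement of `S`. -/
def Disconnects {V : Type*} (G : SimpleGraph V) (S : Set (V × ℤ)) : Prop :=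
  ∀ᶠ M : ℤ in atTop, ∃ K₁ K₂ : ((cylinder G).induce Sᶜ).ConnectedComponent, K₁ ≠ K₂ ∧
    {x : V × ℤ | M ≤ x.2} ⊆ Subtype.val '' K₁.supp ∧
    {x : V × ℤ | x.2 ≤ -M} ⊆ Subtype.val '' K₂.supp

/-- The disconnection time `inf {n ≥ 0 : X_{[0,n]} disconnects the cylinder}`. -/
def disconnectionTime {V : Type*} (G : SimpleGraph V) (ω : ℕ → V × ℤ) : ℕ∞ :=
  ⨅ (n : ℕ) (_ : Disconnects G (ω '' Set.Iic n)), (n : ℕ∞)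

/-! ### Spectral gap and the associated scales -/

section Base

variable {V : Type*} [Fintype V]

open Classical in
/-- Dirichlet form `(2|G|)⁻¹ ∑_{g ∼ g'} (f g' - f g)²` (sum over ordered pairs) of the continuous
time walk on `G` that jumps along each edge at rate one. -/
def dirichletForm (G : SimpleGraph V) (f : V → ℝ) : ℝ :=
  1 / (2 * (Fintype.card V : ℝ)) * ∑ g, ∑ g', if G.Adj g g' then (f g' - f g) ^ 2 else 0

/-- Mean of `f` under the uniform distribution. -/
def unifMean (f : V → ℝ) : ℝ := 1 / (Fintype.card V : ℝ) * ∑ g, f g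

/-- Variance of `f` under the uniform distribution. -/
def unifVar (f : V → ℝ) : ℝ := 1 / (Fintype.card V : ℝ) * ∑ g, (f g - unifMean f) ^ 2

/-- Spectral gap `λ_G`: the infimum of `𝒟(f, f) / var(f)` over nonconstant `f`. -/
def spectralGap (G : SimpleGraph V) : ℝ :=
  ⨅ f : {f : V → ℝ // ¬ ∃ c, ∀ g, f g = c}, dirichletForm G f.1 / unifVar f.1

/-- `t_G = λ_G⁻¹ log (2|G|)`. -/
def relaxScale (G : SimpleGraph V) : ℝ :=
  (spectralGap G)⁻¹ * Real.log (2 * Fintype.card V)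

/-- `h = 2 ([√t_G (log |G|)²] + 1)`. -/
def height (G : SimpleGraph V) : ℕ :=
  2 * (⌊√(relaxScale G) * Real.log (Fintype.card V) ^ 2⌋₊ + 1)

/-- `h' = [(√|A| |G|^{-δ/8})^{1/γ}] ∧ h`. -/
def pocketHeight (G : SimpleGraph V) (δ γ : ℝ) (A : Finset V) : ℕ :=
  min ⌊(√(A.card : ℝ) * (Fintype.card V : ℝ) ^ (-δ / 8)) ^ (1 / γ)⌋₊ (height G)

/-- The box `C = W × [-v, v]` with `v = |W| ∧ [h'/2]` (where `/` is the integer division). -/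
def innerBox (W : Finset V) (h' : ℕ) : Set (V × ℤ) :=
  {x | x.1 ∈ W ∧ |x.2| ≤ ((min W.card (h' / 2) : ℕ) : ℤ)}

/-- The slab `G × [-(2h' - 1), 2h' - 1]`. -/
def slab (V : Type*) (h' : ℕ) : Set (V × ℤ) := {x | |x.2| ≤ 2 * (h' : ℤ) - 1}

/-- `λ_G ≤ |G|^{-2(1-δ)} (log |G|)⁻¹`. -/
def SmallGap (G : SimpleGraph V) (δ : ℝ) : Prop :=
  spectralGap G ≤ (Fintype.card V : ℝ) ^ (-2 * (1 - δ)) * (Real.log (Fintype.card V))⁻¹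

variable [MeasurableSpace V] [MeasurableSingletonClass V]

/-- `A ⊇ W` is a pocket of `G` with its inner set. -/
structure IsPocket (d₀ : ℕ) (δ δ' γ a : ℝ) (G : SimpleGraph V) (A W : Finset V) : Prop where
  subset : W ⊆ A
  connected : (G.induce (W : Set V)).Connected
  card_pocket : (spectralGap G) ^ (-(1 / 2) : ℝ) * (Fintype.card V : ℝ) ^ (15 * δ / 16) ≤ A.card
  card_inner_le : (W.card : ℝ) ≤ (Fintype.card V : ℝ) ^ (δ / 8)
  le_card_inner : 1 / (d₀ : ℝ) * (Fintype.card V : ℝ) ^ δ' ≤ W.card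
  /-- On-diagonal decay of the heat kernel of the walk on `G` killed when leaving `A`. -/
  heat_kernel : ∀ g ∈ A, ∀ n : ℕ, 1 ≤ n →
    (walkLaw G g).real {ω | ω n = g ∧ (n : ℕ∞) < exitTime (A : Set V) ω} ≤ a / (n : ℝ) ^ γ
  /-- From outside `A × ℤ`, the walk on the cylinder is unlikely to enter the inner box before
  leaving the slab. -/
  rarely_entered :
    ENNReal.ofReal ((Fintype.card V : ℝ) ^ (1 - δ / 8) / pocketHeight G δ γ A) *
      (⨆ (x : V × ℤ) (_ : x.1 ∉ A), walkLaw (cylinder G) x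
        {ω | entranceTime (innerBox W (pocketHeight G δ γ A)) ω <
          exitTime (slab V (pocketHeight G δ γ A)) ω}) ≤ 1

/-- The class `𝒢₀(d₀, δ, δ', γ, a)` of finite connected graphs. -/
structure InClass (d₀ : ℕ) (δ δ' γ a : ℝ) (G : SimpleGraph V) : Prop where
  connected : G.Connected
  two_le_card : 2 ≤ Fintype.card V
  degree_le : ∀ g, (G.neighborSet g).ncard ≤ d₀
  gap_or_pocket : SmallGap G δ ∨
    (¬ SmallGap G δ ∧ ∃ A W : Finset V, IsPocket d₀ δ δ' γ a G A W)

end Base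

end DisconnectionTime

end

open scoped Topology

noncomputable section

namespace DisconnectionTime

set_option linter.unusedSectionVars false

/-! ### Adapted functionals of the walk and one-step conditioning -/

section Markov

variable {V : Type*} [MeasurableSpace V] [MeasurableSingletonClass V] [Countable V]

/-! If the spectral gap is small, the time `|G|^{2(1-δ)}` is too short to cross a slow mode. Let `f`
be a nonconstant eigenvector of the Laplacian with eigenvalue at most `λ_G`. Measured in units of
its range, `f` descends from its maximum at mean speed at most `λ_G` per step. A disconnecting trace
meets every fibre, hence those over a maximum and a minimum of `f`, in one order or the other. This
bounds the probability by `2 λ_G |G|^{2(1-δ)} ≤ 2 / log |G|`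
(`walkLaw_disconnectionTime_le_spectralGap`).

In the pocket case the argument is local. Fix a linked part `W'` of the inner set, with `w` points,
`w` close to `|G|^{δ'/2}`. A disconnecting set has at least `w / 2` points in some translate of `W'
× [-w, w]` (`Disconnects.exists_box`). The expected number of visits to such a box is only of order
`w^{1/γ}`, much less than `w` since `γ > 1` (`visits_box_le`). The number of visits has an
exponential tail on the scale of its mean (`walkLaw_visitCount_ge`), and this beats the polynomial
number of translates within reach.

For the mean number of visits, the decay `n^{-γ}` makes the Green function of the walk killed
outside `A × ℤ` of order `∑ min(1, w k^{-γ})` (`greenBarrier`). Later returns at most double it once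
the box is hit with probability at most `1/2` from outside `A × ℤ` (`visits_le_two_mul`). That
bound, `IsPocket.hit_box_le_half`, controls the entrance into `W' × {0}` on three scales. Below
height `2h'` the pocket hypothesis applies to a walk outside the pocket. Between `h'` and `2h` there
are about `2h/h'` attempts to descend from `h'`, each unlikely to succeed inside the pocket by the
Green function again (`hit_floorSet_pocket_le`). Beyond `2h` the base has time to mix, as seen by
expanding a resolvent in eigenvectors (`hit_floorSet_le_of_far`).

Stopping times are avoided: probabilities and expectations up to a fixed horizon are functions
defined by recursion on the horizon (`hit`, `visits`), compared with supersolutions. Path measures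
enter only through adapted super- and submartingales. -/

lemma measurable_of_dependsOn_Iic {F : (ℕ → V) → ℝ≥0∞} {k : ℕ}
    (hF : DependsOn F (Set.Iic k)) : Measurable F := by
  rcases isEmpty_or_nonempty V with hV | ⟨⟨v₀⟩⟩
  · exact Subsingleton.measurable
  · have h : F = (fun p : Finset.Iic k → V =>
        F (fun i => if hi : i ∈ Finset.Iic k then p ⟨i, hi⟩ else v₀)) ∘
          Preorder.frestrictLe k := by
      funext ω
      apply hF
      intro i hi
      have : i ∈ Finset.Iic k := by simpa using hi
      simp [this, Preorder.frestrictLe]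
    rw [h]
    exact (measurable_of_countable _).comp (Preorder.measurable_frestrictLe k)

/-- Moves expectations of adapted functionals to finite-time partial trajectories, where the kernel
composition formula is available. -/
lemma lintegral_walkLaw_eq_lmarginal (Γ : SimpleGraph V) (x : V) {F : (ℕ → V) → ℝ≥0∞} {k : ℕ}
    (hF : DependsOn F (Set.Iic k)) :
    ∫⁻ ω, F ω ∂walkLaw Γ x =
      Kernel.lmarginalPartialTraj (X := fun _ => V) (stepKernel Γ) 0 k F (fun _ => x) := by
  have hm := measurable_of_dependsOn_Iic hF
  rw [Kernel.lmarginalPartialTraj, walkLaw,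
    ← Kernel.traj_map_frestrictLe_apply (X := fun _ => V) (κ := stepKernel Γ)]
  rw [lintegral_map]
  · refine lintegral_congr fun ω => hF fun i hi => ?_
    have : i ∈ Finset.Iic k := by simpa using hi
    simp [Function.updateFinset, Preorder.frestrictLe, this]
  · exact hm.comp measurable_updateFinset
  · exact Preorder.measurable_frestrictLe k

lemma lintegral_walkLaw_zero (Γ : SimpleGraph V) (x : V) {F : (ℕ → V) → ℝ≥0∞}
    (hF : DependsOn F (Set.Iic 0)) : ∫⁻ ω, F ω ∂walkLaw Γ x = F fun _ => x := by
  rw [lintegral_walkLaw_eq_lmarginal Γ x hF,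
    Kernel.lmarginalPartialTraj_le _ le_rfl (measurable_of_dependsOn_Iic hF)]

lemma dependsOn_stepAverage (Γ : SimpleGraph V) {F : (ℕ → V) → ℝ≥0∞} {k : ℕ}
    (hF : DependsOn F (Set.Iic (k + 1))) :
    DependsOn (fun ω => ∫⁻ y, F (Function.update ω (k + 1) y) ∂stepMeasure Γ (ω k))
      (Set.Iic k) := by
  intro ω ω' h
  have hk : ω k = ω' k := h k (by simp)
  simp only [hk]
  refine lintegral_congr fun y => hF fun i hi => ?_
  rcases eq_or_ne i (k + 1) with rfl | hne
  · simp
  · rw [Function.update_of_ne hne, Function.update_of_ne hne]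
    apply h
    simp only [Set.mem_Iic] at hi ⊢
    omega

lemma lintegral_walkLaw_succ (Γ : SimpleGraph V) (x : V) {F : (ℕ → V) → ℝ≥0∞} {k : ℕ}
    (hF : DependsOn F (Set.Iic (k + 1))) :
    ∫⁻ ω, F ω ∂walkLaw Γ x =
      ∫⁻ ω, ∫⁻ y, F (Function.update ω (k + 1) y) ∂stepMeasure Γ (ω k) ∂walkLaw Γ x := by
  have hm := measurable_of_dependsOn_Iic hF
  rw [lintegral_walkLaw_eq_lmarginal Γ x hF,
    lintegral_walkLaw_eq_lmarginal Γ x (dependsOn_stepAverage Γ hF),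
    ← Kernel.lmarginalPartialTraj_self (Nat.zero_le k) (Nat.le_succ k) hm]
  congr 1
  funext ω
  rw [Kernel.lmarginalPartialTraj_succ k hm]
  rfl

/-- A nonnegative adapted functional of the walk that decreases on average has expectation at most
its initial value. -/
lemma lintegral_le_of_supermartingale (Γ : SimpleGraph V) (x : V) (F : ℕ → (ℕ → V) → ℝ≥0∞)
    (n : ℕ) (hdep : ∀ k ≤ n, DependsOn (F k) (Set.Iic k))
    (hstep : ∀ k < n, ∀ ω,
      ∫⁻ y, F (k + 1) (Function.update ω (k + 1) y) ∂stepMeasure Γ (ω k) ≤ F k ω) :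
    ∫⁻ ω, F n ω ∂walkLaw Γ x ≤ F 0 fun _ => x := by
  induction n with
  | zero => exact (lintegral_walkLaw_zero Γ x (hdep 0 le_rfl)).le
  | succ n ih =>
    rw [lintegral_walkLaw_succ Γ x (hdep (n + 1) le_rfl)]
    refine (lintegral_mono fun ω => hstep n (Nat.lt_succ_self n) ω).trans ?_
    exact ih (fun k hk => hdep k (hk.trans (Nat.le_succ n)))
      fun k hk => hstep k (hk.trans (Nat.lt_succ_self n))

/-- A nonnegative adapted functional of the walk that increases on average has expectation at least
its initial value. -/
lemma le_lintegral_of_submartingale (Γ : SimpleGraph V) (x : V) (F : ℕ → (ℕ → V) → ℝ≥0∞)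
    (n : ℕ) (hdep : ∀ k ≤ n, DependsOn (F k) (Set.Iic k))
    (hstep : ∀ k < n, ∀ ω,
      F k ω ≤ ∫⁻ y, F (k + 1) (Function.update ω (k + 1) y) ∂stepMeasure Γ (ω k)) :
    (F 0 fun _ => x) ≤ ∫⁻ ω, F n ω ∂walkLaw Γ x := by
  induction n with
  | zero => exact (lintegral_walkLaw_zero Γ x (hdep 0 le_rfl)).ge
  | succ n ih =>
    rw [lintegral_walkLaw_succ Γ x (hdep (n + 1) le_rfl)]
    refine le_trans ?_ (lintegral_mono fun ω => hstep n (Nat.lt_succ_self n) ω)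
    exact ih (fun k hk => hdep k (hk.trans (Nat.le_succ n)))
      fun k hk => hstep k (hk.trans (Nat.lt_succ_self n))

/-- Same as `lintegral_le_of_supermartingale`, for the probability of an event on which the final
value is at least one. -/
lemma walkLaw_le_of_supermartingale (Γ : SimpleGraph V) (x : V) (F : ℕ → (ℕ → V) → ℝ≥0∞)
    (n : ℕ) (hdep : ∀ k ≤ n, DependsOn (F k) (Set.Iic k))
    (hstep : ∀ k < n, ∀ ω,
      ∫⁻ y, F (k + 1) (Function.update ω (k + 1) y) ∂stepMeasure Γ (ω k) ≤ F k ω)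
    {S : Set (ℕ → V)} {c : ℝ≥0∞} (hc : c ≠ 0) (hc' : c ≠ ∞) (hS : ∀ ω ∈ S, c ≤ F n ω) :
    walkLaw Γ x S ≤ (F 0 fun _ => x) / c := by
  have hm := measurable_of_dependsOn_Iic (hdep n le_rfl)
  calc walkLaw Γ x S ≤ walkLaw Γ x {ω | c ≤ F n ω} := measure_mono hS
    _ ≤ (∫⁻ ω, F n ω ∂walkLaw Γ x) / c := meas_ge_le_lintegral_div hm.aemeasurable hc hc'
    _ ≤ _ := by
      gcongr
      exact lintegral_le_of_supermartingale Γ x F n hdep hstep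

instance (Γ : SimpleGraph V) (x : V) : IsProbabilityMeasure (walkLaw Γ x) := by
  unfold walkLaw; infer_instance

open Classical in
lemma lintegral_stepMeasure (Γ : SimpleGraph V) (x : V) (s : Finset V)
    (hs : ∀ y, y ∈ s ↔ Γ.Adj x y) (hne : s.Nonempty) (f : V → ℝ≥0∞) :
    ∫⁻ y, f y ∂stepMeasure Γ x = (∑ y ∈ s, f y) / (s.card : ℝ≥0∞) := by
  have hset : Γ.neighborSet x = (s : Set V) := by
    ext y; simp [hs]
  have hcond : (Γ.neighborSet x).Finite ∧ (Γ.neighborSet x).Nonempty := by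
    rw [hset]; exact ⟨s.finite_toSet, by simpa using hne⟩
  rw [stepMeasure, if_pos hcond, hset, uniformOn, ProbabilityTheory.cond, lintegral_smul_measure,
    lintegral_finset]
  simp [ENNReal.div_eq_inv_mul]

end Markov

/-! ### The averaging operator of the cylinder walk -/

section Average

variable {V : Type*} [Fintype V] (G : SimpleGraph V)

open Classical in
/-- The neighbours of a vertex of a finite graph. -/
def nbrs (g : V) : Finset V := Finset.univ.filter (G.Adj g)

lemma mem_nbrs {g g' : V} : g' ∈ nbrs G g ↔ G.Adj g g' := by simp [nbrs]

/-- One-step average for the simple random walk on the cylinder. -/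
def avg (F : V × ℤ → ℝ) (x : V × ℤ) : ℝ :=
  (∑ g ∈ nbrs G x.1, F (g, x.2) + F (x.1, x.2 + 1) + F (x.1, x.2 - 1)) /
    ((nbrs G x.1).card + 2)

variable {G}

lemma avg_pos_denom (g : V) : (0 : ℝ) < (nbrs G g).card + 2 := by positivity

lemma avg_le_iff {F : V × ℤ → ℝ} {x : V × ℤ} {c : ℝ} :
    avg G F x ≤ c ↔ ∑ g ∈ nbrs G x.1, F (g, x.2) + F (x.1, x.2 + 1) + F (x.1, x.2 - 1) ≤
      c * ((nbrs G x.1).card + 2) := by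
  rw [avg, div_le_iff₀ (avg_pos_denom _)]

lemma avg_mono_of {F F' : V × ℤ → ℝ} {x : V × ℤ}
    (h₁ : ∀ g ∈ nbrs G x.1, F (g, x.2) ≤ F' (g, x.2))
    (h₂ : F (x.1, x.2 + 1) ≤ F' (x.1, x.2 + 1)) (h₃ : F (x.1, x.2 - 1) ≤ F' (x.1, x.2 - 1)) :
    avg G F x ≤ avg G F' x := by
  unfold avg
  have := Finset.sum_le_sum h₁
  gcongr

lemma avg_mono {F F' : V × ℤ → ℝ} (h : ∀ y, F y ≤ F' y) (x : V × ℤ) :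
    avg G F x ≤ avg G F' x :=
  avg_mono_of (fun _ _ => h _) (h _) (h _)

lemma avg_add (F F' : V × ℤ → ℝ) (x : V × ℤ) :
    avg G (fun y => F y + F' y) x = avg G F x + avg G F' x := by
  unfold avg
  rw [← add_div, Finset.sum_add_distrib]
  ring

lemma avg_mul_left (c : ℝ) (F : V × ℤ → ℝ) (x : V × ℤ) :
    avg G (fun y => c * F y) x = c * avg G F x := by
  unfold avg
  rw [← Finset.mul_sum]
  ring

lemma avg_const (c : ℝ) (x : V × ℤ) : avg G (fun _ => c) x = c := by
  unfold avg
  have := avg_pos_denom (G := G) x.1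
  rw [Finset.sum_const, nsmul_eq_mul]
  field_simp
  ring

lemma avg_nonneg {F : V × ℤ → ℝ} (h : ∀ y, 0 ≤ F y) (x : V × ℤ) : 0 ≤ avg G F x := by
  have := avg_mono (G := G) (F := fun _ => 0) h x
  rwa [avg_const] at this

lemma avg_le_const {F : V × ℤ → ℝ} {c : ℝ} (h : ∀ y, F y ≤ c) (x : V × ℤ) : avg G F x ≤ c := by
  have := avg_mono (G := G) (F' := fun _ => c) h x
  rwa [avg_const] at this

lemma avg_sum {ι : Type*} (s : Finset ι) (F : ι → V × ℤ → ℝ) (x : V × ℤ) :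
    avg G (fun y => ∑ i ∈ s, F i y) x = ∑ i ∈ s, avg G (F i) x := by
  classical
  induction s using Finset.induction_on with
  | empty => simpa using avg_const (G := G) 0 x
  | insert i s hi ih =>
    simp only [Finset.sum_insert hi]
    rw [avg_add, ih]

/-- Translation of functions along the cylinder. -/
lemma avg_shift (F : V × ℤ → ℝ) (j : ℤ) (x : V × ℤ) :
    avg G (fun y => F (y.1, y.2 + j)) x = avg G F (x.1, x.2 + j) := by
  unfold avg
  have h₁ : x.2 + 1 + j = x.2 + j + 1 := by ring
  have h₂ : x.2 - 1 + j = x.2 + j - 1 := by ring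
  simp only [h₁, h₂]

lemma hasse_int_adj {z z' : ℤ} : (SimpleGraph.hasse ℤ).Adj z z' ↔ z' = z + 1 ∨ z' = z - 1 := by
  rw [SimpleGraph.hasse_adj, Order.covBy_iff_add_one_eq, Order.covBy_iff_add_one_eq]
  omega

open Classical in
/-- The neighbours of a point of the cylinder. -/
def cylNbrs (G : SimpleGraph V) (x : V × ℤ) : Finset (V × ℤ) :=
  (nbrs G x.1).image (fun g => (g, x.2)) ∪ {(x.1, x.2 + 1), (x.1, x.2 - 1)}

lemma cylinder_adj {x y : V × ℤ} : (cylinder G).Adj x y ↔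
    (G.Adj x.1 y.1 ∧ y.2 = x.2) ∨ (y.1 = x.1 ∧ (y.2 = x.2 + 1 ∨ y.2 = x.2 - 1)) := by
  rw [cylinder, SimpleGraph.boxProd_adj, hasse_int_adj]
  constructor
  · rintro (⟨h, h'⟩ | ⟨h, h'⟩)
    · exact Or.inl ⟨h, h'.symm⟩
    · exact Or.inr ⟨h'.symm, h⟩
  · rintro (⟨h, h'⟩ | ⟨h, h'⟩)
    · exact Or.inl ⟨h, h'.symm⟩
    · exact Or.inr ⟨h', h.symm⟩

lemma mem_cylNbrs {x y : V × ℤ} : y ∈ cylNbrs G x ↔ (cylinder G).Adj x y := by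
  classical
  rw [cylinder_adj, cylNbrs]
  obtain ⟨g, z⟩ := x
  obtain ⟨g', z'⟩ := y
  simp only [Finset.mem_union, Finset.mem_image, mem_nbrs, Finset.mem_insert,
    Finset.mem_singleton, Prod.mk.injEq]
  constructor
  · rintro (⟨a, ha, rfl, rfl⟩ | ⟨rfl, rfl⟩ | ⟨rfl, rfl⟩) <;> simp_all
  · rintro (⟨h, rfl⟩ | ⟨rfl, rfl | rfl⟩) <;> simp_all

lemma cylNbrs_nonempty (x : V × ℤ) : (cylNbrs G x).Nonempty :=
  ⟨(x.1, x.2 + 1), by rw [mem_cylNbrs, cylinder_adj]; simp⟩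

open Classical in
lemma sum_cylNbrs {M : Type*} [AddCommMonoid M] (f : V × ℤ → M) (x : V × ℤ) :
    ∑ y ∈ cylNbrs G x, f y =
      ∑ g ∈ nbrs G x.1, f (g, x.2) + f (x.1, x.2 + 1) + f (x.1, x.2 - 1) := by
  obtain ⟨g, z⟩ := x
  rw [cylNbrs, Finset.sum_union, Finset.sum_image, Finset.sum_pair, add_assoc]
  · intro h
    have := congrArg Prod.snd h
    simp only at this
    omega
  · intro a _ b _ h
    exact congrArg Prod.fst h
  · rw [Finset.disjoint_left]
    intro y hy hy'
    simp only [Finset.mem_image, Finset.mem_insert, Finset.mem_singleton] at hy hy'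
    obtain ⟨a, _, rfl⟩ := hy
    rcases hy' with h | h <;>
    · have := congrArg Prod.snd h
      simp only at this
      omega

lemma card_cylNbrs (x : V × ℤ) : (cylNbrs G x).card = (nbrs G x.1).card + 2 := by
  rw [Finset.card_eq_sum_ones, sum_cylNbrs, Finset.card_eq_sum_ones]

variable [MeasurableSpace V] [MeasurableSingletonClass V]

lemma lintegral_step_cylinder (x : V × ℤ) (f : V × ℤ → ℝ≥0∞) :
    ∫⁻ y, f y ∂stepMeasure (cylinder G) x =
      (∑ y ∈ cylNbrs G x, f y) / ((cylNbrs G x).card : ℝ≥0∞) :=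
  lintegral_stepMeasure _ _ _ (fun _ => mem_cylNbrs) (cylNbrs_nonempty x) f

lemma lintegral_step_cylinder_ofReal (x : V × ℤ) {F : V × ℤ → ℝ}
    (hF : ∀ y, 0 ≤ F y) :
    ∫⁻ y, ENNReal.ofReal (F y) ∂stepMeasure (cylinder G) x = ENNReal.ofReal (avg G F x) := by
  have hc : (cylNbrs G x).card ≠ 0 := (Finset.card_pos.2 (cylNbrs_nonempty x)).ne'
  rw [lintegral_step_cylinder, ← ENNReal.ofReal_sum_of_nonneg fun y _ => hF y,
    ← ENNReal.ofReal_natCast, ← ENNReal.ofReal_div_of_pos (by positivity), sum_cylNbrs,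
    card_cylNbrs, avg]
  push_cast
  rfl

end Average

/-! ### Hitting probabilities and expected visits with a finite horizon -/

section Hitting

variable {V : Type*} [Fintype V] (G : SimpleGraph V)

open Classical in
/-- The probability that the walk enters `U` by time `k`, staying in `D` before. -/
def hit (U D : Set (V × ℤ)) : ℕ → V × ℤ → ℝ
  | 0, x => if x ∈ U then 1 else 0
  | k + 1, x => if x ∈ U then 1 else if x ∈ D then avg G (hit U D k) x else 0

variable {G} {U U' D D' : Set (V × ℤ)}

lemma hit_of_mem {x : V × ℤ} (hx : x ∈ U) (k : ℕ) : hit G U D k x = 1 := by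
  cases k <;> simp [hit, hx]

lemma hit_of_notMem {x : V × ℤ} (hx : x ∉ U) (hx' : x ∉ D) (k : ℕ) : hit G U D k x = 0 := by
  cases k <;> simp [hit, hx, hx']

lemma hit_zero_of_notMem {x : V × ℤ} (hx : x ∉ U) : hit G U D 0 x = 0 := by
  simp [hit, hx]

lemma hit_succ {x : V × ℤ} (hx : x ∉ U) (hx' : x ∈ D) (k : ℕ) :
    hit G U D (k + 1) x = avg G (hit G U D k) x := by
  simp [hit, hx, hx']

lemma hit_nonneg (k : ℕ) (x : V × ℤ) : 0 ≤ hit G U D k x := by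
  induction k generalizing x with
  | zero => rw [hit]; split_ifs <;> norm_num
  | succ k ih =>
    rw [hit]; split_ifs
    · norm_num
    · exact avg_nonneg ih x
    · norm_num

/-- Comparison with a supersolution. -/
lemma hit_le_of_supersolution {F : V × ℤ → ℝ} (h0 : ∀ x, 0 ≤ F x) (hU : ∀ x ∈ U, 1 ≤ F x)
    (hD : ∀ x ∈ D, x ∉ U → avg G F x ≤ F x) (k : ℕ) (x : V × ℤ) : hit G U D k x ≤ F x := by
  induction k generalizing x with
  | zero =>
    by_cases hx : x ∈ U
    · rw [hit_of_mem hx]; exact hU x hx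
    · rw [hit_zero_of_notMem hx]; exact h0 x
  | succ k ih =>
    by_cases hx : x ∈ U
    · rw [hit_of_mem hx]; exact hU x hx
    · by_cases hx' : x ∈ D
      · rw [hit_succ hx hx']
        exact (avg_mono ih x).trans (hD x hx' hx)
      · rw [hit_of_notMem hx hx']; exact h0 x

lemma hit_le_one (k : ℕ) (x : V × ℤ) : hit G U D k x ≤ 1 :=
  hit_le_of_supersolution (fun _ => zero_le_one) (fun _ _ => le_rfl)
    (fun x _ _ => (avg_const 1 x).le) k x

lemma hit_le_succ (k : ℕ) (x : V × ℤ) : hit G U D k x ≤ hit G U D (k + 1) x := by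
  induction k generalizing x with
  | zero =>
    by_cases hx : x ∈ U
    · rw [hit_of_mem hx, hit_of_mem hx]
    · rw [hit_zero_of_notMem hx]; exact hit_nonneg _ _
  | succ k ih =>
    by_cases hx : x ∈ U
    · rw [hit_of_mem hx, hit_of_mem hx]
    · by_cases hx' : x ∈ D
      · rw [hit_succ hx hx', hit_succ hx hx']
        exact avg_mono ih x
      · rw [hit_of_notMem hx hx', hit_of_notMem hx hx']

lemma hit_mono_time {j k : ℕ} (h : j ≤ k) (x : V × ℤ) : hit G U D j x ≤ hit G U D k x :=
  monotone_nat_of_le_succ (f := fun k => hit G U D k x) (fun k => hit_le_succ k x) h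

lemma hit_mono_set (hU : U ⊆ U') (hD : D ⊆ D') (k : ℕ) (x : V × ℤ) :
    hit G U D k x ≤ hit G U' D' k x := by
  induction k generalizing x with
  | zero =>
    by_cases hx : x ∈ U
    · rw [hit_of_mem hx, hit_of_mem (hU hx)]
    · rw [hit_zero_of_notMem hx]; exact hit_nonneg _ _
  | succ k ih =>
    by_cases hx' : x ∈ U'
    · rw [hit_of_mem hx']; exact hit_le_one _ _
    · have hx : x ∉ U := fun h => hx' (hU h)
      by_cases hxD : x ∈ D
      · rw [hit_succ hx hxD, hit_succ hx' (hD hxD)]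
        exact avg_mono ih x
      · rw [hit_of_notMem hx hxD]; exact hit_nonneg _ _

/-- Decomposition according to whether the walk leaves the smaller set `D'` before entering `U`. -/
lemma hit_le_hit_add {b : ℝ} (hb : 0 ≤ b) {n : ℕ}
    (hexit : ∀ x ∉ D', x ∉ U → hit G U D n x ≤ b) {k : ℕ} (hk : k ≤ n) (x : V × ℤ) :
    hit G U D k x ≤ hit G U D' k x + b := by
  induction k generalizing x with
  | zero =>
    by_cases hx : x ∈ U
    · rw [hit_of_mem hx, hit_of_mem hx]; linarith
    · rw [hit_zero_of_notMem hx, hit_zero_of_notMem hx]; linarith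
  | succ k ih =>
    by_cases hx : x ∈ U
    · rw [hit_of_mem hx, hit_of_mem hx]; linarith
    by_cases hx' : x ∈ D'
    · by_cases hxD : x ∈ D
      · rw [hit_succ hx hx', hit_succ hx hxD]
        refine (avg_mono (fun y => ih (by omega) y) x).trans ?_
        rw [avg_add, avg_const]
      · rw [hit_of_notMem hx hxD]
        linarith [hit_nonneg (G := G) (U := U) (D := D') (k + 1) x]
    · have h1 := hit_mono_time (G := G) (U := U) (D := D) hk x
      have h2 := hexit x hx' hx
      linarith [hit_nonneg (G := G) (U := U) (D := D') (k + 1) x]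

/-- Subadditivity in the target set. -/
lemma hit_le_sum {ι : Type*} (s : Finset ι) (U' : ι → Set (V × ℤ))
    (hU : ∀ x ∈ U, ∃ i ∈ s, x ∈ U' i) (k : ℕ) (x : V × ℤ) :
    hit G U D k x ≤ ∑ i ∈ s, hit G (U' i) D k x := by
  induction k generalizing x with
  | zero =>
    by_cases hx : x ∈ U
    · obtain ⟨i, hi, hxi⟩ := hU x hx
      rw [hit_of_mem hx, ← hit_of_mem (G := G) (D := D) hxi 0]
      exact Finset.single_le_sum (f := fun i => hit G (U' i) D 0 x)
        (fun i _ => hit_nonneg 0 x) hi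
    · rw [hit_zero_of_notMem hx]; exact Finset.sum_nonneg fun i _ => hit_nonneg _ _
  | succ k ih =>
    by_cases hx : x ∈ U
    · obtain ⟨i, hi, hxi⟩ := hU x hx
      rw [hit_of_mem hx, ← hit_of_mem (G := G) (D := D) hxi (k + 1)]
      exact Finset.single_le_sum (f := fun i => hit G (U' i) D (k + 1) x)
        (fun i _ => hit_nonneg _ x) hi
    · by_cases hxD : x ∈ D
      · rw [hit_succ hx hxD]
        refine (avg_mono ih x).trans ?_
        rw [avg_sum]
        refine Finset.sum_le_sum fun i _ => ?_
        by_cases hxi : x ∈ U' i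
        · rw [hit_of_mem hxi]; exact avg_le_const (fun y => hit_le_one k y) x
        · rw [hit_succ hxi hxD]
      · rw [hit_of_notMem hx hxD]; exact Finset.sum_nonneg fun i _ => hit_nonneg _ _

lemma hit_shift (j : ℤ) (k : ℕ) (x : V × ℤ) :
    hit G {y | (y.1, y.2 + j) ∈ U} {y | (y.1, y.2 + j) ∈ D} k x =
      hit G U D k (x.1, x.2 + j) := by
  induction k generalizing x with
  | zero => simp [hit]
  | succ k ih =>
    have ih' : hit G {y | (y.1, y.2 + j) ∈ U} {y | (y.1, y.2 + j) ∈ D} k =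
      fun y => hit G U D k (y.1, y.2 + j) := funext ih
    simp only [hit, Set.mem_ofPred_eq]
    rw [ih', avg_shift]

open Classical in
/-- The expected number of visits to `C` up to time `k`. -/
def visits (G : SimpleGraph V) (C : Set (V × ℤ)) : ℕ → V × ℤ → ℝ
  | 0, x => if x ∈ C then 1 else 0
  | k + 1, x => (if x ∈ C then 1 else 0) + avg G (visits G C k) x

variable {C : Set (V × ℤ)}

lemma visits_nonneg (k : ℕ) (x : V × ℤ) : 0 ≤ visits G C k x := by
  classical
  induction k generalizing x with
  | zero => rw [visits]; split_ifs <;> norm_num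
  | succ k ih =>
    have := avg_nonneg (G := G) ih x
    rw [visits]; split_ifs <;> linarith

lemma visits_le (k : ℕ) (x : V × ℤ) : visits G C k x ≤ k + 1 := by
  classical
  induction k generalizing x with
  | zero => rw [visits]; split_ifs <;> norm_num
  | succ k ih =>
    have := avg_le_const (G := G) ih x
    rw [visits]; push_cast; split_ifs <;> linarith

lemma visits_le_succ (k : ℕ) (x : V × ℤ) : visits G C k x ≤ visits G C (k + 1) x := by
  classical
  induction k generalizing x with
  | zero =>
    rw [visits, visits]
    linarith [avg_nonneg (G := G) (visits_nonneg (G := G) (C := C) 0) x]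
  | succ k ih =>
    rw [visits, visits]
    linarith [avg_mono (G := G) ih x]

lemma visits_mono_time {j k : ℕ} (h : j ≤ k) (x : V × ℤ) : visits G C j x ≤ visits G C k x :=
  monotone_nat_of_le_succ (f := fun k => visits G C k x) (fun k => visits_le_succ k x) h

lemma visits_shift (j : ℤ) (k : ℕ) (x : V × ℤ) :
    visits G {y | (y.1, y.2 + j) ∈ C} k x = visits G C k (x.1, x.2 + j) := by
  classical
  induction k generalizing x with
  | zero => simp [visits]
  | succ k ih =>
    have ih' : visits G {y | (y.1, y.2 + j) ∈ C} k = fun y => visits G C k (y.1, y.2 + j) :=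
      funext ih
    simp only [visits, Set.mem_ofPred_eq]
    rw [ih', avg_shift]

/-- The Markov property at the entrance into `C`: nothing is counted earlier, and the time left is
at most `n`, so at most `m` visits are expected from there. -/
lemma visits_le_hit_mul {n : ℕ} {m : ℝ} (hm : ∀ x, visits G C n x ≤ m) {k : ℕ} (hk : k ≤ n)
    (x : V × ℤ) : visits G C k x ≤ hit G C Set.univ k x * m := by
  classical
  induction k generalizing x with
  | zero =>
    by_cases hx : x ∈ C
    · rw [hit_of_mem hx, one_mul]; exact (visits_mono_time hk x).trans (hm x)
    · rw [hit_zero_of_notMem hx]; simp [visits, hx]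
  | succ k ih =>
    by_cases hx : x ∈ C
    · rw [hit_of_mem hx, one_mul]; exact (visits_mono_time hk x).trans (hm x)
    · rw [hit_succ hx (Set.mem_univ x), visits, if_neg hx, zero_add, mul_comm, ← avg_mul_left]
      refine avg_mono (fun y => ?_) x
      rw [mul_comm]
      exact ih (by omega) y

/-- The number of visits is at most that before leaving `D`, plus the later ones. -/
lemma visits_le_add {n : ℕ} {b : ℝ} {F : V × ℤ → ℝ} (hF : ∀ x, 0 ≤ F x)
    (hD : ∀ x ∈ D, Set.indicator C 1 x + avg G F x ≤ F x)
    (hexit : ∀ x ∉ D, visits G C n x ≤ b) (hb : 0 ≤ b) {k : ℕ} (hk : k ≤ n) (x : V × ℤ) :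
    visits G C k x ≤ F x + b := by
  classical
  induction k generalizing x with
  | zero =>
    by_cases hx : x ∈ D
    · have h1 := hD x hx
      have h2 := avg_nonneg (G := G) hF x
      rw [visits]
      simp only [Set.indicator_apply, Pi.one_apply] at h1
      linarith
    · have := (visits_mono_time hk x).trans (hexit x hx)
      linarith [hF x]
  | succ k ih =>
    by_cases hx : x ∈ D
    · have h1 := hD x hx
      have h2 := avg_mono (G := G) (fun y => ih (by omega) y) x
      rw [avg_add, avg_const] at h2
      rw [visits]
      simp only [Set.indicator_apply, Pi.one_apply] at h1
      linarith
    · have := (visits_mono_time hk x).trans (hexit x hx)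
      linarith [hF x]

/-- If the walk started outside of `D` is unlikely to enter `C`, the number of visits to `C` is
controlled by that before leaving `D`. -/
lemma visits_le_two_mul {n : ℕ} {M : ℝ} {F : V × ℤ → ℝ} (hF : ∀ x, 0 ≤ F x)
    (hFM : ∀ x, F x ≤ M)
    (hD : ∀ x ∈ D, Set.indicator C 1 x + avg G F x ≤ F x)
    (hexit : ∀ x ∉ D, hit G C Set.univ n x ≤ 1 / 2) (x : V × ℤ) :
    visits G C n x ≤ 2 * M := by
  have hbdd : BddAbove (Set.range fun x => visits G C n x) :=
    ⟨n + 1, by rintro _ ⟨y, rfl⟩; exact visits_le n y⟩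
  set m := ⨆ x, visits G C n x with hm
  have hle : ∀ y, visits G C n y ≤ m := fun y => le_ciSup hbdd y
  have hm0 : 0 ≤ m := (visits_nonneg n x).trans (hle x)
  -- Outside `D` the walk must still enter `C`, with probability at most `1/2`, and then expects at
  -- most `m` visits. The supremum `m` is finite because visits up to time `n` number at most `n +
  -- 1`, so the inequality can be solved for `m`.
  have key : m ≤ M + m / 2 := by
    have : Nonempty (V × ℤ) := ⟨x⟩
    refine ciSup_le fun y => ?_
    have := visits_le_add (G := G) (C := C) (n := n) (b := m / 2) hF hD (fun y hy => by
      have h1 := visits_le_hit_mul hle le_rfl y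
      have h2 := hexit y hy
      nlinarith) (by linarith) le_rfl y
    linarith [hFM y]
  linarith [hle x]

end Hitting

/-! ### The base walk killed outside the pocket -/

section KilledMatrix

variable {V : Type*} [Fintype V]

open Classical in
/-- Transition matrix of the simple random walk on the base killed when leaving `A`. -/
def killedMatrix (G : SimpleGraph V) (A : Finset V) : Matrix V V ℝ := fun g g' =>
  if g ∈ A ∧ g' ∈ A ∧ G.Adj g g' then ((nbrs G g).card : ℝ)⁻¹ else 0

lemma killedMatrix_pow_nonneg [DecidableEq V] {G : SimpleGraph V} (A : Finset V) (n : ℕ) (g g' : V) :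
    0 ≤ (killedMatrix G A ^ n) g g' := by
  induction n generalizing g with
  | zero => rw [pow_zero, Matrix.one_apply]; split_ifs <;> norm_num
  | succ n ih =>
    rw [pow_succ', Matrix.mul_apply]
    refine Finset.sum_nonneg fun x _ => mul_nonneg ?_ (ih x)
    rw [killedMatrix]; split_ifs <;> positivity

end KilledMatrix

/-! ### From path probabilities to recursively defined functions -/

section Path

variable {V : Type*} [Fintype V] [MeasurableSpace V] [MeasurableSingletonClass V]
  {G : SimpleGraph V}

lemma update_apply_of_le {α : Type*} (ω : ℕ → α) {i k : ℕ} (h : i ≤ k) (y : α) :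
    Function.update ω (k + 1) y i = ω i :=
  Function.update_of_ne (by omega) _ _

/-- The walk on the cylinder moves vertically by at most one unit at each step. -/
lemma walkLaw_height_le (x : V × ℤ) (n : ℕ) :
    walkLaw (cylinder G) x {ω | ∃ i ≤ n, (i : ℤ) < |(ω i).2 - x.2|} = 0 := by
  classical
  let F : ℕ → (ℕ → V × ℤ) → ℝ≥0∞ := fun k ω =>
    if ∃ i ≤ k, (i : ℤ) < |(ω i).2 - x.2| then 1 else 0
  have hF0 : (F 0 fun _ => x) = 0 := by simp [F]
  have := walkLaw_le_of_supermartingale (cylinder G) x F n (S := {ω | ∃ i ≤ n, (i : ℤ) <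
    |(ω i).2 - x.2|}) (c := 1) ?_ ?_ one_ne_zero ENNReal.one_ne_top ?_
  · rw [hF0] at this
    simpa using this
  · intro k _ ω ω' h
    have : (∃ i ≤ k, (i : ℤ) < |(ω i).2 - x.2|) ↔ ∃ i ≤ k, (i : ℤ) < |(ω' i).2 - x.2| := by
      refine exists_congr fun i => and_congr_right fun hi => ?_
      rw [h i hi]
    simp only [F, this]
  · intro k _ ω
    by_cases hk : ∃ i ≤ k, (i : ℤ) < |(ω i).2 - x.2|
    · simp only [F, if_pos hk]
      refine (lintegral_mono (g := fun _ => 1) fun y => ?_).trans (by simp)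
      split_ifs <;> simp
    · rw [lintegral_step_cylinder, Finset.sum_eq_zero]
      · simp
      intro y hy
      rw [mem_cylNbrs, cylinder_adj] at hy
      simp only [F]
      rw [if_neg]
      push Not at hk ⊢
      intro i hi
      rcases hi.lt_or_eq with hi | rfl
      · rw [update_apply_of_le ω (by omega)]; exact hk i (by omega)
      · have h := hk k le_rfl
        rw [Function.update_self]
        rw [abs_le] at h ⊢
        push_cast
        omega
  · intro ω hω
    exact (if_pos hω).ge

open Classical in
/-- Number of visits to `C` up to time `n` along a path. -/
def visitCount (C : Set (V × ℤ)) (n : ℕ) (ω : ℕ → V × ℤ) : ℕ :=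
  ((Finset.range (n + 1)).filter fun i => ω i ∈ C).card

/-- Exponential tail of the number of visits to a set, given a uniform bound on its mean. -/
lemma walkLaw_visitCount_ge (x : V × ℤ) (C : Set (V × ℤ)) (n : ℕ) {m : ℝ} (hm : 0 < m)
    (hv : ∀ y, visits G C n y ≤ m) (u : ℕ) :
    walkLaw (cylinder G) x {ω | u ≤ visitCount C n ω} ≤
      ENNReal.ofReal (2 / (1 + 1 / (2 * m)) ^ u) := by
  classical
  set s : ℝ := 1 + 1 / (2 * m) with hs
  have hs1 : 1 ≤ s := by rw [hs]; have : 0 ≤ 1 / (2 * m) := by positivity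
                         linarith
  have hs0 : 0 < s := by linarith
  let e : ℕ → V × ℤ → ℝ := fun k y => 1 + m⁻¹ * visits G C k y
  have he0 : ∀ k y, 0 ≤ e k y := fun k y => by
    have := visits_nonneg (G := G) (C := C) k y
    positivity
  have he1 : ∀ k y, 1 ≤ e k y := fun k y => by
    have := visits_nonneg (G := G) (C := C) k y
    have : 0 ≤ m⁻¹ * visits G C k y := by positivity
    simp only [e]; linarith
  have hb : ∀ k ≤ n, ∀ y, m⁻¹ * visits G C k y ≤ 1 := fun k hk y => by
    have h1 := (visits_mono_time hk y).trans (hv y)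
    rw [inv_mul_le_iff₀ hm]; linarith
  have hstep : ∀ k < n, ∀ y, y ∈ C → s * avg G (e k) y ≤ e (k + 1) y := by
    intro k hk y hy
    have h1 : avg G (e k) y = 1 + m⁻¹ * (visits G C (k + 1) y - 1) := by
      simp only [e]
      rw [avg_add (fun _ => 1), avg_const, avg_mul_left, visits, if_pos hy]
      ring
    have h2 := hb (k + 1) hk y
    rw [h1]
    simp only [e]
    set t := m⁻¹ * visits G C (k + 1) y
    have h3 : 1 + m⁻¹ * (visits G C (k + 1) y - 1) = 1 + t - m⁻¹ := by simp only [t]; ring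
    rw [h3]
    have h4 : s = 1 + m⁻¹ / 2 := by rw [hs]; field_simp
    have h5 : 0 < m⁻¹ := by positivity
    rw [h4]
    nlinarith
  have hstep' : ∀ k y, y ∉ C → avg G (e k) y = e (k + 1) y := by
    intro k y hy
    simp only [e]
    rw [avg_add (fun _ => 1), avg_const, avg_mul_left, visits, if_neg hy, zero_add]
  let cnt : ℕ → (ℕ → V × ℤ) → ℕ := fun k ω => ((Finset.range k).filter fun i => ω i ∈ C).card
  have hcnt : ∀ k (ω ω' : ℕ → V × ℤ), (∀ i < k, ω i = ω' i) → cnt k ω = cnt k ω' := by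
    intro k ω ω' h
    simp only [cnt]
    congr 1
    refine Finset.filter_congr fun i hi => ?_
    rw [h i (Finset.mem_range.1 hi)]
  have hcnt_succ : ∀ k (ω : ℕ → V × ℤ), cnt (k + 1) ω = cnt k ω + if ω k ∈ C then 1 else 0 := by
    intro k ω
    simp only [cnt]
    rw [Finset.range_add_one, Finset.filter_insert]
    split_ifs
    · rw [Finset.card_insert_of_notMem (by simp)]
    · rfl
  -- An exponential supermartingale. A visit gains a factor `s` but lowers the expected remaining
  -- count by one, hence `e` by `1/m`. Since `e ≤ 2` and `s = 1 + 1/(2m)`, one has `s (e - 1/m) ≤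
  -- e`.
  let F : ℕ → (ℕ → V × ℤ) → ℝ≥0∞ := fun k ω =>
    ENNReal.ofReal (s ^ cnt k ω * e (n - k) (ω k))
  have key := walkLaw_le_of_supermartingale (cylinder G) x F n
    (S := {ω | u ≤ visitCount C n ω}) (c := ENNReal.ofReal (s ^ u)) ?_ ?_ ?_ ?_ ?_
  · refine key.trans ?_
    rw [← ENNReal.ofReal_div_of_pos (by positivity)]
    apply ENNReal.ofReal_le_ofReal
    have := hb n le_rfl x
    simp only [cnt, Finset.range_zero, Finset.filter_empty, Finset.card_empty, pow_zero, one_mul,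
      Nat.sub_zero, e]
    gcongr
    linarith
  · intro k _ ω ω' h
    simp only [F]
    rw [hcnt k ω ω' fun i hi => h i (by simp; omega), h k (by simp)]
  · intro k hk ω
    have hc : ∀ y, cnt (k + 1) (Function.update ω (k + 1) y) = cnt (k + 1) ω := fun y =>
      hcnt _ _ _ fun i hi => update_apply_of_le ω (by omega) y
    simp only [F, hc, Function.update_self]
    rw [lintegral_step_cylinder_ofReal (ω k) (F := fun y => s ^ cnt (k + 1) ω * e (n - (k + 1)) y)
      (fun y => mul_nonneg (by positivity) (he0 _ _)), avg_mul_left]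
    apply ENNReal.ofReal_le_ofReal
    obtain ⟨l, hl⟩ : ∃ l, n - k = l + 1 := ⟨n - k - 1, by omega⟩
    have hl' : n - (k + 1) = l := by omega
    rw [hl, hl', hcnt_succ]
    by_cases hC : ω k ∈ C
    · rw [if_pos hC, pow_succ, mul_assoc]
      have := hstep l (by omega) (ω k) hC
      gcongr
    · rw [if_neg hC, add_zero, hstep' l _ hC]
  · simp only [ne_eq, ENNReal.ofReal_eq_zero, not_le]; positivity
  · exact ENNReal.ofReal_ne_top
  · intro ω hω
    apply ENNReal.ofReal_le_ofReal
    have h1 : visitCount C n ω ≤ cnt n ω + if ω n ∈ C then 1 else 0 := by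
      rw [← hcnt_succ]; rfl
    have hω' : u ≤ visitCount C n ω := hω
    simp only [Nat.sub_self]
    by_cases hC : ω n ∈ C
    · rw [if_pos hC] at h1
      -- `cnt n` omits the visit at time `n` itself; its factor `s` is paid by `e 0` on `C`.
      have he : s ≤ e 0 (ω n) := by
        simp only [e, visits, if_pos hC, hs]
        have : 1 / (2 * m) ≤ m⁻¹ * 1 := by
          rw [mul_one, one_div]; gcongr; linarith
        linarith
      calc s ^ u ≤ s ^ (cnt n ω + 1) := pow_le_pow_right₀ hs1 (hω'.trans h1)
        _ = s ^ cnt n ω * s := pow_succ _ _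
        _ ≤ _ := by gcongr
    · rw [if_neg hC] at h1
      calc s ^ u ≤ s ^ cnt n ω := pow_le_pow_right₀ hs1 (hω'.trans h1)
        _ = s ^ cnt n ω * 1 := (mul_one _).symm
        _ ≤ _ := by gcongr; exact he1 _ _

/-- Probability to visit `U` and later `U'`, in terms of a time-dependent supersolution. -/
lemma walkLaw_visit_then_visit_le (x : V × ℤ) (U U' : Set (V × ℤ)) (n : ℕ)
    (φ : ℕ → V × ℤ → ℝ) (hφ0 : ∀ k y, 0 ≤ φ k y) (hφ : ∀ k y, avg G (φ k) y ≤ φ (k + 1) y)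
    (hU' : ∀ k, ∀ y ∈ U', 1 ≤ φ k y) {s : ℝ} (hU : ∀ k ≤ n, ∀ y ∈ U, φ k y ≤ s) :
    walkLaw (cylinder G) x {ω | ∃ j ≤ n, ∃ i ≤ j, ω i ∈ U ∧ ω j ∈ U'} ≤ ENNReal.ofReal s := by
  classical
  -- Three phases: the constant `s` before `U` is visited, the supersolution with the remaining time
  -- while waiting for `U'`, and `1` after success. The hypotheses on `U` and `U'` say that `F` does
  -- not increase at the two changes of phase.
  let F : ℕ → (ℕ → V × ℤ) → ℝ≥0∞ := fun k ω =>
    if ∃ j ≤ k, ∃ i ≤ j, ω i ∈ U ∧ ω j ∈ U' then 1 else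
      if ∃ i ≤ k, ω i ∈ U then ENNReal.ofReal (φ (n - k) (ω k)) else ENNReal.ofReal s
  have hle_s : ∀ k ≤ n, ∀ y ∈ U, ENNReal.ofReal (φ k y) ≤ ENNReal.ofReal s :=
    fun k hk y hy => ENNReal.ofReal_le_ofReal (hU k hk y hy)
  have hone : ∀ k, ∀ y ∈ U', 1 ≤ ENNReal.ofReal (φ k y) := fun k y hy => by
    rw [← ENNReal.ofReal_one]; exact ENNReal.ofReal_le_ofReal (hU' k y hy)
  have key := walkLaw_le_of_supermartingale (cylinder G) x F n
    (S := {ω | ∃ j ≤ n, ∃ i ≤ j, ω i ∈ U ∧ ω j ∈ U'}) (c := 1) ?_ ?_ one_ne_zero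
    ENNReal.one_ne_top ?_
  · refine key.trans ?_
    rw [div_one]
    simp only [F]
    split_ifs with h1 h2
    · obtain ⟨j, hj, i, hi, hxU, hxU'⟩ := h1
      exact (hone n x hxU').trans (hle_s n le_rfl x hxU)
    · obtain ⟨i, hi, hxU⟩ := h2
      exact hle_s n le_rfl x hxU
    · exact le_rfl
  · intro k _ ω ω' h
    have e1 : (∃ j ≤ k, ∃ i ≤ j, ω i ∈ U ∧ ω j ∈ U') ↔
        ∃ j ≤ k, ∃ i ≤ j, ω' i ∈ U ∧ ω' j ∈ U' := by
      refine exists_congr fun j => and_congr_right fun hj => exists_congr fun i =>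
        and_congr_right fun hi => ?_
      rw [h i (hi.trans hj), h j hj]
    have e2 : (∃ i ≤ k, ω i ∈ U) ↔ ∃ i ≤ k, ω' i ∈ U := by
      refine exists_congr fun j => and_congr_right fun hj => ?_
      rw [h j hj]
    simp only [F, e1, e2, h k (Set.mem_Iic.2 le_rfl)]
  · intro k hk ω
    by_cases h1 : ∃ j ≤ k, ∃ i ≤ j, ω i ∈ U ∧ ω j ∈ U'
    · have h1' : F k ω = 1 := if_pos h1
      obtain ⟨j, hj, i, hi, h2, h3⟩ := h1
      rw [h1']
      refine (lintegral_mono (g := fun _ => 1) fun y => ?_).trans (by simp)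
      simp only [F]
      rw [if_pos ⟨j, by omega, i, hi, by rwa [update_apply_of_le ω (by omega)],
        by rwa [update_apply_of_le ω (by omega)]⟩]
    · by_cases h2 : ∃ i ≤ k, ω i ∈ U
      · have h2' : F k ω = ENNReal.ofReal (φ (n - k) (ω k)) := by
          simp only [F]; rw [if_neg h1, if_pos h2]
        obtain ⟨i, hi, hiU⟩ := h2
        rw [h2']
        have hk' : n - k = n - (k + 1) + 1 := by omega
        refine le_trans (lintegral_mono (g := fun y => ENNReal.ofReal (φ (n - (k + 1)) y))
          fun y => ?_) ?_
        · simp only [F]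
          split_ifs with h3 h4
          · obtain ⟨j, hj, l, hl, h5, h6⟩ := h3
            rcases hj.lt_or_eq with hj | rfl
            · rw [update_apply_of_le ω (by omega)] at h5 h6
              exact absurd ⟨j, by omega, l, hl, h5, h6⟩ h1
            · rw [Function.update_self] at h6
              exact hone _ _ h6
          · rw [Function.update_self]
          · exact absurd ⟨i, by omega, by rwa [update_apply_of_le ω (by omega)]⟩ h4
        · rw [lintegral_step_cylinder_ofReal _ (hφ0 _), hk']
          exact ENNReal.ofReal_le_ofReal (hφ _ _)
      · have h2' : F k ω = ENNReal.ofReal s := by simp only [F]; rw [if_neg h1, if_neg h2]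
        rw [h2']
        refine (lintegral_mono (g := fun _ => ENNReal.ofReal s) fun y => ?_).trans (by simp)
        simp only [F]
        have hnew : ∀ i ≤ k + 1, Function.update ω (k + 1) y i ∈ U → i = k + 1 := by
          intro i hi hiU
          by_contra hne
          rw [update_apply_of_le ω (by omega)] at hiU
          exact h2 ⟨i, by omega, hiU⟩
        split_ifs with h3 h4
        · obtain ⟨j, hj, l, hl, h5, h6⟩ := h3
          have hl' := hnew l (by omega) h5
          have hj' : j = k + 1 := by omega
          subst hl' hj'
          rw [Function.update_self] at h5 h6
          exact (hone (n - (k + 1)) y h6).trans (hle_s _ (by omega) y h5)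
        · obtain ⟨i, hi, hiU⟩ := h4
          have hi' := hnew i hi hiU
          subst hi'
          rw [Function.update_self] at hiU ⊢
          exact hle_s _ (by omega) y hiU
        · exact le_rfl
  · intro ω hω
    exact (if_pos hω).ge

/-- The function `hit` is bounded by the probability it describes. -/
lemma ofReal_hit_le_walkLaw (U D : Set (V × ℤ)) (n : ℕ) (x : V × ℤ) :
    ENNReal.ofReal (hit G U D n x) ≤
      walkLaw (cylinder G) x {ω | ∃ j ≤ n, ω j ∈ U ∧ ∀ i < j, ω i ∈ D} := by
  classical
  let S : ℕ → Set (ℕ → V × ℤ) := fun k => {ω | ∃ j ≤ k, ω j ∈ U ∧ ∀ i < j, ω i ∈ D}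
  let R : ℕ → Set (ℕ → V × ℤ) := fun k => {ω | (∀ i ≤ k, ω i ∉ U) ∧ ∀ i < k, ω i ∈ D}
  let F : ℕ → (ℕ → V × ℤ) → ℝ≥0∞ := fun k ω =>
    if ω ∈ S k then 1 else if ω ∈ R k then ENNReal.ofReal (hit G U D (n - k) (ω k)) else 0
  have hS : ∀ k (ω ω' : ℕ → V × ℤ), (∀ i ≤ k, ω i = ω' i) → ω ∈ S k → ω' ∈ S k := by
    rintro k ω ω' h ⟨j, hj, hjU, hD⟩
    exact ⟨j, hj, h j hj ▸ hjU, fun i hi => h i (by omega) ▸ hD i hi⟩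
  have hR : ∀ k (ω ω' : ℕ → V × ℤ), (∀ i ≤ k, ω i = ω' i) → ω ∈ R k → ω' ∈ R k := by
    rintro k ω ω' h ⟨h1, h2⟩
    exact ⟨fun i hi => h i hi ▸ h1 i hi, fun i hi => h i hi.le ▸ h2 i hi⟩
  have hdep : ∀ k ≤ n, DependsOn (F k) (Set.Iic k) := by
    intro k _ ω ω' h
    have e1 : ω ∈ S k ↔ ω' ∈ S k :=
      ⟨hS k ω ω' fun i hi => h i hi, hS k ω' ω fun i hi => (h i hi).symm⟩
    have e2 : ω ∈ R k ↔ ω' ∈ R k :=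
      ⟨hR k ω ω' fun i hi => h i hi, hR k ω' ω fun i hi => (h i hi).symm⟩
    simp only [F, e1, e2, h k (Set.mem_Iic.2 le_rfl)]
  have key := le_lintegral_of_submartingale (cylinder G) x F n hdep ?_
  · have h0 : ENNReal.ofReal (hit G U D n x) ≤ F 0 fun _ => x := by
      by_cases hx : x ∈ U
      · have : (fun _ => x) ∈ S 0 := ⟨0, le_rfl, hx, fun i hi => by omega⟩
        simp only [F]
        rw [if_pos this, ← ENNReal.ofReal_one]
        exact ENNReal.ofReal_le_ofReal (hit_le_one _ _)
      · have h1 : (fun _ => x) ∉ S 0 := fun ⟨j, _, hj, _⟩ => hx hj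
        have h2 : (fun _ => x) ∈ R 0 := ⟨fun _ _ => hx, fun i hi => by omega⟩
        simp only [F]
        rw [if_neg h1, if_pos h2, Nat.sub_zero]
    refine h0.trans (key.trans ?_)
    have hm : MeasurableSet (S n) := by
      have hdepS : DependsOn ((S n).indicator (1 : (ℕ → V × ℤ) → ℝ≥0∞)) (Set.Iic n) := by
        intro ω ω' h
        have e1 : ω ∈ S n ↔ ω' ∈ S n :=
          ⟨hS n ω ω' fun i hi => h i hi, hS n ω' ω fun i hi => (h i hi).symm⟩
        simp only [Set.indicator_apply, e1, Pi.one_apply]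
      have := (measurable_of_dependsOn_Iic hdepS) (measurableSet_singleton 1)
      convert this using 1
      ext ω
      by_cases h : ω ∈ S n <;> simp [h]
    change _ ≤ walkLaw (cylinder G) x (S n)
    rw [← lintegral_indicator_one hm]
    refine lintegral_mono fun ω => ?_
    by_cases h : ω ∈ S n
    · simp [F, h]
    · simp only [F, if_neg h, Nat.sub_self]
      by_cases h' : ω ∈ R n
      · rw [if_pos h', hit_zero_of_notMem (h'.1 n le_rfl)]; simp
      · simp [h']
  · intro k hk ω
    have hup : ∀ y, ∀ i ≤ k, ω i = Function.update ω (k + 1) y i := fun y i hi =>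
      (update_apply_of_le ω hi y).symm
    by_cases h1 : ω ∈ S k
    · have hF1 : F k ω = 1 := if_pos h1
      rw [hF1]
      refine le_trans (by simp) (lintegral_mono (f := fun _ => (1 : ℝ≥0∞)) fun y => ?_)
      have h2 : Function.update ω (k + 1) y ∈ S (k + 1) := by
        obtain ⟨j, hj, h⟩ := hS k ω _ (hup y) h1
        exact ⟨j, by omega, h⟩
      simp only [F]
      rw [if_pos h2]
    by_cases h2 : ω ∈ R k
    · have hF2 : F k ω = ENNReal.ofReal (hit G U D (n - k) (ω k)) := by
        simp only [F]; rw [if_neg h1, if_pos h2]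
      rw [hF2]
      by_cases hD : ω k ∈ D
      · have hk' : n - k = n - (k + 1) + 1 := by omega
        rw [hk', hit_succ (h2.1 k le_rfl) hD, ← lintegral_step_cylinder_ofReal _
          (fun y => hit_nonneg _ y)]
        refine lintegral_mono fun y => ?_
        by_cases hy : y ∈ U
        · have h3 : Function.update ω (k + 1) y ∈ S (k + 1) := by
            refine ⟨k + 1, le_rfl, by rwa [Function.update_self], fun i hi => ?_⟩
            rw [update_apply_of_le ω (by omega)]
            rcases (Nat.lt_succ_iff.1 hi).lt_or_eq with hi | rfl
            · exact h2.2 i hi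
            · exact hD
          simp only [F]
          rw [if_pos h3, ← ENNReal.ofReal_one]
          exact ENNReal.ofReal_le_ofReal (hit_le_one _ _)
        · have h3 : Function.update ω (k + 1) y ∈ R (k + 1) := by
            refine ⟨fun i hi => ?_, fun i hi => ?_⟩
            · rcases hi.lt_or_eq with hi | rfl
              · rw [update_apply_of_le ω (by omega)]; exact h2.1 i (by omega)
              · rwa [Function.update_self]
            · rw [update_apply_of_le ω (by omega)]
              rcases (Nat.lt_succ_iff.1 hi).lt_or_eq with hi | rfl
              · exact h2.2 i hi
              · exact hD
          have h4 : Function.update ω (k + 1) y ∉ S (k + 1) := by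
            rintro ⟨j, hj, hjU, _⟩
            exact h3.1 j hj hjU
          simp only [F]
          rw [if_neg h4, if_pos h3, Function.update_self]
      · rw [hit_of_notMem (h2.1 k le_rfl) hD]; simp
    · have : F k ω = 0 := by simp only [F]; rw [if_neg h1, if_neg h2]
      rw [this]; exact zero_le

/-- The inclusion `U ⊆ D` makes the inequality between the two times strict: the walk is still in
`D` when it enters `U`. -/
lemma ofReal_hit_le_entrance_lt_exit {U D : Set (V × ℤ)} (hUD : U ⊆ D) (n : ℕ) (x : V × ℤ) :
    ENNReal.ofReal (hit G U D n x) ≤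
      walkLaw (cylinder G) x {ω | entranceTime U ω < exitTime D ω} := by
  refine (ofReal_hit_le_walkLaw U D n x).trans (measure_mono ?_)
  rintro ω ⟨j, _, hjU, hjD⟩
  have h1 : entranceTime U ω ≤ j := iInf₂_le j hjU
  have h2 : ((j + 1 : ℕ) : ℕ∞) ≤ exitTime D ω := by
    refine le_iInf₂ fun i hi => ?_
    have : j + 1 ≤ i := by
      by_contra hlt
      rcases (by omega : i < j ∨ i = j) with h | rfl
      · exact hi (hjD i h)
      · exact hi (hUD hjU)
    exact_mod_cast this
  refine lt_of_le_of_lt h1 (lt_of_lt_of_le ?_ h2)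
  exact_mod_cast Nat.lt_succ_self j

/-- Transfers the heat kernel hypothesis from paths to matrix powers. Only this inequality is
needed, so a submartingale suffices. -/
lemma killedMatrix_pow_le_walkLaw [DecidableEq V] (hG : ∀ g, (nbrs G g).Nonempty) (A : Finset V) (n : ℕ)
    {g : V} (hg : g ∈ A) (g₀ : V) :
    (killedMatrix G A ^ n) g g₀ ≤
      (walkLaw G g).real {ω | ω n = g₀ ∧ (n : ℕ∞) < exitTime (A : Set V) ω} := by
  let F : ℕ → (ℕ → V) → ℝ≥0∞ := fun k ω =>
    if ∀ i ≤ k, ω i ∈ A then ENNReal.ofReal ((killedMatrix G A ^ (n - k)) (ω k) g₀) else 0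
  have hdep : ∀ k ≤ n, DependsOn (F k) (Set.Iic k) := by
    intro k _ ω ω' h
    have e1 : (∀ i ≤ k, ω i ∈ A) ↔ ∀ i ≤ k, ω' i ∈ A := by
      refine forall_congr' fun i => forall_congr' fun hi => ?_
      rw [h i hi]
    simp only [F, e1, h k (Set.mem_Iic.2 le_rfl)]
  have key := le_lintegral_of_submartingale G g F n hdep ?_
  · have h0 : (F 0 fun _ => g) = ENNReal.ofReal ((killedMatrix G A ^ n) g g₀) := by
      simp [F, hg]
    let S : Set (ℕ → V) := {ω | ω n = g₀ ∧ (n : ℕ∞) < exitTime (A : Set V) ω}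
    have hle : ∫⁻ ω, F n ω ∂walkLaw G g ≤ walkLaw G g S := by
      have hset : MeasurableSet {ω : ℕ → V | 1 ≤ F n ω} :=
        (measurable_of_dependsOn_Iic (hdep n le_rfl)) measurableSet_Ici
      calc ∫⁻ ω, F n ω ∂walkLaw G g
          ≤ ∫⁻ ω, {ω : ℕ → V | 1 ≤ F n ω}.indicator 1 ω ∂walkLaw G g := by
            refine lintegral_mono fun ω => ?_
            by_cases h : ∀ i ≤ n, ω i ∈ A
            · by_cases h' : ω n = g₀
              · have : F n ω = 1 := by simp [F, if_pos h, h']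
                simp [this]
              · have : F n ω = 0 := by simp [F, h']
                simp [this]
            · have : F n ω = 0 := by simp only [F]; rw [if_neg h]
              simp [this]
        _ = walkLaw G g {ω : ℕ → V | 1 ≤ F n ω} := lintegral_indicator_one hset
        _ ≤ walkLaw G g S := by
          refine measure_mono fun ω hω => ?_
          have hω' : 1 ≤ F n ω := hω
          by_cases h : ∀ i ≤ n, ω i ∈ A
          · by_cases h' : ω n = g₀
            · refine ⟨h', ?_⟩
              have h2 : ((n + 1 : ℕ) : ℕ∞) ≤ exitTime (A : Set V) ω := by
                refine le_iInf₂ fun i hi => ?_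
                have : n + 1 ≤ i := by
                  by_contra hlt
                  exact hi (h i (by omega))
                exact_mod_cast this
              refine lt_of_lt_of_le ?_ h2
              exact_mod_cast Nat.lt_succ_self n
            · have : F n ω = 0 := by simp [F, h']
              rw [this] at hω'
              simp at hω'
          · have : F n ω = 0 := by simp only [F]; rw [if_neg h]
            rw [this] at hω'
            simp at hω'
    rw [h0] at key
    have := key.trans hle
    exact (ENNReal.ofReal_le_iff_le_toReal (measure_ne_top _ _)).1 this
  · intro k hk ω
    by_cases h : ∀ i ≤ k, ω i ∈ A
    · have hk' : n - k = n - (k + 1) + 1 := by omega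
      have hcard : 0 < (nbrs G (ω k)).card := Finset.card_pos.2 (hG _)
      have hFk : F k ω = ENNReal.ofReal ((killedMatrix G A ^ (n - k)) (ω k) g₀) := if_pos h
      have hF' : ∀ y, F (k + 1) (Function.update ω (k + 1) y) =
          ENNReal.ofReal (if y ∈ A then (killedMatrix G A ^ (n - (k + 1))) y g₀ else 0) := by
        intro y
        have e1 : (∀ i ≤ k + 1, Function.update ω (k + 1) y i ∈ A) ↔ y ∈ A := by
          constructor
          · intro h'
            simpa using h' (k + 1) le_rfl
          · intro hy i hi
            rcases hi.lt_or_eq with hi | rfl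
            · rw [update_apply_of_le ω (by omega)]; exact h i (by omega)
            · rwa [Function.update_self]
        simp only [F, e1, Function.update_self]
        split_ifs <;> simp
      rw [hFk]
      simp only [hF']
      rw [lintegral_stepMeasure G (ω k) (nbrs G (ω k)) (fun y => mem_nbrs G) (hG _),
        ← ENNReal.ofReal_sum_of_nonneg, ← ENNReal.ofReal_natCast,
        ← ENNReal.ofReal_div_of_pos (by positivity)]
      · apply ENNReal.ofReal_le_ofReal
        rw [hk', pow_succ', Matrix.mul_apply, div_eq_inv_mul, Finset.mul_sum]
        simp only [nbrs]
        rw [Finset.sum_filter]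
        refine Finset.sum_le_sum fun y _ => ?_
        have hkA := h k le_rfl
        by_cases hy : y ∈ A <;> by_cases hadj : G.Adj (ω k) y <;>
          simp [killedMatrix, hkA, hy, hadj, nbrs]
      · intro y _
        split_ifs
        · exact killedMatrix_pow_nonneg _ _ _ _
        · exact le_rfl
    · have : F k ω = 0 := by simp only [F]; rw [if_neg h]
      rw [this]; exact zero_le

end Path

/-! ### Linked vertex sets of prescribed size -/

section Linked

variable {V : Type*} {G : SimpleGraph V}

/-- Every splitting of `W` into two nonempty parts is crossed by an edge. -/
def Linked (G : SimpleGraph V) (W : Finset V) : Prop :=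
  ∀ s : Set V, ∀ a ∈ W, a ∈ s → ∀ b ∈ W, b ∉ s → ∃ c ∈ W, c ∈ s ∧ ∃ d ∈ W, d ∉ s ∧ G.Adj c d

lemma linked_of_connected {W : Finset V} (hW : (G.induce (W : Set V)).Connected) :
    Linked G W := by
  intro s a ha has b hb hbs
  obtain ⟨p⟩ := hW.preconnected ⟨a, ha⟩ ⟨b, hb⟩
  obtain ⟨d, _, h1, h2⟩ := p.exists_boundary_dart (Subtype.val ⁻¹' s) has hbs
  exact ⟨d.fst, d.fst.2, h1, d.snd, d.snd.2, h2, d.adj⟩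

lemma Linked.insert [DecidableEq V] {W : Finset V} (hW : Linked G W) {a b : V} (ha : a ∈ W)
    (hab : G.Adj a b) : Linked G (Insert.insert b W) := by
  intro s c hc hcs d hd hds
  by_cases h1 : ∃ c' ∈ W, c' ∈ s
  · obtain ⟨c', hc', hc's⟩ := h1
    by_cases h2 : ∃ d' ∈ W, d' ∉ s
    · obtain ⟨d', hd', hd's⟩ := h2
      obtain ⟨x, hx, hxs, y, hy, hys, hxy⟩ := hW s c' hc' hc's d' hd' hd's
      exact ⟨x, Finset.mem_insert_of_mem hx, hxs, y, Finset.mem_insert_of_mem hy, hys, hxy⟩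
    · push Not at h2
      have hb : d = b := (Finset.mem_insert.1 hd).resolve_right fun h => hds (h2 d h)
      subst hb
      exact ⟨a, Finset.mem_insert_of_mem ha, h2 a ha, d, hd, hds, hab⟩
  · push Not at h1
    have hb : c = b := (Finset.mem_insert.1 hc).resolve_right fun h => h1 c h hcs
    subst hb
    exact ⟨c, hc, hcs, a, Finset.mem_insert_of_mem ha, h1 a ha, hab.symm⟩

/-- Greedy growth from one vertex: linkedness of `W` provides an edge leaving any nonempty proper
subset, and adding its endpoint preserves linkedness. -/
lemma Linked.exists_subset_card {W : Finset V} (hW : Linked G W) {w : ℕ} (hw : 1 ≤ w)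
    (hwW : w ≤ W.card) : ∃ W' ⊆ W, W'.card = w ∧ Linked G W' := by
  classical
  induction w, hw using Nat.le_induction with
  | base =>
    obtain ⟨a, ha⟩ : W.Nonempty := Finset.card_pos.1 hwW
    refine ⟨{a}, by simpa using ha, Finset.card_singleton a, ?_⟩
    intro s c hc hcs d hd hds
    rw [Finset.mem_singleton] at hc hd
    subst hc hd
    exact absurd hcs hds
  | succ w hw ih =>
    obtain ⟨W', hsub, hcard, hl⟩ := ih (by omega)
    obtain ⟨a, ha⟩ : W'.Nonempty := Finset.card_pos.1 (by omega)
    obtain ⟨b, hb, hb'⟩ : ∃ b ∈ W, b ∉ W' := Finset.exists_mem_notMem_of_card_lt_card (by omega)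
    obtain ⟨c, _, hc, d, hd, hd', hcd⟩ := hW (W' : Set V) a (hsub ha) ha b hb hb'
    refine ⟨Insert.insert d W', Finset.insert_subset hd hsub, ?_, hl.insert hc hcd⟩
    rw [Finset.card_insert_of_notMem hd', hcard]

end Linked

/-! ### Geometry of disconnecting sets -/

section Separation

variable {V : Type*} {G : SimpleGraph V}

lemma exists_consecutive {p : ℤ → Prop} {lo hi a b : ℤ} (ha : lo ≤ a ∧ a ≤ hi)
    (hb : lo ≤ b ∧ b ≤ hi) (hpa : p a) (hpb : ¬ p b) :
    ∃ z z', (z' = z + 1 ∨ z' = z - 1) ∧ lo ≤ z' ∧ z' ≤ hi ∧ p z ∧ ¬ p z' := by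
  by_contra hcon
  push Not at hcon
  have up : ∀ k : ℕ, a + k ≤ hi → p (a + k) := by
    intro k
    induction k with
    | zero => intro _; simpa using hpa
    | succ k ih =>
      intro hk
      push_cast at hk ⊢
      have := hcon (a + k) (a + k + 1) (Or.inl rfl) (by omega) (by omega) (ih (by omega))
      rwa [← add_assoc]
  have down : ∀ k : ℕ, lo ≤ a - k → p (a - k) := by
    intro k
    induction k with
    | zero => intro _; simpa using hpa
    | succ k ih =>
      intro hk
      push_cast at hk ⊢
      have := hcon (a - k) (a - k - 1) (Or.inr rfl) (by omega) (by omega) (ih (by omega))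
      rwa [← sub_sub]
  rcases le_total a b with h | h
  · have := up (b - a).toNat (by omega)
    rw [show a + ((b - a).toNat : ℤ) = b by omega] at this
    exact hpb this
  · have := down (a - b).toNat (by omega)
    rw [show a - ((a - b).toNat : ℤ) = b by omega] at this
    exact hpb this

/-- `T` is the upper side of a separation of the cylinder by `S`. -/
structure IsUpperSide (G : SimpleGraph V) (S T : Set (V × ℤ)) (M : ℤ) : Prop where
  top : ∀ x : V × ℤ, M ≤ x.2 → x ∈ T
  bot : ∀ x : V × ℤ, x.2 ≤ -M → x ∉ T
  boundary : ∀ x ∈ T, ∀ y ∉ T, (cylinder G).Adj x y → y ∈ S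

/-- The upper component serves as `T`: a neighbour of it outside `S` would belong to it. Only this
one-sided boundary property is used afterwards. -/
lemma Disconnects.exists_isUpperSide {S : Set (V × ℤ)} (h : Disconnects G S) :
    ∃ T M, IsUpperSide G S T M := by
  obtain ⟨M, K₁, K₂, hne, h1, h2⟩ := h.exists
  refine ⟨Subtype.val '' K₁.supp, M, fun x hx => h1 hx, ?_, ?_⟩
  · rintro x hx ⟨y, hy, rfl⟩
    obtain ⟨y', hy', hyy⟩ := h2 hx
    have : y' = y := Subtype.ext hyy
    subst this
    rw [SimpleGraph.ConnectedComponent.mem_supp_iff] at hy hy'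
    exact hne (hy ▸ hy')
  · rintro _ ⟨x, hx, rfl⟩ y hy hadj
    by_contra hyS
    refine hy ⟨⟨y, hyS⟩, ?_, rfl⟩
    rw [SimpleGraph.ConnectedComponent.mem_supp_iff] at hx ⊢
    rw [← hx]
    refine SimpleGraph.ConnectedComponent.sound (SimpleGraph.Adj.reachable ?_)
    rw [SimpleGraph.comap_adj]
    exact hadj.symm

variable {S T : Set (V × ℤ)} {M : ℤ}

lemma cylinder_adj_vertical (g : V) {z z' : ℤ} (h : z' = z + 1 ∨ z' = z - 1) :
    (cylinder G).Adj (g, z) (g, z') := by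
  rw [cylinder, SimpleGraph.boxProd_adj]
  exact Or.inr ⟨hasse_int_adj.2 h, rfl⟩

lemma cylinder_adj_horizontal {g g' : V} (h : G.Adj g g') (z : ℤ) :
    (cylinder G).Adj (g, z) (g', z) := by
  rw [cylinder, SimpleGraph.boxProd_adj]
  exact Or.inl ⟨h, rfl⟩

lemma IsUpperSide.exists_mem_of_mixed (h : IsUpperSide G S T M) (g : V) {lo hi a b : ℤ}
    (ha : lo ≤ a ∧ a ≤ hi) (hb : lo ≤ b ∧ b ≤ hi) (hTa : (g, a) ∈ T) (hTb : (g, b) ∉ T) :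
    ∃ z, lo ≤ z ∧ z ≤ hi ∧ (g, z) ∈ S := by
  obtain ⟨z, z', hzz, h1, h2, h3, h4⟩ :=
    exists_consecutive (p := fun z => (g, z) ∈ T) ha hb hTa hTb
  exact ⟨z', h1, h2, h.boundary _ h3 _ h4 (cylinder_adj_vertical g hzz)⟩

/-- A set that disconnects the cylinder meets every fibre. -/
lemma Disconnects.exists_mem_fibre (h : Disconnects G S) (g : V) : ∃ z, (g, z) ∈ S := by
  obtain ⟨T, M, hT⟩ := h.exists_isUpperSide
  have h1 := hT.top (g, |M|) (le_abs_self M)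
  have h2 := hT.bot (g, -|M|) (neg_le_neg (le_abs_self M))
  have h0 := abs_nonneg M
  obtain ⟨z, _, _, hz⟩ := hT.exists_mem_of_mixed g (lo := -|M|) (hi := |M|) (a := |M|) (b := -|M|)
    ⟨by omega, le_rfl⟩ ⟨le_rfl, by omega⟩ h1 h2
  exact ⟨z, hz⟩

open Classical in
/-- A set that disconnects the cylinder has many points in some box over a linked set. -/
lemma Disconnects.exists_box (h : Disconnects G S) {W : Finset V} (hW : Linked G W)
    (hcard : 1 ≤ W.card) :
    ∃ (j : ℤ) (Q : Finset (V × ℤ)), (∀ q ∈ Q, q ∈ S) ∧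
      (∀ q ∈ Q, q.1 ∈ W ∧ |q.2 - j| ≤ (W.card : ℤ)) ∧ W.card ≤ 2 * Q.card := by
  obtain ⟨T, M, hT⟩ := h.exists_isUpperSide
  set w := W.card with hw
  let E : ℤ → Finset V := fun j => W.filter fun g => ∃ z, j - w ≤ z ∧ z ≤ j + w ∧ (g, z) ∈ T
  have hmixed : ∀ (j : ℤ) (X : Finset V), X ⊆ W → w ≤ 2 * X.card →
      (∀ g ∈ X, ∃ z, j - w ≤ z ∧ z ≤ j + w ∧ (g, z) ∈ S) →
      ∃ (j : ℤ) (Q : Finset (V × ℤ)), (∀ q ∈ Q, q ∈ S) ∧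
      (∀ q ∈ Q, q.1 ∈ W ∧ |q.2 - j| ≤ (w : ℤ)) ∧ w ≤ 2 * Q.card := by
    intro j X hX hXc hXS
    choose! f hf1 hf2 hf3 using hXS
    refine ⟨j, X.image fun g => (g, f g), ?_, ?_, ?_⟩
    · intro q hq
      obtain ⟨g, hg, rfl⟩ := Finset.mem_image.1 hq
      exact hf3 g hg
    · intro q hq
      obtain ⟨g, hg, rfl⟩ := Finset.mem_image.1 hq
      refine ⟨hX hg, ?_⟩
      have h1 := hf1 g hg
      have h2 := hf2 g hg
      rw [abs_le]
      constructor <;> simp only <;> omega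
    · rwa [Finset.card_image_of_injective]
      intro a b hab
      exact congrArg Prod.fst hab
  obtain ⟨j, hj, hmin⟩ := Int.exists_least_of_bdd (P := fun j => w ≤ 2 * (E j).card)
    ⟨-M - w, fun j hj => by
      by_contra hlt
      have : E j = ∅ := by
        refine Finset.filter_eq_empty_iff.2 ?_
        rintro g _ ⟨z, _, hz, hzT⟩
        exact hT.bot (g, z) (by simp only; omega) hzT
      rw [this, Finset.card_empty] at hj
      omega⟩
    ⟨M, by
      have : E M = W := Finset.filter_eq_self.2 fun g _ =>
        ⟨M, by omega, by omega, hT.top (g, M) le_rfl⟩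
      rw [this]; omega⟩
  have hj' : 2 * (E (j - 1)).card < w := by
    by_contra hcon
    have := hmin (j - 1) (by omega)
    omega
  by_cases hfull : ∃ g₁ ∈ W, ∀ z, j - w ≤ z → z ≤ j + w → (g₁, z) ∈ T
  · obtain ⟨g₁, hg₁, hfull⟩ := hfull
    by_cases hempty : ∃ g₂ ∈ W, ∀ z, j - w ≤ z → z ≤ j + w → (g₂, z) ∉ T
    · obtain ⟨g₂, hg₂, hempty⟩ := hempty
      have : Nonempty V := ⟨g₁⟩
      -- One fibre entirely in `T` and one entirely outside: linkedness yields a horizontal crossing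
      -- on each of the `2w + 1` levels.
      have hlev : ∀ z ∈ Finset.Icc (j - w) (j + w), ∃ d ∈ W, (d, z) ∈ S := by
        intro z hz
        rw [Finset.mem_Icc] at hz
        obtain ⟨c, _, hc, d, hd, hd', hcd⟩ := hW {g | (g, z) ∈ T} g₁ hg₁ (hfull z hz.1 hz.2)
          g₂ hg₂ (hempty z hz.1 hz.2)
        exact ⟨d, hd, hT.boundary _ hc _ hd' (cylinder_adj_horizontal hcd z)⟩
      choose! f hf1 hf2 using hlev
      refine ⟨j, (Finset.Icc (j - w) (j + w)).image fun z => (f z, z), ?_, ?_, ?_⟩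
      · intro q hq
        obtain ⟨g, hg, rfl⟩ := Finset.mem_image.1 hq
        exact hf2 g hg
      · intro q hq
        obtain ⟨z, hz, rfl⟩ := Finset.mem_image.1 hq
        refine ⟨hf1 z hz, ?_⟩
        rw [Finset.mem_Icc] at hz
        rw [abs_le]
        constructor <;> simp only <;> omega
      · rw [Finset.card_image_of_injective, Int.card_Icc]
        · omega
        · intro a b hab
          exact congrArg Prod.snd hab
    · push Not at hempty
      -- No fibre avoids `T`. By minimality of `j` more than half of them miss `T` in the window
      -- around `j - 1`, which contains level `j` because `w ≥ 1`; those fibres are mixed in the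
      -- window around `j`.
      refine hmixed j (W \ E (j - 1)) Finset.sdiff_subset ?_ ?_
      · have := Finset.le_card_sdiff (E (j - 1)) W
        omega
      · intro g hg
        rw [Finset.mem_sdiff] at hg
        obtain ⟨z, hz1, hz2, hzT⟩ := hempty g hg.1
        have hnot : (g, j) ∉ T := fun hmem =>
          hg.2 (Finset.mem_filter.2 ⟨hg.1, j, by omega, by omega, hmem⟩)
        exact hT.exists_mem_of_mixed g ⟨hz1, hz2⟩ ⟨by omega, by omega⟩ hzT hnot
  · push Not at hfull
    -- No fibre lies entirely in `T`, so all fibres counted by `E j` are mixed.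
    refine hmixed j (E j) (Finset.filter_subset _ _) hj ?_
    intro g hg
    obtain ⟨hgW, z, hz1, hz2, hzT⟩ := Finset.mem_filter.1 hg
    obtain ⟨z', hz1', hz2', hzT'⟩ := hfull g hgW
    exact hT.exists_mem_of_mixed g ⟨hz1, hz2⟩ ⟨hz1', hz2'⟩ hzT hzT'

/-- The disconnection time is an integer or infinite, so the real bound `r` may be replaced by its
integer part. -/
lemma exists_disconnects_of_disconnectionTime_le {ω : ℕ → V × ℤ} {r : ℝ}
    (h : (disconnectionTime G ω : ℝ≥0∞) ≤ ENNReal.ofReal r) :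
    ∃ k ≤ ⌊r⌋₊, Disconnects G (ω '' Set.Iic k) := by
  by_contra hcon
  push Not at hcon
  have h1 : ((⌊r⌋₊ + 1 : ℕ) : ℕ∞) ≤ disconnectionTime G ω := by
    refine le_iInf₂ fun k hk => ?_
    have : ⌊r⌋₊ + 1 ≤ k := by
      by_contra hlt
      exact hcon k (by omega) hk
    exact_mod_cast this
  have h2 : ((⌊r⌋₊ + 1 : ℕ) : ℝ≥0∞) ≤ ENNReal.ofReal r := by
    refine le_trans ?_ h
    exact_mod_cast ENat.toENNReal_le.2 h1
  rw [← ENNReal.ofReal_natCast] at h2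
  have h3 : r < ((⌊r⌋₊ + 1 : ℕ) : ℝ) := by push_cast; exact Nat.lt_floor_add_one r
  rcases le_or_gt r 0 with hr | hr
  · rw [ENNReal.ofReal_of_nonpos hr] at h2
    simp at h2
    have : (0 : ℝ) ≤ ⌊r⌋₊ := by positivity
    linarith
  · have := (ENNReal.ofReal_le_ofReal_iff hr.le).1 h2
    linarith

end Separation

/-! ### Disconnection forces many visits to some box -/

section Confinement

variable {V : Type*} [Fintype V]

/-- The box `W × [-|W|, |W|]`. -/
def box (W : Finset V) (w : ℕ) : Set (V × ℤ) := {x | x.1 ∈ W ∧ |x.2| ≤ (w : ℤ)}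

lemma card_le_visitCount {C : Set (V × ℤ)} {n k : ℕ} (hk : k ≤ n) {ω : ℕ → V × ℤ}
    {Q : Finset (V × ℤ)} (hQ : ∀ q ∈ Q, q ∈ ω '' Set.Iic k) (hQC : ∀ q ∈ Q, q ∈ C) :
    Q.card ≤ visitCount C n ω := by
  classical
  unfold visitCount
  refine (Finset.card_le_card (t := ((Finset.range (n + 1)).filter fun i => ω i ∈ C).image ω)
    fun q hq => ?_).trans Finset.card_image_le
  obtain ⟨i, hi, rfl⟩ := hQ q hq
  have hi' : i ≤ k := hi
  exact Finset.mem_image.2 ⟨i, Finset.mem_filter.2 ⟨Finset.mem_range.2 (by omega), hQC _ hq⟩, rfl⟩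

variable [MeasurableSpace V] [MeasurableSingletonClass V] {G : SimpleGraph V}

/-- Bound on the law of the disconnection time from a uniform bound on the expected number of
visits to a box over a linked set. -/
lemma walkLaw_disconnectionTime_le (x : V × ℤ) {W : Finset V} (hW : Linked G W)
    (hcard : 1 ≤ W.card) (r : ℝ) {m : ℝ} (hm : 0 < m)
    (hv : ∀ y, visits G (box W W.card) ⌊r⌋₊ y ≤ m) {u : ℕ} (hu : 2 * u ≤ W.card) :
    walkLaw (cylinder G) x {ω | (disconnectionTime G ω : ℝ≥0∞) ≤ ENNReal.ofReal r} ≤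
      ENNReal.ofReal ((2 * (⌊r⌋₊ + W.card) + 1) * (2 / (1 + 1 / (2 * m)) ^ u)) := by
  set n := ⌊r⌋₊
  set w := W.card with hw
  -- The possible centres of the box: it contains a visited point, at vertical distance at most `w`
  -- from the centre and at most `n` from the start.
  let J : Finset ℤ := Finset.Icc (x.2 - (n + w)) (x.2 + (n + w))
  let Cj : ℤ → Set (V × ℤ) := fun j => {y | (y.1, y.2 + -j) ∈ box W w}
  have hsub : {ω | (disconnectionTime G ω : ℝ≥0∞) ≤ ENNReal.ofReal r} ⊆
      {ω | ∃ i ≤ n, (i : ℤ) < |(ω i).2 - x.2|} ∪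
        ⋃ j ∈ J, {ω | u ≤ visitCount (Cj j) n ω} := by
    intro ω hω
    by_cases hconf : ∃ i ≤ n, (i : ℤ) < |(ω i).2 - x.2|
    · exact Or.inl hconf
    · right
      push Not at hconf
      obtain ⟨k, hk, hdis⟩ := exists_disconnects_of_disconnectionTime_le hω
      obtain ⟨j, Q, hQS, hQW, hQc⟩ := hdis.exists_box hW hcard
      have hjJ : j ∈ J := by
        obtain ⟨q, hq⟩ : Q.Nonempty := Finset.card_pos.1 (by omega)
        obtain ⟨i, hi, hiq⟩ := hQS q hq
        have hi' : i ≤ k := hi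
        have h1 := hconf i (by omega)
        have h2 := (hQW q hq).2
        rw [hiq] at h1
        rw [abs_le] at h1 h2
        rw [Finset.mem_Icc]
        omega
      refine Set.mem_iUnion₂.2 ⟨j, hjJ, ?_⟩
      have : Q.card ≤ visitCount (Cj j) n ω := card_le_visitCount hk hQS fun q hq => by
        obtain ⟨h1, h2⟩ := hQW q hq
        exact ⟨h1, by simpa [sub_eq_add_neg] using h2⟩
      change u ≤ _
      omega
  have hb : ∀ j ∈ J, walkLaw (cylinder G) x {ω | u ≤ visitCount (Cj j) n ω} ≤
      ENNReal.ofReal (2 / (1 + 1 / (2 * m)) ^ u) := fun j _ =>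
    walkLaw_visitCount_ge x (Cj j) n hm (fun y => by
      rw [visits_shift]; exact hv _) u
  have hJ : J.card = 2 * (n + w) + 1 := by
    rw [Int.card_Icc]; omega
  calc walkLaw (cylinder G) x _
      ≤ walkLaw (cylinder G) x {ω | ∃ i ≤ n, (i : ℤ) < |(ω i).2 - x.2|} +
        ∑ j ∈ J, walkLaw (cylinder G) x {ω | u ≤ visitCount (Cj j) n ω} :=
        (measure_mono hsub).trans ((measure_union_le _ _).trans
          (add_le_add le_rfl (measure_biUnion_finset_le _ _)))
    _ ≤ 0 + ∑ j ∈ J, ENNReal.ofReal (2 / (1 + 1 / (2 * m)) ^ u) := by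
        rw [walkLaw_height_le]
        gcongr with j hj
        exact hb j hj
    _ = ENNReal.ofReal ((2 * (n + w) + 1) * (2 / (1 + 1 / (2 * m)) ^ u)) := by
        rw [zero_add, Finset.sum_const, hJ, nsmul_eq_mul, ENNReal.ofReal_mul (by positivity),
          ← ENNReal.ofReal_natCast]
        push_cast
        rfl

end Confinement

/-! ### The Laplacian and the variational spectral gap -/

section Spectral

variable {V : Type*} [Fintype V] (G : SimpleGraph V)

/-- The (positive) combinatorial Laplacian. -/
def lap (f : V → ℝ) (g : V) : ℝ := ∑ g' ∈ nbrs G g, (f g - f g')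

variable {G}

lemma lap_sum_smul {ι : Type*} (s : Finset ι) (c : ι → ℝ) (φ : ι → V → ℝ) (g : V) :
    lap G (fun x => ∑ i ∈ s, c i * φ i x) g = ∑ i ∈ s, c i * lap G (φ i) g := by
  unfold lap
  simp only [Finset.mul_sum]
  rw [Finset.sum_comm]
  refine Finset.sum_congr rfl fun g' _ => ?_
  rw [← Finset.sum_sub_distrib]
  exact Finset.sum_congr rfl fun i _ => by ring

open Classical in
lemma sum_adj_sq (f : V → ℝ) :
    (∑ g, ∑ g', if G.Adj g g' then (f g' - f g) ^ 2 else 0) = 2 * ∑ g, f g * lap G f g := by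
  have h1 : ∑ g, f g * lap G f g =
      ∑ g, ∑ g', if G.Adj g g' then f g * (f g - f g') else 0 := by
    refine Finset.sum_congr rfl fun g _ => ?_
    rw [lap, nbrs, Finset.sum_filter, Finset.mul_sum]
    refine Finset.sum_congr rfl fun g' _ => ?_
    split_ifs <;> simp
  have h2 : ∑ g, f g * lap G f g =
      ∑ g, ∑ g', if G.Adj g g' then f g' * (f g' - f g) else 0 := by
    rw [h1, Finset.sum_comm]
    refine Finset.sum_congr rfl fun g _ => Finset.sum_congr rfl fun g' _ => ?_
    simp only [G.adj_comm]
  rw [two_mul]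
  nth_rw 1 [h1]
  rw [h2, ← Finset.sum_add_distrib]
  refine Finset.sum_congr rfl fun g _ => ?_
  rw [← Finset.sum_add_distrib]
  refine Finset.sum_congr rfl fun g' _ => ?_
  split_ifs <;> ring

lemma dirichletForm_eq (f : V → ℝ) :
    dirichletForm G f = 1 / (Fintype.card V : ℝ) * ∑ g, f g * lap G f g := by
  rw [dirichletForm, sum_adj_sq]
  ring

open Classical in
/-- An orthonormal basis of eigenvectors of the Laplacian. -/
lemma exists_eigenbasis (G : SimpleGraph V) : ∃ (μ : V → ℝ) (φ : V → V → ℝ),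
    (∀ i g, lap G (φ i) g = μ i * φ i g) ∧
    (∀ i j, ∑ g, φ i g * φ j g = if i = j then 1 else 0) ∧
    (∀ g g', ∑ i, φ i g * φ i g' = if g = g' then 1 else 0) ∧ ∀ i, 0 ≤ μ i := by
  have hH : (G.lapMatrix ℝ).IsHermitian := SimpleGraph.isHermitian_lapMatrix ℝ G
  let U : Matrix V V ℝ := (hH.eigenvectorUnitary : Matrix V V ℝ)
  have hU1 : star U * U = 1 := Unitary.coe_star_mul_self hH.eigenvectorUnitary
  have hU2 : U * star U = 1 := Unitary.coe_mul_star_self hH.eigenvectorUnitary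
  have heig : ∀ i g, lap G (fun g => U g i) g = hH.eigenvalues i * U g i := by
    intro i g
    have h := congrFun (hH.mulVec_eigenvectorBasis i) g
    have hU : ∀ g, U g i = hH.eigenvectorBasis i g := fun g =>
      hH.eigenvectorUnitary_apply g i
    simp only [hU]
    rw [SimpleGraph.lapMatrix_mulVec_apply] at h
    simp only [Pi.smul_apply, smul_eq_mul] at h
    rw [← h, lap, Finset.sum_sub_distrib, Finset.sum_const, nsmul_eq_mul]
    have hn : nbrs G g = G.neighborFinset g := by
      ext; simp [mem_nbrs]
    rw [hn, SimpleGraph.card_neighborFinset_eq_degree]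
  refine ⟨hH.eigenvalues, fun i g => U g i, heig, ?_, ?_, ?_⟩
  · intro i j
    have := congrFun (congrFun hU1 i) j
    rw [Matrix.mul_apply, Matrix.one_apply] at this
    simpa [Matrix.star_apply] using this
  · intro g g'
    have := congrFun (congrFun hU2 g) g'
    rw [Matrix.mul_apply, Matrix.one_apply] at this
    simpa [Matrix.star_apply] using this
  · exact (SimpleGraph.posSemidef_lapMatrix ℝ G).eigenvalues_nonneg

lemma sum_lap (f : V → ℝ) : ∑ g, lap G f g = 0 := by
  classical
  have h1 : ∑ g, lap G f g = ∑ g, ∑ g', if G.Adj g g' then f g - f g' else 0 := by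
    refine Finset.sum_congr rfl fun g _ => ?_
    rw [lap, nbrs, Finset.sum_filter]
  have h2 : ∑ g, lap G f g = ∑ g, ∑ g', if G.Adj g g' then f g' - f g else 0 := by
    rw [h1, Finset.sum_comm]
    refine Finset.sum_congr rfl fun g _ => Finset.sum_congr rfl fun g' _ => ?_
    simp only [G.adj_comm]
  have h3 : ∑ g, lap G f g + ∑ g, lap G f g = 0 := by
    nth_rw 1 [h1]
    rw [h2, ← Finset.sum_add_distrib]
    refine Finset.sum_eq_zero fun g _ => ?_
    rw [← Finset.sum_add_distrib]
    refine Finset.sum_eq_zero fun g' _ => ?_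
    split_ifs <;> ring
  linarith

/-- Every edge has zero energy, so `f` is constant along paths. -/
lemma const_of_energy_eq_zero (hG : G.Connected) {f : V → ℝ}
    (h : ∑ g, f g * lap G f g = 0) : ∃ c, ∀ g, f g = c := by
  classical
  have h2 := sum_adj_sq (G := G) f
  rw [h, mul_zero] at h2
  have hadj : ∀ g g', G.Adj g g' → f g = f g' := by
    intro g g' hgg
    have h3 := (Finset.sum_eq_zero_iff_of_nonneg fun g _ =>
      Finset.sum_nonneg fun g' _ => by split_ifs <;> positivity).1 h2 g (Finset.mem_univ g)
    have h4 := (Finset.sum_eq_zero_iff_of_nonneg fun g' _ => by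
      split_ifs <;> positivity).1 h3 g' (Finset.mem_univ g')
    rw [if_pos hgg] at h4
    have := pow_eq_zero_iff (two_ne_zero) |>.1 h4
    linarith
  obtain ⟨g₀⟩ := hG.nonempty
  refine ⟨f g₀, fun g => ?_⟩
  obtain ⟨p⟩ := hG.preconnected g g₀
  induction p with
  | nil => rfl
  | cons h' p ih => rw [hadj _ _ h', ih]

lemma unifVar_pos {f : V → ℝ} (hf : ¬ ∃ c, ∀ g, f g = c) : 0 < unifVar f := by
  have hne : Nonempty V := by
    by_contra h
    rw [not_nonempty_iff] at h
    exact hf ⟨0, fun g => h.elim g⟩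
  have hN : (0 : ℝ) < Fintype.card V := by exact_mod_cast Fintype.card_pos
  rw [unifVar]
  refine mul_pos (by positivity) ?_
  refine lt_of_le_of_ne (Finset.sum_nonneg fun _ _ => sq_nonneg _) fun h => hf ⟨unifMean f, ?_⟩
  intro g
  have := (Finset.sum_eq_zero_iff_of_nonneg fun g _ => sq_nonneg _).1 h.symm g (Finset.mem_univ g)
  have := pow_eq_zero_iff (two_ne_zero) |>.1 this
  linarith

/-- The mean minimizes the mean square deviation. With a free constant `b`, the mean of an expansion
in eigenvectors need not be identified. -/
lemma unifVar_le [Nonempty V] (f : V → ℝ) (b : ℝ) :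
    unifVar f ≤ 1 / (Fintype.card V : ℝ) * ∑ g, (f g - b) ^ 2 := by
  have hN : (0 : ℝ) < Fintype.card V := by exact_mod_cast Fintype.card_pos
  rw [unifVar]
  refine mul_le_mul_of_nonneg_left ?_ (by positivity)
  have h1 : ∑ g, f g = Fintype.card V * unifMean f := by
    rw [unifMean]; field_simp
  have h2 : ∑ g, (f g - b) ^ 2 = ∑ g, (f g - unifMean f) ^ 2 +
      Fintype.card V * (unifMean f - b) ^ 2 := by
    have : ∀ g, (f g - b) ^ 2 = (f g - unifMean f) ^ 2 +
        (2 * (unifMean f - b) * f g + (b ^ 2 - unifMean f ^ 2)) := fun g => by ring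
    simp only [this]
    rw [Finset.sum_add_distrib, Finset.sum_add_distrib, ← Finset.mul_sum, h1, Finset.sum_const,
      Finset.card_univ, nsmul_eq_mul]
    ring
  rw [h2]
  have : 0 ≤ (Fintype.card V : ℝ) * (unifMean f - b) ^ 2 := by positivity
  linarith

lemma energy_nonneg (f : V → ℝ) : 0 ≤ ∑ g, f g * lap G f g := by
  classical
  have h := sum_adj_sq (G := G) f
  have : 0 ≤ ∑ g, ∑ g', if G.Adj g g' then (f g' - f g) ^ 2 else 0 :=
    Finset.sum_nonneg fun g _ => Finset.sum_nonneg fun g' _ => by split_ifs <;> positivity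
  linarith

lemma dirichletForm_nonneg (f : V → ℝ) : 0 ≤ dirichletForm G f := by
  rw [dirichletForm_eq]
  have := energy_nonneg (G := G) f
  positivity

lemma spectralGap_le_div {f : V → ℝ} (hf : ¬ ∃ c, ∀ g, f g = c) :
    spectralGap G ≤ dirichletForm G f / unifVar f := by
  refine ciInf_le (f := fun f : {f : V → ℝ // ¬ ∃ c, ∀ g, f g = c} =>
    dirichletForm G f.1 / unifVar f.1) ?_ ⟨f, hf⟩
  refine ⟨0, ?_⟩
  rintro _ ⟨f', rfl⟩
  exact div_nonneg (dirichletForm_nonneg _) (unifVar_pos f'.2).le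

lemma eigenvalue_pos (hG : G.Connected) {f : V → ℝ} {μ : ℝ} (hμ : 0 ≤ μ)
    (hf : ¬ ∃ c, ∀ g, f g = c) (heig : ∀ g, lap G f g = μ * f g) : 0 < μ := by
  refine lt_of_le_of_ne hμ fun h => hf (const_of_energy_eq_zero hG ?_)
  simp [heig, ← h]

lemma sum_eigenvector {f : V → ℝ} {μ : ℝ} (hμ : 0 < μ)
    (heig : ∀ g, lap G f g = μ * f g) : ∑ g, f g = 0 := by
  have h := sum_lap (G := G) f
  simp only [heig] at h
  rw [← Finset.mul_sum] at h
  exact (mul_eq_zero.1 h).resolve_left hμ.ne'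

/-- The Rayleigh quotient of the eigenvector is `μ`: connectedness makes `μ` positive, and summing
the eigenvalue equation then gives mean zero. -/
lemma spectralGap_le_eigenvalue (hG : G.Connected) {f : V → ℝ} {μ : ℝ} (hμ : 0 ≤ μ)
    (hf : ¬ ∃ c, ∀ g, f g = c) (heig : ∀ g, lap G f g = μ * f g) : spectralGap G ≤ μ := by
  have hpos := eigenvalue_pos hG hμ hf heig
  have hsum := sum_eigenvector hpos heig
  have hv := unifVar_pos hf
  refine (spectralGap_le_div hf).trans ?_
  rw [div_le_iff₀ hv, dirichletForm_eq]
  have hmean : unifMean f = 0 := by rw [unifMean, hsum, mul_zero]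
  rw [unifVar]
  simp only [hmean, sub_zero, heig]
  apply le_of_eq
  have : ∀ g, f g * (μ * f g) = μ * f g ^ 2 := fun g => by ring
  simp only [this]
  rw [← Finset.mul_sum]
  ring

/-- The spectral gap dominates an eigenvalue with a nonconstant eigenvector. -/
lemma exists_eigenvector_le_spectralGap (hV : 2 ≤ Fintype.card V) :
    ∃ (f : V → ℝ) (μ : ℝ), 0 ≤ μ ∧ (¬ ∃ c, ∀ g, f g = c) ∧ (∀ g, lap G f g = μ * f g) ∧
      μ ≤ spectralGap G := by
  classical
  obtain ⟨μ, φ, heig, horth, hcomp, hμ⟩ := exists_eigenbasis G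
  have hne : Nonempty V := Fintype.card_pos_iff.1 (by omega)
  let S : Finset V := Finset.univ.filter fun i => ¬ ∃ c, ∀ g, φ i g = c
  obtain ⟨g₁, g₂, h12⟩ := Fintype.exists_pair_of_one_lt_card (by omega : 1 < Fintype.card V)
  have hS : S.Nonempty := by
    by_contra h
    rw [Finset.not_nonempty_iff_eq_empty, Finset.filter_eq_empty_iff] at h
    have h1 := hcomp g₁ g₂
    have h2 := hcomp g₁ g₁
    rw [if_neg h12] at h1
    rw [if_pos rfl] at h2
    have h3 : ∀ i, φ i g₁ = φ i g₂ := fun i => by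
      obtain ⟨c, hc⟩ := not_not.1 (h (Finset.mem_univ i))
      rw [hc, hc]
    simp only [← h3] at h1
    linarith
  obtain ⟨i₀, hi₀, hmin⟩ := S.exists_min_image μ hS
  refine ⟨φ i₀, μ i₀, hμ i₀, (Finset.mem_filter.1 hi₀).2, heig i₀, ?_⟩
  have : Nonempty {f : V → ℝ // ¬ ∃ c, ∀ g, f g = c} := ⟨⟨φ i₀, (Finset.mem_filter.1 hi₀).2⟩⟩
  refine le_ciInf fun ⟨f, hf⟩ => ?_
  rw [le_div_iff₀ (unifVar_pos hf)]
  have hN : (0 : ℝ) < Fintype.card V := by exact_mod_cast Fintype.card_pos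
  let c : V → ℝ := fun i => ∑ x, f x * φ i x
  have hexp : ∀ g, f g = ∑ i, c i * φ i g := by
    intro g
    simp only [c, Finset.sum_mul]
    rw [Finset.sum_comm]
    simp only [mul_assoc, ← Finset.mul_sum, hcomp]
    simp
  have hexp' : f = fun g => ∑ i, c i * φ i g := funext hexp
  have henergy : ∑ g, f g * lap G f g = ∑ i, μ i * c i ^ 2 := by
    have h1 : ∀ g, lap G f g = ∑ i, c i * (μ i * φ i g) := by
      intro g
      conv_lhs => rw [hexp']
      rw [lap_sum_smul]
      simp only [heig]
    simp only [h1, Finset.mul_sum]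
    rw [Finset.sum_comm]
    refine Finset.sum_congr rfl fun i _ => ?_
    have : ∀ g, f g * (c i * (μ i * φ i g)) = c i * μ i * (f g * φ i g) := fun g => by ring
    simp only [this]
    rw [← Finset.mul_sum]
    change c i * μ i * c i = _
    ring
  -- All constant eigenvectors together contribute one constant `b`, removed by `unifVar_le`. The
  -- remaining modes have eigenvalue at least `μ i₀`.
  have hconst : ∃ b, ∀ g, ∑ i ∈ Sᶜ, c i * φ i g = b := by
    have h1 : ∀ i ∈ Sᶜ, ∀ g, φ i g = φ i g₁ := by
      intro i hi g
      rw [Finset.mem_compl, Finset.mem_filter] at hi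
      push Not at hi
      obtain ⟨d, hd⟩ := hi (Finset.mem_univ i)
      rw [hd, hd]
    exact ⟨∑ i ∈ Sᶜ, c i * φ i g₁, fun g => Finset.sum_congr rfl fun i hi => by rw [h1 i hi g]⟩
  obtain ⟨b, hb⟩ := hconst
  have hvar : ∑ g, (f g - b) ^ 2 = ∑ i ∈ S, c i ^ 2 := by
    have h1 : ∀ g, f g - b = ∑ i ∈ S, c i * φ i g := by
      intro g
      rw [hexp g, ← hb g, ← Finset.sum_add_sum_compl S]
      ring
    simp only [h1, sq, Finset.sum_mul_sum]
    rw [Finset.sum_comm]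
    refine Finset.sum_congr rfl fun i hi => ?_
    rw [Finset.sum_comm]
    have : ∀ j, ∑ g, c i * φ i g * (c j * φ j g) = c i * c j * ∑ g, φ i g * φ j g := by
      intro j
      rw [Finset.mul_sum]
      exact Finset.sum_congr rfl fun g _ => by ring
    simp only [this, horth]
    simp [hi]
  calc μ i₀ * unifVar f ≤ μ i₀ * (1 / (Fintype.card V : ℝ) * ∑ g, (f g - b) ^ 2) :=
        mul_le_mul_of_nonneg_left (unifVar_le f b) (hμ i₀)
    _ = 1 / (Fintype.card V : ℝ) * ∑ i ∈ S, μ i₀ * c i ^ 2 := by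
        rw [hvar, ← Finset.mul_sum]; ring
    _ ≤ 1 / (Fintype.card V : ℝ) * ∑ i ∈ S, μ i * c i ^ 2 := by
        gcongr with i hi
        exact hmin i hi
    _ ≤ 1 / (Fintype.card V : ℝ) * ∑ i, μ i * c i ^ 2 := by
        gcongr
        · exact fun i _ _ => mul_nonneg (hμ i) (sq_nonneg _)
        · exact Finset.subset_univ S
    _ = dirichletForm G f := by rw [dirichletForm_eq, henergy]

end Spectral

/-! ### The case of a small spectral gap -/

section SmallGap

variable {V : Type*} [Fintype V] [MeasurableSpace V] [MeasurableSingletonClass V]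
  {G : SimpleGraph V}

lemma avg_fst (f : V → ℝ) (x : V × ℤ) :
    avg G (fun y => f y.1) x = f x.1 - lap G f x.1 / ((nbrs G x.1).card + 2) := by
  have := avg_pos_denom (G := G) x.1
  rw [avg, lap, Finset.sum_sub_distrib, Finset.sum_const, nsmul_eq_mul]
  field_simp
  ring

/-- For an eigenvector with a small eigenvalue, going from its maximum to its minimum takes a long
time. -/
lemma walkLaw_visit_max_then_min_le (x : V × ℤ) {f : V → ℝ} {μ : ℝ} (hμ : 0 ≤ μ)
    (heig : ∀ g, lap G f g = μ * f g) {gM gm : V} (hM : ∀ g, f g ≤ f gM)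
    (hlt : f gm < f gM) (hm0 : f gm ≤ 0) (n : ℕ) :
    walkLaw (cylinder G) x {ω | ∃ j ≤ n, ∃ i ≤ j, ω i ∈ {y : V × ℤ | y.1 = gM} ∧
      ω j ∈ {y : V × ℤ | y.1 = gm}} ≤ ENNReal.ofReal (μ * n) := by
  set R := f gM - f gm with hR
  have hR0 : 0 < R := by linarith
  -- The normalized drop of `f` below its maximum, plus `μ` per unit of time left. One step lowers
  -- `f` on average by `μ f / (deg + 2)`, and `f ≤ f gM ≤ R` because `f gm ≤ 0`.
  refine walkLaw_visit_then_visit_le x _ _ n (fun k y => R⁻¹ * (f gM - f y.1) + μ * k) ?_ ?_ ?_ ?_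
  · intro k y
    have := hM y.1
    have : 0 ≤ f gM - f y.1 := by linarith
    positivity
  · intro k y
    have h1 : avg G (fun y => R⁻¹ * (f gM - f y.1) + μ * k) y =
        R⁻¹ * (f gM - f y.1) + μ * k + R⁻¹ * (lap G f y.1 / ((nbrs G y.1).card + 2)) := by
      have : (fun y : V × ℤ => R⁻¹ * (f gM - f y.1) + μ * k) =
          fun y => (R⁻¹ * f gM + μ * k) + (-R⁻¹) * f y.1 := by funext y; ring
      rw [this, avg_add (fun _ => R⁻¹ * f gM + μ * k), avg_const,
        avg_mul_left (-R⁻¹) (fun y => f y.1), avg_fst]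
      ring
    rw [h1, heig]
    push_cast
    have hd : (1 : ℝ) ≤ (nbrs G y.1).card + 2 := by
      have : (0 : ℝ) ≤ (nbrs G y.1).card := by positivity
      linarith
    have h2 : R⁻¹ * (μ * f y.1 / ((nbrs G y.1).card + 2)) ≤ μ := by
      rw [inv_mul_le_iff₀ hR0]
      have h3 : f y.1 ≤ R := by linarith [hM y.1]
      rw [div_le_iff₀ (by linarith)]
      nlinarith [mul_nonneg hR0.le hμ, mul_le_mul_of_nonneg_left h3 hμ]
    linarith
  · intro k y hy
    have hy' : y.1 = gm := hy
    rw [hy', ← hR, inv_mul_cancel₀ hR0.ne']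
    have : 0 ≤ μ * k := by positivity
    linarith
  · intro k hk y hy
    have hy' : y.1 = gM := hy
    rw [hy', sub_self, mul_zero, zero_add]
    gcongr

/-- The trace visits the fibres over a maximum and a minimum of a slow eigenvector. The factor 2
accounts for the two orders; the second is the first applied to `-f`. -/
lemma walkLaw_disconnectionTime_le_spectralGap (hG : G.Connected) (hV : 2 ≤ Fintype.card V)
    (x : V × ℤ) (r : ℝ) :
    walkLaw (cylinder G) x {ω | (disconnectionTime G ω : ℝ≥0∞) ≤ ENNReal.ofReal r} ≤
      ENNReal.ofReal (2 * (spectralGap G * ⌊r⌋₊)) := by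
  obtain ⟨f, μ, hμ, hf, heig, hle⟩ := exists_eigenvector_le_spectralGap (G := G) hV
  have hne : Nonempty V := hG.nonempty
  have hsum := sum_eigenvector (eigenvalue_pos hG hμ hf heig) heig
  obtain ⟨gM, hM⟩ := Finite.exists_max f
  obtain ⟨gm, hm⟩ := Finite.exists_min f
  have hlt : f gm < f gM := by
    by_contra hcon
    exact hf ⟨f gm, fun g => le_antisymm ((hM g).trans (not_lt.1 hcon)) (hm g)⟩
  have hm0 : f gm ≤ 0 := by
    by_contra hcon
    have : 0 < ∑ g, f g := Finset.sum_pos (fun g _ => (not_le.1 hcon).trans_le (hm g))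
      Finset.univ_nonempty
    linarith
  have hM0 : 0 ≤ f gM := by
    by_contra hcon
    have : ∑ g, f g < 0 := Finset.sum_neg (fun g _ => (hM g).trans_lt (not_le.1 hcon))
      Finset.univ_nonempty
    linarith
  set n := ⌊r⌋₊
  have h1 := walkLaw_visit_max_then_min_le x hμ heig hM hlt hm0 n
  have h2 := walkLaw_visit_max_then_min_le (G := G) x (f := fun g => -f g) hμ (fun g => by
    have h := heig g
    unfold lap at h ⊢
    rw [mul_neg, ← h, ← Finset.sum_neg_distrib]
    exact Finset.sum_congr rfl fun g' _ => by ring) (gM := gm) (gm := gM)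
    (fun g => neg_le_neg (hm g)) (neg_lt_neg hlt)
    (neg_nonpos.2 hM0) n
  have hsub : {ω | (disconnectionTime G ω : ℝ≥0∞) ≤ ENNReal.ofReal r} ⊆
      {ω | ∃ j ≤ n, ∃ i ≤ j, ω i ∈ {y : V × ℤ | y.1 = gM} ∧ ω j ∈ {y : V × ℤ | y.1 = gm}} ∪
      {ω | ∃ j ≤ n, ∃ i ≤ j, ω i ∈ {y : V × ℤ | y.1 = gm} ∧ ω j ∈ {y : V × ℤ | y.1 = gM}} := by
    intro ω hω
    obtain ⟨k, hk, hdis⟩ := exists_disconnects_of_disconnectionTime_le hω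
    obtain ⟨z, i, hi, hiM⟩ := hdis.exists_mem_fibre gM
    obtain ⟨z', j, hj, hjm⟩ := hdis.exists_mem_fibre gm
    have hi' : i ≤ k := hi
    have hj' : j ≤ k := hj
    have hi1 : ω i ∈ {y : V × ℤ | y.1 = gM} := by simp [hiM]
    have hj1 : ω j ∈ {y : V × ℤ | y.1 = gm} := by simp [hjm]
    rcases le_total i j with h | h
    · exact Or.inl ⟨j, hj'.trans hk, i, h, hi1, hj1⟩
    · exact Or.inr ⟨i, hi'.trans hk, j, h, hj1, hi1⟩
  refine (measure_mono hsub).trans ((measure_union_le _ _).trans ((add_le_add h1 h2).trans ?_))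
  rw [← ENNReal.ofReal_add (by positivity) (by positivity)]
  apply ENNReal.ofReal_le_ofReal
  have : μ * n ≤ spectralGap G * n := by gcongr
  linarith

end SmallGap

/-! ### Tails of power series -/

section Series

/-- The comparison of `k ^ (-γ)` with its integral over `[k - 1, k]`, obtained from `log t ≤ t - 1`
and `exp t ≥ 1 + t`. -/
lemma rpow_neg_le_sub {γ : ℝ} (hγ : 1 < γ) {k : ℝ} (hk : 1 < k) :
    k ^ (-γ) ≤ ((k - 1) ^ (1 - γ) - k ^ (1 - γ)) / (γ - 1) := by
  have hk0 : 0 < k := by linarith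
  have hk1 : 0 < k - 1 := by linarith
  rw [le_div_iff₀ (by linarith)]
  have h1 : (k - 1) ^ (1 - γ) = k ^ (1 - γ) * ((k - 1) / k) ^ (1 - γ) := by
    rw [← Real.mul_rpow hk0.le (by positivity)]
    congr 1
    field_simp
  have h2 : 1 + (γ - 1) / k ≤ ((k - 1) / k) ^ (1 - γ) := by
    rw [Real.rpow_def_of_pos (by positivity)]
    have h3 : Real.log ((k - 1) / k) ≤ (k - 1) / k - 1 :=
      Real.log_le_sub_one_of_pos (by positivity)
    have h4 : (k - 1) / k - 1 = -(1 / k) := by field_simp; ring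
    rw [h4] at h3
    have h5 : (γ - 1) / k ≤ Real.log ((k - 1) / k) * (1 - γ) := by
      have : (γ - 1) / k = (-(1 / k)) * (1 - γ) := by ring
      rw [this]
      exact mul_le_mul_of_nonpos_right h3 (by linarith)
    linarith [Real.add_one_le_exp (Real.log ((k - 1) / k) * (1 - γ))]
  have h6 : k ^ (1 - γ) = k * k ^ (-γ) := by
    rw [show (1 : ℝ) - γ = 1 + -γ by ring, Real.rpow_add hk0, Real.rpow_one]
  have h7 : 0 < k ^ (1 - γ) := by positivity
  rw [h1]
  have h8 : k ^ (1 - γ) * (1 + (γ - 1) / k) = k ^ (1 - γ) + (γ - 1) * k ^ (-γ) := by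
    rw [h6]; field_simp
  nlinarith [mul_le_mul_of_nonneg_left h2 h7.le]

/-- Before `k₀` the factor `p` is bounded by one, from `k₀` on the factor `b` is, and the power tail
telescopes. The choice of `k₀` is left open for later optimization. -/
lemma sum_range_mul_le {p b : ℕ → ℝ} {K γ : ℝ} (hγ : 1 < γ) (hK : 0 ≤ K) (hp0 : ∀ k, 0 ≤ p k)
    (hp1 : ∀ k, p k ≤ 1) (hb0 : ∀ k, 0 ≤ b k) (hb1 : ∀ k, b k ≤ 1)
    (hp : ∀ k : ℕ, 2 ≤ k → p k ≤ K * (k : ℝ) ^ (-γ)) {k₀ : ℕ} (hk₀ : 2 ≤ k₀) (N : ℕ) :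
    ∑ k ∈ Finset.range N, p k * b k ≤
      ∑ k ∈ Finset.range k₀, b k + K * ((k₀ : ℝ) - 1) ^ (1 - γ) / (γ - 1) := by
  have hk₀' : (2 : ℝ) ≤ k₀ := by exact_mod_cast hk₀
  have hstart : ∑ k ∈ Finset.range k₀, p k * b k ≤ ∑ k ∈ Finset.range k₀, b k :=
    Finset.sum_le_sum fun k _ => mul_le_of_le_one_left (hb0 k) (hp1 k)
  have hmain : ∀ N, k₀ ≤ N → ∑ k ∈ Finset.range N, p k * b k ≤
      ∑ k ∈ Finset.range k₀, b k +
        K * (((k₀ : ℝ) - 1) ^ (1 - γ) - ((N : ℝ) - 1) ^ (1 - γ)) / (γ - 1) := by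
    intro N hN
    induction N, hN using Nat.le_induction with
    | base => simpa using hstart
    | succ N hN ih =>
      rw [Finset.sum_range_succ]
      have hN' : (2 : ℝ) ≤ N := by exact_mod_cast hk₀.trans hN
      have h1 : p N * b N ≤ K * (N : ℝ) ^ (-γ) :=
        (mul_le_of_le_one_right (hp0 N) (hb1 N)).trans (hp N (hk₀.trans hN))
      have h2 := mul_le_mul_of_nonneg_left (rpow_neg_le_sub hγ (k := N) (by linarith)) hK
      have h3 : ((N + 1 : ℕ) : ℝ) - 1 = N := by push_cast; ring
      rw [h3]
      have h4 : K * (((k₀ : ℝ) - 1) ^ (1 - γ) - (N : ℝ) ^ (1 - γ)) / (γ - 1) =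
          K * (((k₀ : ℝ) - 1) ^ (1 - γ) - ((N : ℝ) - 1) ^ (1 - γ)) / (γ - 1) +
          K * ((((N : ℝ) - 1) ^ (1 - γ) - (N : ℝ) ^ (1 - γ)) / (γ - 1)) := by ring
      rw [h4]
      linarith
  have hmono : ∑ k ∈ Finset.range N, p k * b k ≤
      ∑ k ∈ Finset.range (max N k₀), p k * b k :=
    Finset.sum_le_sum_of_subset_of_nonneg
      (Finset.range_mono (le_max_left _ _)) fun k _ _ => mul_nonneg (hp0 k) (hb0 k)
  refine hmono.trans ((hmain _ (le_max_right _ _)).trans ?_)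
  have h5 : 0 ≤ ((max N k₀ : ℕ) : ℝ) - 1 := by
    have : (k₀ : ℝ) ≤ ((max N k₀ : ℕ) : ℝ) := by exact_mod_cast le_max_right N k₀
    linarith
  have h6 := Real.rpow_nonneg h5 (1 - γ)
  gcongr
  linarith

end Series

/-! ### Green function estimates for the killed walk -/

section Killed

variable {V : Type*} [Fintype V] {G : SimpleGraph V}

lemma killedMatrix_nonneg (A : Finset V) (g g' : V) : 0 ≤ killedMatrix G A g g' := by
  rw [killedMatrix]; split_ifs <;> positivity

lemma killedMatrix_of_notMem {A : Finset V} {g : V} (hg : g ∉ A) (g' : V) :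
    killedMatrix G A g g' = 0 := by simp [killedMatrix, hg]

lemma killedMatrix_row_sum_le (A : Finset V) (g : V) : ∑ x, killedMatrix G A g x ≤ 1 := by
  classical
  calc ∑ x, killedMatrix G A g x ≤ ∑ x, if G.Adj g x then ((nbrs G g).card : ℝ)⁻¹ else 0 := by
        refine Finset.sum_le_sum fun x _ => ?_
        rw [killedMatrix]
        split_ifs with h1 h2 h2
        · exact le_rfl
        · exact absurd h1.2.2 h2
        · positivity
        · exact le_rfl
    _ = (nbrs G g).card * ((nbrs G g).card : ℝ)⁻¹ := by
        rw [← Finset.sum_filter, Finset.sum_const, nsmul_eq_mul]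
        simp only [nbrs]
    _ ≤ 1 := mul_inv_le_one

/-- Sums against a row of the killed transition matrix. -/
lemma sum_killedMatrix_mul {A : Finset V} {g : V} (hg : g ∈ A) {f : V → ℝ}
    (hf : ∀ x ∉ A, f x = 0) :
    ∑ x, killedMatrix G A g x * f x = ((nbrs G g).card : ℝ)⁻¹ * ∑ x ∈ nbrs G g, f x := by
  classical
  rw [nbrs, Finset.sum_filter, Finset.mul_sum]
  refine Finset.sum_congr rfl fun x _ => ?_
  by_cases hx : x ∈ A
  · by_cases hadj : G.Adj g x <;> simp [killedMatrix, hg, hx, hadj, nbrs]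
  · simp [hf x hx]

variable [DecidableEq V]

lemma killedMatrix_pow_of_notMem {A : Finset V} {g : V} (hg : g ∉ A) {n : ℕ} (hn : 1 ≤ n)
    (g' : V) : (killedMatrix G A ^ n) g g' = 0 := by
  obtain ⟨k, rfl⟩ : ∃ k, n = k + 1 := ⟨n - 1, by omega⟩
  rw [pow_succ', Matrix.mul_apply]
  exact Finset.sum_eq_zero fun x _ => by rw [killedMatrix_of_notMem hg, zero_mul]

lemma killedMatrix_pow_row_sum_le (A : Finset V) (n : ℕ) (g : V) :
    ∑ x, (killedMatrix G A ^ n) g x ≤ 1 := by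
  induction n generalizing g with
  | zero => simp [Matrix.one_apply]
  | succ n ih =>
    simp only [pow_succ', Matrix.mul_apply]
    rw [Finset.sum_comm]
    simp only [← Finset.mul_sum]
    refine (Finset.sum_le_sum fun y _ => mul_le_of_le_one_right (killedMatrix_nonneg A g y)
      (ih y)).trans (killedMatrix_row_sum_le A g)

/-- Reversibility of the killed walk. -/
lemma killedMatrix_reversible (A : Finset V) (g g' : V) :
    ((nbrs G g).card : ℝ) * killedMatrix G A g g' =
      (nbrs G g').card * killedMatrix G A g' g := by
  by_cases h : G.Adj g g'
  · have h1 : ((nbrs G g).card : ℝ) ≠ 0 := by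
      exact_mod_cast (Finset.card_pos.2 ⟨g', (mem_nbrs G).2 h⟩).ne'
    have h2 : ((nbrs G g').card : ℝ) ≠ 0 := by
      exact_mod_cast (Finset.card_pos.2 ⟨g, (mem_nbrs G).2 h.symm⟩).ne'
    by_cases hg : g ∈ A <;> by_cases hg' : g' ∈ A <;>
      simp [killedMatrix, h, h.symm, hg, hg', h1, h2]
  · have h' : ¬ G.Adj g' g := fun h' => h h'.symm
    simp [killedMatrix, h, h']

lemma killedMatrix_pow_reversible (A : Finset V) (n : ℕ) (g g' : V) :
    ((nbrs G g).card : ℝ) * (killedMatrix G A ^ n) g g' =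
      (nbrs G g').card * (killedMatrix G A ^ n) g' g := by
  induction n generalizing g g' with
  | zero =>
    by_cases h : g = g'
    · subst h; rfl
    · simp [h, Ne.symm h]
  | succ n ih =>
    rw [pow_succ', Matrix.mul_apply, ← pow_succ', pow_succ, Matrix.mul_apply, Finset.mul_sum,
      Finset.mul_sum]
    refine Finset.sum_congr rfl fun x _ => ?_
    rw [← mul_assoc, killedMatrix_reversible, mul_comm (_ * _), ← mul_assoc, mul_comm _ (_ : ℝ),
      ← mul_assoc, mul_assoc, mul_comm ((killedMatrix G A ^ n) x g'), ih x g']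
    ring

variable {A : Finset V} {d₀ : ℕ} {a γ : ℝ}

/-- Off-diagonal heat kernel bound at even times. -/
lemma killedMatrix_pow_even_le (hpos : ∀ g, (nbrs G g).Nonempty)
    (hdeg : ∀ g, (nbrs G g).card ≤ d₀) (ha : 0 ≤ a)
    (hdiag : ∀ g ∈ A, ∀ n : ℕ, 1 ≤ n → (killedMatrix G A ^ n) g g ≤ a / (n : ℝ) ^ γ)
    {k : ℕ} (hk : 1 ≤ k) (g g' : V) :
    (killedMatrix G A ^ (2 * k)) g g' ≤ d₀ * (a / ((2 * k : ℕ) : ℝ) ^ γ) := by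
  set D := a / ((2 * k : ℕ) : ℝ) ^ γ with hD
  have hD0 : 0 ≤ D := by positivity
  have hdiag' : ∀ g, (killedMatrix G A ^ (2 * k)) g g ≤ D := by
    intro g
    by_cases hg : g ∈ A
    · exact hdiag g hg (2 * k) (by omega)
    · rw [killedMatrix_pow_of_notMem hg (by omega)]; exact hD0
  have hc : ∀ g, (1 : ℝ) ≤ (nbrs G g).card := fun g => by
    exact_mod_cast Finset.card_pos.2 (hpos g)
  have hc' : ∀ g, ((nbrs G g).card : ℝ) ≤ d₀ := fun g => by exact_mod_cast hdeg g
  have hmul : ∀ g g', (killedMatrix G A ^ (2 * k)) g g' =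
      ∑ x, (killedMatrix G A ^ k) g x * (killedMatrix G A ^ k) x g' := by
    intro g g'
    rw [two_mul, pow_add, Matrix.mul_apply]
  have hrev : ∀ g x, (killedMatrix G A ^ k) x g =
      (nbrs G g).card / (nbrs G x).card * (killedMatrix G A ^ k) g x := by
    intro g x
    have h1 := killedMatrix_pow_reversible (G := G) A k x g
    have h2 := hc x
    field_simp
    linarith
  -- Reversibility turns a return at time `2k` into a weighted square norm of the law at time `k`;
  -- an off-diagonal entry is the corresponding inner product, bounded by the arithmetic-geometric
  -- inequality. The factor `d₀` comes from the degree weights.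
  have hsq : ∀ g, ∑ x, (killedMatrix G A ^ k) g x ^ 2 / (nbrs G x).card ≤
      D / (nbrs G g).card := by
    intro g
    rw [le_div_iff₀ (by linarith [hc g]), Finset.sum_mul]
    refine le_trans (le_of_eq ?_) (hdiag' g)
    rw [hmul]
    refine Finset.sum_congr rfl fun x _ => ?_
    rw [hrev g x]
    ring
  have h1 : (killedMatrix G A ^ (2 * k)) g g' ≤ ∑ x, (nbrs G g').card * (1 / 2 *
      ((killedMatrix G A ^ k) g x ^ 2 / (nbrs G x).card) + 1 / 2 *
      ((killedMatrix G A ^ k) g' x ^ 2 / (nbrs G x).card)) := by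
    rw [hmul]
    refine Finset.sum_le_sum fun x _ => ?_
    rw [hrev g' x]
    have h2 := hc x
    have h3 := hc g'
    have h4 := two_mul_le_add_sq ((killedMatrix G A ^ k) g x) ((killedMatrix G A ^ k) g' x)
    have h5 : (0 : ℝ) ≤ (nbrs G g').card / (nbrs G x).card :=
      div_nonneg (by linarith) (by linarith)
    calc _ = (nbrs G g').card / (nbrs G x).card *
          ((killedMatrix G A ^ k) g x * (killedMatrix G A ^ k) g' x) := by ring
      _ ≤ (nbrs G g').card / (nbrs G x).card * (1 / 2 * ((killedMatrix G A ^ k) g x ^ 2 +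
          (killedMatrix G A ^ k) g' x ^ 2)) := by
        exact mul_le_mul_of_nonneg_left (by linarith) h5
      _ = _ := by ring
  refine h1.trans ?_
  rw [← Finset.mul_sum, Finset.sum_add_distrib, ← Finset.mul_sum, ← Finset.mul_sum]
  have h6 := hsq g
  have h7 := hsq g'
  have h8 : D / (nbrs G g).card ≤ D := div_le_self hD0 (hc g)
  have h9 : D / (nbrs G g').card ≤ D := div_le_self hD0 (hc g')
  have h10 : 1 / 2 * ∑ x, (killedMatrix G A ^ k) g x ^ 2 / (nbrs G x).card +
      1 / 2 * ∑ x, (killedMatrix G A ^ k) g' x ^ 2 / (nbrs G x).card ≤ D := by linarith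
  exact (mul_le_mul_of_nonneg_left h10 (by linarith [hc g'])).trans
    (mul_le_mul_of_nonneg_right (hc' g') hD0)

/-- An odd power is one substochastic step followed by an even one. The factor `2 ^ γ` covers the
replacement of `k` by the preceding even time, which is at least `k / 2`. -/
lemma killedMatrix_pow_le (hpos : ∀ g, (nbrs G g).Nonempty)
    (hdeg : ∀ g, (nbrs G g).card ≤ d₀) (ha : 0 ≤ a) (hγ : 0 ≤ γ)
    (hdiag : ∀ g ∈ A, ∀ n : ℕ, 1 ≤ n → (killedMatrix G A ^ n) g g ≤ a / (n : ℝ) ^ γ)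
    {k : ℕ} (hk : 2 ≤ k) (g g' : V) :
    (killedMatrix G A ^ k) g g' ≤ d₀ * a * 2 ^ γ * (k : ℝ) ^ (-γ) := by
  have hk0 : (0 : ℝ) < k := by exact_mod_cast (by omega : 0 < k)
  have hhalf : ∀ l : ℕ, k ≤ 2 * (2 * l) → 1 ≤ l →
      d₀ * (a / ((2 * l : ℕ) : ℝ) ^ γ) ≤ d₀ * a * 2 ^ γ * (k : ℝ) ^ (-γ) := by
    intro l hl hl1
    have h1 : (k : ℝ) / 2 ≤ ((2 * l : ℕ) : ℝ) := by
      rw [div_le_iff₀ (by norm_num)]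
      exact_mod_cast (by omega : k ≤ 2 * l * 2)
    have h2 : (k / 2 : ℝ) ^ γ ≤ ((2 * l : ℕ) : ℝ) ^ γ :=
      Real.rpow_le_rpow (by positivity) h1 hγ
    calc d₀ * (a / ((2 * l : ℕ) : ℝ) ^ γ) ≤ d₀ * (a / (k / 2 : ℝ) ^ γ) := by gcongr
      _ = d₀ * a * 2 ^ γ * (k : ℝ) ^ (-γ) := by
        rw [Real.div_rpow hk0.le (by norm_num), Real.rpow_neg hk0.le]
        field_simp
  rcases Nat.even_or_odd' k with ⟨l, rfl | rfl⟩
  · exact (killedMatrix_pow_even_le hpos hdeg ha hdiag (by omega) g g').trans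
      (hhalf l (by omega) (by omega))
  · refine le_trans ?_ (hhalf l (by omega) (by omega))
    rw [pow_succ', Matrix.mul_apply]
    set B := d₀ * (a / ((2 * l : ℕ) : ℝ) ^ γ)
    have hB : 0 ≤ B := by positivity
    calc ∑ x, killedMatrix G A g x * (killedMatrix G A ^ (2 * l)) x g'
        ≤ ∑ x, killedMatrix G A g x * B := Finset.sum_le_sum fun x _ =>
          mul_le_mul_of_nonneg_left
            (killedMatrix_pow_even_le hpos hdeg ha hdiag (by omega) x g')
            (killedMatrix_nonneg A g x)
      _ = (∑ x, killedMatrix G A g x) * B := by rw [Finset.sum_mul]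
      _ ≤ B := mul_le_of_le_one_left hB (killedMatrix_row_sum_le A g)

/-- Probability that the walk killed outside `A` is in `W` at time `k`. -/
def killedProb (G : SimpleGraph V) (A W : Finset V) (k : ℕ) (g : V) : ℝ :=
  ∑ x ∈ W, (killedMatrix G A ^ k) g x

variable {W : Finset V}

lemma killedProb_nonneg (k : ℕ) (g : V) : 0 ≤ killedProb G A W k g :=
  Finset.sum_nonneg fun x _ => killedMatrix_pow_nonneg A k g x

lemma killedProb_le_one (k : ℕ) (g : V) : killedProb G A W k g ≤ 1 :=
  (Finset.sum_le_sum_of_subset_of_nonneg (Finset.subset_univ W)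
    fun x _ _ => killedMatrix_pow_nonneg A k g x).trans (killedMatrix_pow_row_sum_le A k g)

lemma killedProb_zero (g : V) : killedProb G A W 0 g = if g ∈ W then 1 else 0 := by
  simp [killedProb, Matrix.one_apply]

lemma killedProb_of_notMem (hWA : W ⊆ A) {g : V} (hg : g ∉ A) (k : ℕ) :
    killedProb G A W k g = 0 := by
  rcases Nat.eq_zero_or_pos k with rfl | hk
  · rw [killedProb_zero, if_neg fun h => hg (hWA h)]
  · exact Finset.sum_eq_zero fun x _ => killedMatrix_pow_of_notMem hg hk x

lemma killedProb_succ (hWA : W ⊆ A) {g : V} (hg : g ∈ A) (hpos : (nbrs G g).Nonempty) (k : ℕ) :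
    ((nbrs G g).card : ℝ) * killedProb G A W (k + 1) g =
      ∑ x ∈ nbrs G g, killedProb G A W k x := by
  have hc : ((nbrs G g).card : ℝ) ≠ 0 := by exact_mod_cast (Finset.card_pos.2 hpos).ne'
  have h1 : killedProb G A W (k + 1) g = ∑ y, killedMatrix G A g y * killedProb G A W k y := by
    simp only [killedProb, pow_succ', Matrix.mul_apply, Finset.mul_sum]
    rw [Finset.sum_comm]
  rw [h1, sum_killedMatrix_mul hg fun x hx => killedProb_of_notMem hWA hx k]
  field_simp

lemma killedProb_le (hpos : ∀ g, (nbrs G g).Nonempty)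
    (hdeg : ∀ g, (nbrs G g).card ≤ d₀) (ha : 0 ≤ a) (hγ : 0 ≤ γ)
    (hdiag : ∀ g ∈ A, ∀ n : ℕ, 1 ≤ n → (killedMatrix G A ^ n) g g ≤ a / (n : ℝ) ^ γ)
    {k : ℕ} (hk : 2 ≤ k) (g : V) :
    killedProb G A W k g ≤ W.card * (d₀ * a * 2 ^ γ) * (k : ℝ) ^ (-γ) := by
  refine (Finset.sum_le_sum fun x _ =>
    killedMatrix_pow_le hpos hdeg ha hγ hdiag hk g x).trans ?_
  rw [Finset.sum_const, nsmul_eq_mul, mul_assoc (W.card : ℝ)]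

/-- A function of the cylinder that dominates the Green function of the walk killed when leaving
`A × ℤ`, integrated against a profile on `W × ℤ`. -/
def greenBarrier (G : SimpleGraph V) (A W : Finset V) (b : ℕ → ℤ → ℝ) (x : V × ℤ) : ℝ :=
  3 * ∑' k, killedProb G A W k x.1 * b (k + 1) x.2

/-- Profiles `b k z` that decrease under a vertical averaging of arbitrary strength. -/
structure IsProfile (b : ℕ → ℤ → ℝ) : Prop where
  nonneg : ∀ k z, 0 ≤ b k z
  le_one : ∀ k z, b k z ≤ 1
  step : ∀ k z, ∀ β : ℝ, 0 ≤ β → β ≤ 1 →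
    b k z + β * (b (k + 1) (z + 1) + b (k + 1) (z - 1) - 2 * b (k + 1) z) ≤ b (k + 1) z

variable {b : ℕ → ℤ → ℝ} {K : ℝ}

lemma summable_killedProb_mul (hγ : 1 < γ) (hK : 0 ≤ K)
    (hp : ∀ k : ℕ, 2 ≤ k → ∀ g, killedProb G A W k g ≤ K * (k : ℝ) ^ (-γ)) (hb : IsProfile b)
    (g : V) (z : ℤ) : Summable fun k => killedProb G A W k g * b (k + 1) z :=
  summable_of_sum_range_le (fun k => mul_nonneg (killedProb_nonneg k g) (hb.nonneg _ _))
    (sum_range_mul_le hγ hK (fun k => killedProb_nonneg k g) (fun k => killedProb_le_one k g)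
      (fun k => hb.nonneg (k + 1) z) (fun k => hb.le_one (k + 1) z) (fun k hk => hp k hk g) le_rfl)

lemma greenBarrier_nonneg (hb : IsProfile b) (x : V × ℤ) : 0 ≤ greenBarrier G A W b x :=
  mul_nonneg (by norm_num)
    (tsum_nonneg fun k => mul_nonneg (killedProb_nonneg k _) (hb.nonneg _ _))

/-- The early part is governed by the vertical profile and the late part by horizontal transience.
-/
lemma greenBarrier_le (hγ : 1 < γ) (hK : 0 ≤ K)
    (hp : ∀ k : ℕ, 2 ≤ k → ∀ g, killedProb G A W k g ≤ K * (k : ℝ) ^ (-γ)) (hb : IsProfile b)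
    {k₀ : ℕ} (hk₀ : 2 ≤ k₀) (x : V × ℤ) :
    greenBarrier G A W b x ≤ 3 * (∑ k ∈ Finset.range k₀, b (k + 1) x.2 +
      K * ((k₀ : ℝ) - 1) ^ (1 - γ) / (γ - 1)) := by
  refine mul_le_mul_of_nonneg_left ?_ (by norm_num)
  exact Real.tsum_le_of_sum_range_le
    (fun k => mul_nonneg (killedProb_nonneg k _) (hb.nonneg _ _))
    (sum_range_mul_le hγ hK (fun k => killedProb_nonneg k x.1) (fun k => killedProb_le_one k x.1)
      (fun k => hb.nonneg (k + 1) x.2) (fun k => hb.le_one (k + 1) x.2)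
      (fun k hk => hp k hk x.1) hk₀)

/-- The index `k` counts horizontal steps only. At a vertex of degree `d`, the one-step equation
multiplied by `d + 2` reduces to the profile inequality with `β = 1/d`, which is why profiles must
tolerate every vertical strength in `[0, 1]`. The term `k = 0` leaves `3 d b 0`, enough for the
source `(d + 2) b 0` because `d ≥ 1`; hence the factor 3. -/
lemma greenBarrier_supersolution (hγ : 1 < γ) (hK : 0 ≤ K)
    (hp : ∀ k : ℕ, 2 ≤ k → ∀ g, killedProb G A W k g ≤ K * (k : ℝ) ^ (-γ)) (hb : IsProfile b)
    (hWA : W ⊆ A) (hpos : ∀ g, (nbrs G g).Nonempty) {x : V × ℤ} (hx : x.1 ∈ A) :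
    (if x.1 ∈ W then b 0 x.2 else 0) + avg G (greenBarrier G A W b) x ≤
      greenBarrier G A W b x := by
  obtain ⟨g, z⟩ := x
  simp only at hx ⊢
  set d : ℝ := ((nbrs G g).card : ℝ) with hd
  have hd1 : 1 ≤ d := by rw [hd]; exact_mod_cast Finset.card_pos.2 (hpos g)
  have hs : ∀ g z, Summable fun k => killedProb G A W k g * b (k + 1) z :=
    summable_killedProb_mul hγ hK hp hb
  set p : ℕ → ℝ := fun k => killedProb G A W k g with hpdef
  have hp0 : ∀ k, 0 ≤ p k := fun k => killedProb_nonneg k g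
  have hsum : ∑ g' ∈ nbrs G g, greenBarrier G A W b (g', z) =
      3 * ∑' k, d * p (k + 1) * b (k + 1) z := by
    simp only [greenBarrier]
    rw [← Finset.mul_sum, ← Summable.tsum_finsetSum fun g' _ => hs g' z]
    congr 1
    refine tsum_congr fun k => ?_
    rw [← Finset.sum_mul, ← killedProb_succ hWA hx (hpos g)]
  have hshift : Summable fun k => d * p (k + 1) * b (k + 1) z := by
    have h1 : Summable fun k => ∑ g' ∈ nbrs G g, killedProb G A W k g' * b (k + 1) z :=
      summable_sum fun g' _ => hs g' z
    refine h1.congr fun k => ?_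
    rw [← Finset.sum_mul, ← killedProb_succ hWA hx (hpos g)]
  have hbase : Summable fun k => d * (p k * b k z) := by
    rw [← summable_nat_add_iff 1]
    exact hshift.congr fun k => by ring
  have hbase_eq : ∑' k, d * (p k * b k z) =
      d * (p 0 * b 0 z) + ∑' k, d * p (k + 1) * b (k + 1) z := by
    rw [hbase.tsum_eq_zero_add]
    congr 1
    exact tsum_congr fun k => by ring
  have hterm : ∀ k, d * (p k * b k z) ≤ (d + 2) * (p k * b (k + 1) z) -
      p k * b (k + 1) (z + 1) - p k * b (k + 1) (z - 1) := by
    intro k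
    have h1 := hb.step k z d⁻¹ (by positivity) (inv_le_one_of_one_le₀ hd1)
    have h2 : d * b k z + (b (k + 1) (z + 1) + b (k + 1) (z - 1) - 2 * b (k + 1) z) ≤
        d * b (k + 1) z := by
      have := mul_le_mul_of_nonneg_left h1 (by linarith : (0 : ℝ) ≤ d)
      rw [mul_add, ← mul_assoc, mul_inv_cancel₀ (by linarith), one_mul] at this
      exact this
    nlinarith [mul_le_mul_of_nonneg_left h2 (hp0 k)]
  have hS0 : Summable fun k => (d + 2) * (p k * b (k + 1) z) := (hs g z).mul_left _
  have hS1 := hs g (z + 1)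
  have hS2 := hs g (z - 1)
  have hle : ∑' k, d * (p k * b k z) ≤ (d + 2) * ∑' k, p k * b (k + 1) z -
      ∑' k, p k * b (k + 1) (z + 1) - ∑' k, p k * b (k + 1) (z - 1) := by
    rw [← tsum_mul_left, ← hS0.tsum_sub hS1, ← (hS0.sub hS1).tsum_sub hS2]
    exact hbase.tsum_le_tsum hterm ((hS0.sub hS1).sub hS2)
  have hp00 : p 0 = if g ∈ W then 1 else 0 := killedProb_zero g
  have hden : (0 : ℝ) < d + 2 := by linarith
  rw [avg, ← hd]
  simp only
  rw [hsum, ← le_sub_iff_add_le', div_le_iff₀ hden]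
  simp only [greenBarrier]
  change 3 * ∑' k, d * p (k + 1) * b (k + 1) z + 3 * ∑' k, p k * b (k + 1) (z + 1) +
    3 * ∑' k, p k * b (k + 1) (z - 1) ≤ (3 * ∑' k, p k * b (k + 1) z - _) * (d + 2)
  rw [hbase_eq, hp00] at hle
  have hb0 := hb.nonneg 0 z
  split_ifs at hle ⊢
  · nlinarith
  · nlinarith

lemma isProfile_one : IsProfile fun _ _ => (1 : ℝ) :=
  ⟨fun _ _ => zero_le_one, fun _ _ => le_rfl, fun _ _ β _ _ => by linarith⟩

/-- The profile controlling the walk that climbs to height `r`. -/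
def climbProfile (θ r : ℝ) (k : ℕ) (z : ℤ) : ℝ :=
  min 1 (2 * Real.exp (-θ * r) * Real.cosh (θ * z) * Real.exp (4 * θ ^ 2 * k))

/-- Where the new value is truncated at 1 the inequality is immediate from `b ≤ 1`. Elsewhere, the
sum of the values of `cosh (θ z)` at the two vertical neighbours is `2 cosh θ` times the central
value, `cosh θ ≤ 1 + θ²`, and the time factor `exp (-4θ²) ≤ 1 - 2θ²` absorbs the gain for `β ≤ 1`.
-/
lemma isProfile_climbProfile {θ r : ℝ} (hθ : |θ| ≤ 1 / 2) : IsProfile (climbProfile θ r) := by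
  refine ⟨fun k z => ?_, fun k z => min_le_left _ _, fun k z β hβ0 hβ1 => ?_⟩
  · have := Real.cosh_pos (θ * z)
    exact le_min zero_le_one (by positivity)
  · set c : ℝ := 2 * Real.exp (-θ * r) with hc
    have hc0 : 0 ≤ c := by positivity
    have hle1 : ∀ k z, climbProfile θ r k z ≤ 1 := fun k z => min_le_left _ _
    have hle2 : ∀ (k : ℕ) (z : ℤ), climbProfile θ r k z ≤
      c * Real.cosh (θ * z) * Real.exp (4 * θ ^ 2 * k) := fun k z => min_le_right _ _
    rcases min_choice (1 : ℝ) (c * Real.cosh (θ * z) * Real.exp (4 * θ ^ 2 * (k + 1 : ℕ)))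
      with h | h
    · have h' : climbProfile θ r (k + 1) z = 1 := h
      rw [h']
      nlinarith [hle1 k z, hle1 (k + 1) (z + 1), hle1 (k + 1) (z - 1)]
    · have h' : climbProfile θ r (k + 1) z =
        c * Real.cosh (θ * z) * Real.exp (4 * θ ^ 2 * (k + 1 : ℕ)) := h
      have h1 := hle2 (k + 1) (z + 1)
      have h2 := hle2 (k + 1) (z - 1)
      have h3 := hle2 k z
      have hcosh : Real.cosh (θ * (z + 1 : ℤ)) + Real.cosh (θ * (z - 1 : ℤ)) =
          2 * Real.cosh θ * Real.cosh (θ * z) := by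
        push_cast
        rw [mul_add, mul_sub, mul_one, Real.cosh_add, Real.cosh_sub]
        ring
      set E := Real.exp (4 * θ ^ 2 * (k + 1 : ℕ)) with hE
      have hE0 : 0 < E := Real.exp_pos _
      set Z := Real.cosh (θ * z) with hZ
      have hZ0 : 0 < Z := Real.cosh_pos _
      have hEk : Real.exp (4 * θ ^ 2 * (k : ℕ)) = E * Real.exp (-(4 * θ ^ 2)) := by
        rw [hE, ← Real.exp_add]
        congr 1
        push_cast
        ring
      rw [hEk] at h3
      have hθ2 : θ ^ 2 ≤ 1 / 4 := by
        have := sq_le_sq' (by linarith [neg_abs_le θ, abs_nonneg θ]) hθ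
        rw [sq_abs] at this
        linarith
      have hcθ : Real.cosh θ - 1 ≤ θ ^ 2 := by
        have h4 := Real.cosh_le_exp_half_sq θ
        have h5 : Real.exp (θ ^ 2 / 2) ≤ 1 + θ ^ 2 := by
          have h6 := Real.add_one_le_exp (-(θ ^ 2 / 2))
          have h7 : Real.exp (θ ^ 2 / 2) * Real.exp (-(θ ^ 2 / 2)) = 1 := by
            rw [← Real.exp_add]; simp
          have h8 := Real.exp_pos (θ ^ 2 / 2)
          have h9 := sq_nonneg θ
          have h10 : Real.exp (θ ^ 2 / 2) * (1 - θ ^ 2 / 2) ≤ 1 := by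
            rw [← h7]; gcongr; linarith
          nlinarith
        linarith
      have hexp : Real.exp (-(4 * θ ^ 2)) ≤ 1 - 2 * θ ^ 2 := by
        have h4 := Real.add_one_le_exp (4 * θ ^ 2)
        have h5 : Real.exp (4 * θ ^ 2) * Real.exp (-(4 * θ ^ 2)) = 1 := by
          rw [← Real.exp_add]; simp
        have h6 := Real.exp_pos (-(4 * θ ^ 2))
        have h7 : (1 + 4 * θ ^ 2) * Real.exp (-(4 * θ ^ 2)) ≤ 1 := by
          rw [← h5]; gcongr; linarith
        have h8 : 1 ≤ (1 + 4 * θ ^ 2) * (1 - 2 * θ ^ 2) := by nlinarith [sq_nonneg θ]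
        by_contra hcon
        push Not at hcon
        nlinarith [sq_nonneg θ]
      have hsum : climbProfile θ r (k + 1) (z + 1) + climbProfile θ r (k + 1) (z - 1) ≤
          c * E * (2 * Real.cosh θ * Z) := by
        calc _ ≤ c * Real.cosh (θ * (z + 1 : ℤ)) * E + c * Real.cosh (θ * (z - 1 : ℤ)) * E :=
              add_le_add h1 h2
          _ = c * E * (Real.cosh (θ * (z + 1 : ℤ)) + Real.cosh (θ * (z - 1 : ℤ))) := by ring
          _ = _ := by rw [hcosh]
      rw [h']
      have hcEZ : 0 ≤ c * E * Z := by positivity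
      have hc1 : 1 ≤ Real.cosh θ := Real.one_le_cosh θ
      calc climbProfile θ r k z + β * (climbProfile θ r (k + 1) (z + 1) +
            climbProfile θ r (k + 1) (z - 1) - 2 * (c * Z * E))
          ≤ c * Z * (E * Real.exp (-(4 * θ ^ 2))) +
            β * (c * E * (2 * Real.cosh θ * Z) - 2 * (c * Z * E)) := by gcongr
        _ = c * E * Z * (Real.exp (-(4 * θ ^ 2)) + β * (2 * (Real.cosh θ - 1))) := by ring
        _ ≤ c * E * Z * (1 - 2 * θ ^ 2 + 1 * (2 * θ ^ 2)) := by
            gcongr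
        _ = c * Z * E := by ring

end Killed

/-! ### Monotonicity in height through the lazy walk -/

section Lazy

variable {V : Type*} [Fintype V] {G : SimpleGraph V}

/-- The horizontal set `W × {0}`. -/
def floorSet (W : Finset V) : Set (V × ℤ) := {x | x.1 ∈ W ∧ x.2 = 0}

open Classical in
/-- Probability that the lazy walk enters `W × {0}` by time `k` before leaving `A × ℤ`. -/
def lazyHit (G : SimpleGraph V) (A W : Finset V) : ℕ → V × ℤ → ℝ
  | 0, x => if x ∈ floorSet W then 1 else 0
  | k + 1, x => if x ∈ floorSet W then 1 else
      if x.1 ∈ A then 1 / 2 * lazyHit G A W k x + 1 / 2 * avg G (lazyHit G A W k) x else 0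

variable {A W : Finset V}

lemma lazyHit_of_mem {x : V × ℤ} (hx : x ∈ floorSet W) (k : ℕ) : lazyHit G A W k x = 1 := by
  cases k <;> simp [lazyHit, hx]

lemma lazyHit_of_notMem {x : V × ℤ} (hx : x ∉ floorSet W) (hA : x.1 ∉ A) (k : ℕ) :
    lazyHit G A W k x = 0 := by
  cases k <;> simp [lazyHit, hx, hA]

lemma lazyHit_zero_of_notMem {x : V × ℤ} (hx : x ∉ floorSet W) : lazyHit G A W 0 x = 0 := by
  simp [lazyHit, hx]

lemma lazyHit_succ {x : V × ℤ} (hx : x ∉ floorSet W) (hA : x.1 ∈ A) (k : ℕ) :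
    lazyHit G A W (k + 1) x =
      1 / 2 * lazyHit G A W k x + 1 / 2 * avg G (lazyHit G A W k) x := by
  simp [lazyHit, hx, hA]

lemma lazyHit_nonneg (k : ℕ) (x : V × ℤ) : 0 ≤ lazyHit G A W k x := by
  induction k generalizing x with
  | zero => rw [lazyHit]; split_ifs <;> norm_num
  | succ k ih =>
    rw [lazyHit]; split_ifs
    · norm_num
    · linarith [ih x, avg_nonneg (G := G) ih x]
    · norm_num

lemma lazyHit_le_one (k : ℕ) (x : V × ℤ) : lazyHit G A W k x ≤ 1 := by
  induction k generalizing x with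
  | zero => rw [lazyHit]; split_ifs <;> norm_num
  | succ k ih =>
    rw [lazyHit]; split_ifs
    · norm_num
    · linarith [ih x, avg_le_const (G := G) ih x]
    · norm_num

lemma lazyHit_le_succ (k : ℕ) (x : V × ℤ) : lazyHit G A W k x ≤ lazyHit G A W (k + 1) x := by
  induction k generalizing x with
  | zero =>
    by_cases hx : x ∈ floorSet W
    · rw [lazyHit_of_mem hx, lazyHit_of_mem hx]
    · rw [lazyHit_zero_of_notMem hx]; exact lazyHit_nonneg _ _
  | succ k ih =>
    by_cases hx : x ∈ floorSet W
    · rw [lazyHit_of_mem hx, lazyHit_of_mem hx]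
    · by_cases hA : x.1 ∈ A
      · rw [lazyHit_succ hx hA, lazyHit_succ hx hA]
        linarith [ih x, avg_mono (G := G) ih x]
      · rw [lazyHit_of_notMem hx hA, lazyHit_of_notMem hx hA]

lemma lazyHit_neg (k : ℕ) (g : V) (z : ℤ) :
    lazyHit G A W k (g, -z) = lazyHit G A W k (g, z) := by
  have hmem : ∀ g z, (g, -z) ∈ floorSet W ↔ (g, z) ∈ floorSet W := fun g z => by simp [floorSet]
  induction k generalizing g z with
  | zero =>
    by_cases hz : (g, z) ∈ floorSet W
    · rw [lazyHit_of_mem ((hmem g z).2 hz), lazyHit_of_mem hz]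
    · rw [lazyHit_zero_of_notMem hz, lazyHit_zero_of_notMem fun h => hz ((hmem g z).1 h)]
  | succ k ih =>
    have h1 : avg G (lazyHit G A W k) (g, -z) = avg G (lazyHit G A W k) (g, z) := by
      unfold avg
      simp only [ih]
      rw [show -z + 1 = -(z - 1) by ring, show -z - 1 = -(z + 1) by ring, ih, ih]
      ring
    by_cases hz : (g, z) ∈ floorSet W
    · rw [lazyHit_of_mem ((hmem g z).2 hz), lazyHit_of_mem hz]
    · have hz' : (g, -z) ∉ floorSet W := fun h => hz ((hmem g z).1 h)
      by_cases hA : g ∈ A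
      · rw [lazyHit_succ hz hA, lazyHit_succ hz' hA, h1, ih]
      · rw [lazyHit_of_notMem hz hA, lazyHit_of_notMem hz' hA]

/-- The hitting probability decreases with the distance to the target level. -/
lemma lazyHit_antitone_step (k : ℕ) (g : V) {z : ℤ} (hz : 0 ≤ z) :
    lazyHit G A W k (g, z + 1) ≤ lazyHit G A W k (g, z) := by
  induction k generalizing g z with
  | zero =>
    have : (g, z + 1) ∉ floorSet W := fun h => by have := h.2; simp only at this; omega
    rw [lazyHit_zero_of_notMem this]; exact lazyHit_nonneg _ _
  | succ k ih =>
    have h1 : (g, z + 1) ∉ floorSet W := fun h => by have := h.2; simp only at this; omega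
    by_cases hA : g ∈ A
    swap
    · rw [lazyHit_of_notMem h1 hA]; exact lazyHit_nonneg _ _
    by_cases h0 : (g, z) ∈ floorSet W
    · rw [lazyHit_of_mem h0]; exact lazyHit_le_one _ _
    rw [lazyHit_succ h1 hA, lazyHit_succ h0 hA]
    rcases hz.lt_or_eq with hz0 | rfl
    · have h2 := ih g hz
      have h3 : avg G (lazyHit G A W k) (g, z + 1) ≤ avg G (lazyHit G A W k) (g, z) := by
        unfold avg
        have e1 : ∑ g' ∈ nbrs G g, lazyHit G A W k (g', z + 1) ≤
            ∑ g' ∈ nbrs G g, lazyHit G A W k (g', z) := Finset.sum_le_sum fun g' _ => ih g' hz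
        have e2 := ih g (z := z + 1) (by omega)
        have e3 := ih g (z := z - 1) (by omega)
        rw [sub_add_cancel] at e3
        simp only [add_sub_cancel_right]
        gcongr
      linarith
    -- At level 0 both vertical steps move away from the floor, while from level 1 one of them
    -- reaches level 0. The holding probability compensates: it leaves the coefficient `deg + 2 - 1
    -- ≥ 0` in front of the difference. This is where laziness is needed.
    · have h2 := ih g le_rfl
      have e1 : ∑ g' ∈ nbrs G g, lazyHit G A W k (g', 0 + 1) ≤
          ∑ g' ∈ nbrs G g, lazyHit G A W k (g', 0) := Finset.sum_le_sum fun g' _ => ih g' le_rfl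
      have e2 := ih g (z := 1) (by omega)
      have e3 := lazyHit_neg (G := G) (A := A) (W := W) k g 1
      have hd := avg_pos_denom (G := G) g
      have hd' : (0 : ℝ) ≤ (nbrs G g).card := by positivity
      unfold avg
      simp only [zero_add, zero_sub, sub_self] at *
      rw [e3]
      have h3 : 0 ≤ (lazyHit G A W k (g, 0) - lazyHit G A W k (g, 1)) *
        ((nbrs G g).card + 2 - 1) := mul_nonneg (by linarith) (by linarith)
      rw [← sub_nonneg]
      have h4 : 1 / 2 * lazyHit G A W k (g, 0) + 1 / 2 *
          ((∑ g' ∈ nbrs G g, lazyHit G A W k (g', 0) + lazyHit G A W k (g, 1) +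
            lazyHit G A W k (g, 1)) / ((nbrs G g).card + 2)) -
          (1 / 2 * lazyHit G A W k (g, 1) + 1 / 2 *
          ((∑ g' ∈ nbrs G g, lazyHit G A W k (g', 1) + lazyHit G A W k (g, 1 + 1) +
            lazyHit G A W k (g, 0)) / ((nbrs G g).card + 2))) =
          1 / 2 * (((lazyHit G A W k (g, 0) - lazyHit G A W k (g, 1)) *
            ((nbrs G g).card + 2 - 1) + (∑ g' ∈ nbrs G g, lazyHit G A W k (g', 0) -
            ∑ g' ∈ nbrs G g, lazyHit G A W k (g', 1)) + (lazyHit G A W k (g, 1) -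
            lazyHit G A W k (g, 1 + 1))) / ((nbrs G g).card + 2)) := by
        field_simp
        ring
      rw [h4]
      refine mul_nonneg (by norm_num) (div_nonneg ?_ hd.le)
      linarith

lemma lazyHit_antitone (k : ℕ) (g : V) {i j : ℤ} (hi : 0 ≤ i) (hij : i ≤ j) :
    lazyHit G A W k (g, j) ≤ lazyHit G A W k (g, i) := by
  induction j, hij using Int.leInduction with
  | base => exact le_rfl
  | succ j hij ih => exact (lazyHit_antitone_step k g (by omega)).trans ih

/-- The walk and the lazy walk have the same hitting probabilities, up to the time horizon. -/
lemma hit_le_of_lazyHit_le {c : ℝ} {x : V × ℤ} (h : ∀ k, lazyHit G A W k x ≤ c) (n : ℕ) :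
    hit G (floorSet W) {y | y.1 ∈ A} n x ≤ c := by
  have hbdd : ∀ y, BddAbove (Set.range fun k => lazyHit G A W k y) := fun y =>
    ⟨1, by rintro _ ⟨k, rfl⟩; exact lazyHit_le_one k y⟩
  -- Off the floor and over `A`, the increasing limit satisfies `F = (F + avg F) / 2`, hence is
  -- harmonic for the walk without holding, and dominates its hitting probabilities.
  let F : V × ℤ → ℝ := fun y => ⨆ k, lazyHit G A W k y
  have hlim : ∀ y, Tendsto (fun k => lazyHit G A W k y) atTop (𝓝 (F y)) := fun y =>
    tendsto_atTop_ciSup (monotone_nat_of_le_succ fun k => lazyHit_le_succ k y) (hbdd y)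
  have hlim_avg : ∀ y, Tendsto (fun k => avg G (lazyHit G A W k) y) atTop (𝓝 (avg G F y)) := by
    intro y
    unfold avg
    refine Tendsto.div_const ?_ _
    exact ((tendsto_finsetSum _ fun g _ => hlim _).add (hlim _)).add (hlim _)
  refine (hit_le_of_supersolution (F := F) ?_ ?_ ?_ n x).trans (ciSup_le h)
  · exact fun y => (lazyHit_nonneg 0 y).trans (le_ciSup (hbdd y) 0)
  · exact fun y hy => (lazyHit_of_mem hy 0).symm.le.trans (le_ciSup (hbdd y) 0)
  · intro y hyA hy
    have h1 : Tendsto (fun k => lazyHit G A W (k + 1) y) atTop (𝓝 (F y)) :=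
      (hlim y).comp (tendsto_add_atTop_nat 1)
    have h2 : Tendsto (fun k => lazyHit G A W (k + 1) y) atTop
        (𝓝 (1 / 2 * F y + 1 / 2 * avg G F y)) := by
      refine (((hlim y).const_mul (1 / 2)).add ((hlim_avg y).const_mul (1 / 2))).congr fun k => ?_
      rw [lazyHit_succ hy hyA]
    have h3 := tendsto_nhds_unique h1 h2
    linarith

/-- Sum over heights of the hitting probabilities is bounded by a Green function. -/
lemma sum_lazyHit_le {B : V × ℤ → ℝ} (hB : ∀ x, 0 ≤ B x) {r R : ℤ} (hWA : W ⊆ A)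
    (hsuper : ∀ x : V × ℤ, x.1 ∈ A →
      (open Classical in if x.1 ∈ W ∧ x.2 ≤ -r then 1 else 0) + avg G B x ≤ B x)
    (k : ℕ) (x : V × ℤ) :
    ∑ i ∈ Finset.Icc r R, lazyHit G A W k (x.1, x.2 + i) ≤ 2 * B x := by
  classical
  -- Shifting the start up by `i` amounts to aiming at the level `-i`. The sum over `i ≥ r` is thus
  -- at most the number of visits to `W × (-∞, -r]`; holding with probability `1/2` doubles the
  -- Green function.
  let f : ℤ → V × ℤ → Prop := fun i x => (x.1, x.2 + i) ∈ floorSet W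
  have hind : ∀ x : V × ℤ, (∑ i ∈ Finset.Icc r R, if f i x then (1 : ℝ) else 0) ≤
      if x.1 ∈ W ∧ x.2 ≤ -r then 1 else 0 := by
    intro x
    by_cases h : ∃ i ∈ Finset.Icc r R, f i x
    · obtain ⟨i, hi, hfi⟩ := h
      rw [Finset.mem_Icc] at hi
      have hz : x.2 + i = 0 := hfi.2
      rw [if_pos ⟨hfi.1, by omega⟩]
      rw [Finset.sum_eq_single i]
      · rw [if_pos hfi]
      · intro j _ hj
        rw [if_neg]
        intro hfj
        have hz' : x.2 + j = 0 := hfj.2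
        omega
      · intro hni
        exact absurd (Finset.mem_Icc.2 hi) hni
    · push Not at h
      rw [Finset.sum_eq_zero fun i hi => if_neg (h i hi)]
      split_ifs <;> norm_num
  have hterm : ∀ (k : ℕ) (i : ℤ) (x : V × ℤ), x.1 ∈ A →
      lazyHit G A W (k + 1) (x.1, x.2 + i) ≤ (if f i x then 1 else 0) +
        (1 / 2 * lazyHit G A W k (x.1, x.2 + i) +
          1 / 2 * avg G (fun y => lazyHit G A W k (y.1, y.2 + i)) x) := by
    intro k i x hx
    rw [avg_shift]
    by_cases hfi : f i x
    · rw [if_pos hfi, lazyHit_of_mem hfi]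
      linarith [lazyHit_nonneg (G := G) (A := A) (W := W) k (x.1, x.2 + i),
        avg_nonneg (G := G) (lazyHit_nonneg (G := G) (A := A) (W := W) k) (x.1, x.2 + i)]
    · rw [if_neg hfi, lazyHit_succ hfi hx, zero_add]
  have hout : ∀ (k : ℕ) (x : V × ℤ), x.1 ∉ A →
      ∑ i ∈ Finset.Icc r R, lazyHit G A W k (x.1, x.2 + i) ≤ 2 * B x := by
    intro k x hx
    rw [Finset.sum_eq_zero fun i _ =>
      lazyHit_of_notMem (x := (x.1, x.2 + i)) (fun h => hx (hWA h.1)) hx k]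
    linarith [hB x]
  induction k generalizing x with
  | zero =>
    by_cases hx : x.1 ∈ A
    · have h1 := hsuper x hx
      have h2 := avg_nonneg (G := G) hB x
      have h3 := hind x
      have h4 : ∑ i ∈ Finset.Icc r R, lazyHit G A W 0 (x.1, x.2 + i) =
          ∑ i ∈ Finset.Icc r R, if f i x then (1 : ℝ) else 0 := rfl
      rw [h4]
      have h5 := hB x
      linarith
    · exact hout 0 x hx
  | succ k ih =>
    by_cases hx : x.1 ∈ A
    · have h1 := Finset.sum_le_sum fun i (_ : i ∈ Finset.Icc r R) => hterm k i x hx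
      rw [Finset.sum_add_distrib, Finset.sum_add_distrib, ← Finset.mul_sum, ← Finset.mul_sum,
        ← avg_sum] at h1
      have h2 := avg_mono (G := G) ih x
      rw [avg_mul_left] at h2
      have h3 := hsuper x hx
      have h4 := hind x
      have h5 := ih x
      linarith
    · exact hout _ x hx

/-- By monotonicity the value at height `R` is at most the average over the heights `r, …, R`. After
translation the sum counts levels reached from height 0, which a Green function bounds. Averaging
gains the factor `1 / (R - r + 1)` over a bound for one level. -/
lemma hit_floorSet_le {B : V × ℤ → ℝ} (hB : ∀ x, 0 ≤ B x) {r R : ℤ} (hr : 0 ≤ r) (hrR : r ≤ R)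
    (hWA : W ⊆ A) (hsuper : ∀ x : V × ℤ, x.1 ∈ A →
      (open Classical in if x.1 ∈ W ∧ x.2 ≤ -r then 1 else 0) + avg G B x ≤ B x)
    (n : ℕ) {x : V × ℤ} (hx : |x.2| = R) :
    hit G (floorSet W) {y | y.1 ∈ A} n x ≤ 2 * B (x.1, 0) / (R - r + 1) := by
  refine hit_le_of_lazyHit_le (fun k => ?_) n
  have h1 : lazyHit G A W k x = lazyHit G A W k (x.1, R) := by
    rcases abs_eq (hr.trans hrR) |>.1 hx with h | h
    · rw [← h]
    · rw [show R = -x.2 by omega, lazyHit_neg]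
  have hpos : (0 : ℝ) < R - r + 1 := by
    have : (r : ℝ) ≤ R := by exact_mod_cast hrR
    linarith
  rw [h1, le_div_iff₀ hpos]
  have h2 := sum_lazyHit_le (R := R) hB hWA hsuper k (x.1, 0)
  have h3 : ∑ i ∈ Finset.Icc r R, lazyHit G A W k (x.1, R) ≤
      ∑ i ∈ Finset.Icc r R, lazyHit G A W k (x.1, 0 + i) := by
    refine Finset.sum_le_sum fun i hi => ?_
    rw [Finset.mem_Icc] at hi
    rw [zero_add]
    exact lazyHit_antitone k x.1 (by omega) hi.2
  rw [Finset.sum_const, nsmul_eq_mul, Int.card_Icc] at h3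
  have h4 : (((R + 1 - r).toNat : ℕ) : ℝ) = R - r + 1 := by
    have h5 : (((R + 1 - r).toNat : ℕ) : ℤ) = R + 1 - r := Int.toNat_of_nonneg (by omega)
    have h6 : (((R + 1 - r).toNat : ℕ) : ℝ) = ((R + 1 - r : ℤ) : ℝ) := by exact_mod_cast h5
    rw [h6]; push_cast; ring
  rw [h4] at h3
  linarith

end Lazy

/-! ### Counting vertical excursions -/

section Levels

variable {V : Type*} [Fintype V] {G : SimpleGraph V} {U : Set (V × ℤ)}

/-- Vertical excursions: a walk started above height `2 h'` makes on average at most `2 h / h'`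
attempts from height `h'` before reaching height `2 h`. -/
lemma hit_le_of_excursions (hU : ∀ x ∈ U, x.2 = 0) {h' h : ℕ} (hh' : 1 ≤ h') (hh : h' ≤ h) {n : ℕ}
    {u : ℝ} (hu : ∀ x : V × ℤ, |x.2| = h' → hit G U {y | |y.2| < 2 * h'} n x ≤ u)
    {x : V × ℤ} (hx : 2 * (h' : ℤ) ≤ |x.2|) :
    hit G U {y | |y.2| < 2 * h} n x ≤ 2 * h / h' * u := by
  classical
  set D : Set (V × ℤ) := {y | |y.2| < 2 * h} with hD
  let φ : V × ℤ → ℝ := fun y => if 2 * (h' : ℤ) ≤ |y.2| then hit G U D n y else 0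
  have hφ1 : ∀ y, φ y ≤ 1 := fun y => by
    simp only [φ]; split_ifs
    · exact hit_le_one _ _
    · exact zero_le_one
  have hbdd : BddAbove (Set.range φ) := ⟨1, by rintro _ ⟨y, rfl⟩; exact hφ1 y⟩
  set M := ⨆ y, φ y with hM
  have hMle : ∀ y : V × ℤ, 2 * (h' : ℤ) ≤ |y.2| → hit G U D n y ≤ M := fun y hy => by
    have := le_ciSup hbdd y
    simp only [φ, if_pos hy] at this
    exact this
  have hM0 : 0 ≤ M := (hit_nonneg n x).trans (hMle x hx)
  have hu0 : 0 ≤ u := (hit_nonneg n _).trans (hu (x.1, (h' : ℤ)) (by simp))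
  have hh1 : (1 : ℝ) ≤ h' := by exact_mod_cast hh'
  have hh2 : (h' : ℝ) ≤ h := by exact_mod_cast hh
  have hden : (0 : ℝ) < 2 * h - h' := by linarith
  have hnotU : ∀ y : V × ℤ, (h' : ℤ) ≤ |y.2| → y ∉ U := fun y hy hyU => by
    rw [hU y hyU, abs_zero] at hy; omega
  -- Up to height `2h` this is linear in `|z|`, equal to 1 at height `h'` and to 0 at `2h`: the
  -- probability of coming down to `h'` first. From there the walk succeeds before height `2h'`,
  -- with probability at most `u`, or starts afresh with bound `M`.
  let ℓ : V × ℤ → ℝ := fun y => max 0 ((2 * h - |(y.2 : ℝ)|) / (2 * h - h'))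
  have hℓ0 : ∀ y, 0 ≤ ℓ y := fun y => le_max_left _ _
  have key : ∀ k ≤ n, ∀ y : V × ℤ, (h' : ℤ) ≤ |y.2| → hit G U D k y ≤ (u + M) * ℓ y := by
    intro k
    induction k with
    | zero =>
      intro _ y hy
      rw [hit_zero_of_notMem (hnotU y hy)]
      exact mul_nonneg (by linarith) (hℓ0 y)
    | succ k ih =>
      intro hk y hy
      by_cases hyD : y ∈ D
      swap
      · rw [hit_of_notMem (hnotU y hy) hyD]
        exact mul_nonneg (by linarith) (hℓ0 y)
      have hyD' : |y.2| < 2 * (h : ℤ) := hyD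
      rcases hy.lt_or_eq with hlt | heq
      · rw [hit_succ (hnotU y hy) hyD]
        have h1 : avg G (hit G U D k) y ≤ avg G (fun y => (u + M) * ℓ y) y := by
          refine avg_mono_of (fun g _ => ih (by omega) _ hy) (ih (by omega) _ ?_)
            (ih (by omega) _ ?_)
          · simp only
            rcases abs_cases y.2 with ⟨h1, h2⟩ | ⟨h1, h2⟩ <;>
            rcases abs_cases (y.2 + 1) with ⟨h3, h4⟩ | ⟨h3, h4⟩ <;> omega
          · simp only
            rcases abs_cases y.2 with ⟨h1, h2⟩ | ⟨h1, h2⟩ <;>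
            rcases abs_cases (y.2 - 1) with ⟨h3, h4⟩ | ⟨h3, h4⟩ <;> omega
        refine h1.trans ?_
        rw [avg_mul_left]
        refine mul_le_mul_of_nonneg_left ?_ (by linarith)
        rw [avg_le_iff]
        have hval : ∀ (g : V) (z : ℤ), |z| ≤ 2 * (h : ℤ) →
            ℓ (g, z) = (2 * h - |(z : ℝ)|) / (2 * h - h') := by
          intro g z hz
          refine max_eq_right (div_nonneg ?_ hden.le)
          have : |(z : ℝ)| ≤ 2 * h := by exact_mod_cast hz
          linarith
        have hy0 : ℓ y = (2 * h - |(y.2 : ℝ)|) / (2 * h - h') := hval y.1 y.2 hyD'.le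
        have e1 : |y.2 + 1| ≤ 2 * (h : ℤ) := by
          rcases abs_cases y.2 with ⟨h1, h2⟩ | ⟨h1, h2⟩ <;>
            rcases abs_cases (y.2 + 1) with ⟨h3, h4⟩ | ⟨h3, h4⟩ <;> omega
        have e2 : |y.2 - 1| ≤ 2 * (h : ℤ) := by
          rcases abs_cases y.2 with ⟨h1, h2⟩ | ⟨h1, h2⟩ <;>
            rcases abs_cases (y.2 - 1) with ⟨h3, h4⟩ | ⟨h3, h4⟩ <;> omega
        have e3 : |((y.2 + 1 : ℤ) : ℝ)| + |((y.2 - 1 : ℤ) : ℝ)| = 2 * |(y.2 : ℝ)| := by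
          have : |y.2 + 1| + |y.2 - 1| = 2 * |y.2| := by
            rcases abs_cases y.2 with ⟨h1, h2⟩ | ⟨h1, h2⟩ <;>
            rcases abs_cases (y.2 + 1) with ⟨h3, h4⟩ | ⟨h3, h4⟩ <;>
            rcases abs_cases (y.2 - 1) with ⟨h5, h6⟩ | ⟨h5, h6⟩ <;> omega
          exact_mod_cast this
        have e4 : ∀ g ∈ nbrs G y.1, ℓ (g, y.2) = ℓ y := fun g _ => rfl
        rw [Finset.sum_congr rfl e4, Finset.sum_const, nsmul_eq_mul, hval _ _ e1, hval _ _ e2,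
          mul_add, mul_comm (ℓ y) ((nbrs G y.1).card : ℝ), add_assoc]
        refine add_le_add le_rfl (le_of_eq ?_)
        rw [hy0, ← add_div, div_mul_eq_mul_div]
        congr 1
        linarith
      · have h1 : ℓ y = 1 := by
          have : |(y.2 : ℝ)| = h' := by
            have : |y.2| = (h' : ℤ) := heq.symm
            exact_mod_cast this
          simp only [ℓ]
          rw [this, div_self hden.ne']
          exact max_eq_right zero_le_one
        rw [h1, mul_one]
        refine (hit_mono_time hk y).trans ?_
        have h2 := hit_le_hit_add (G := G) (U := U) (D := D) (D' := {y | |y.2| < 2 * (h' : ℤ)})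
          (n := n) hM0 (fun y hy _ => hMle y (by simpa using hy)) le_rfl y
        exact h2.trans (add_le_add (hu y heq.symm) le_rfl)
  -- From height `2h'` or above the chance of returning to `h'` is bounded away from one, so the
  -- inequality for `M` closes up.
  have hMbound : M ≤ (u + M) * ((2 * h - 2 * h') / (2 * h - h')) := by
    have : Nonempty (V × ℤ) := ⟨x⟩
    have h0 : 0 ≤ (u + M) * ((2 * h - 2 * h') / (2 * h - h') : ℝ) :=
      mul_nonneg (by linarith) (div_nonneg (by linarith) hden.le)
    refine ciSup_le fun y => ?_
    simp only [φ]
    split_ifs with hy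
    · refine (key n le_rfl y (by omega)).trans ?_
      refine mul_le_mul_of_nonneg_left ?_ (by linarith)
      refine max_le (div_nonneg (by linarith) hden.le) ?_
      have : 2 * (h' : ℝ) ≤ |(y.2 : ℝ)| := by exact_mod_cast hy
      gcongr
    · exact h0
  refine (hMle x hx).trans ?_
  rw [← mul_div_assoc, le_div_iff₀ hden] at hMbound
  rw [div_mul_eq_mul_div, le_div_iff₀ (by linarith)]
  nlinarith

end Levels

/-! ### Combining the three vertical scales -/

section Pocket

variable {V : Type*} [Fintype V] {G : SimpleGraph V} {A W : Finset V}

/-- Hitting probability of `W × {0}` from outside of the pocket, from its various ingredients. -/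
lemma hit_floorSet_univ_le {h' h n : ℕ} (hh' : 1 ≤ h') (hh : h' ≤ h)
    {τ uA ρ : ℝ} (hτ0 : 0 ≤ τ) (hρ0 : 0 ≤ ρ)
    (hτ : ∀ x : V × ℤ, x.1 ∉ A → hit G (floorSet W) {y | |y.2| < 2 * h'} n x ≤ τ)
    (hρ : ∀ x : V × ℤ, 2 * (h : ℤ) ≤ |x.2| → hit G (floorSet W) Set.univ n x ≤ ρ)
    (huA : h' < h → ∀ x : V × ℤ, |x.2| = h' → hit G (floorSet W) {y | y.1 ∈ A} n x ≤ uA)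
    (huA0 : 0 ≤ uA) {x : V × ℤ} (hx : x.1 ∉ A) :
    hit G (floorSet W) Set.univ n x ≤
      τ + ((if h' < h then 2 * h / h' * (uA + τ) else 0) + ρ) := by
  have hfloor : ∀ y ∈ floorSet W, y.2 = 0 := fun y hy => hy.2
  set M : ℝ := if h' < h then 2 * h / h' * (uA + τ) else 0 with hM
  have hM0 : 0 ≤ M := by rw [hM]; split_ifs <;> positivity
  have hhigh : ∀ y : V × ℤ, 2 * (h' : ℤ) ≤ |y.2| → hit G (floorSet W) Set.univ n y ≤ M + ρ := by
    intro y hy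
    have h1 := hit_le_hit_add (G := G) (U := floorSet W) (D := Set.univ)
      (D' := {y | |y.2| < 2 * (h : ℤ)}) (n := n) hρ0
      (fun y hy _ => hρ y (by simpa using hy)) le_rfl y
    refine h1.trans (add_le_add ?_ le_rfl)
    by_cases hlt : h' < h
    · rw [hM, if_pos hlt]
      refine hit_le_of_excursions hfloor hh' hh (fun z hz => ?_) hy
      -- During an attempt the walk either stays over `A`, or leaves it while still in the slab and
      -- then has probability at most `τ`.
      have h2 := hit_le_hit_add (G := G) (U := floorSet W) (D := {y | |y.2| < 2 * (h' : ℤ)})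
        (D' := {y | |y.2| < 2 * (h' : ℤ) ∧ y.1 ∈ A}) (n := n) hτ0 (fun y hy hyU => by
          by_cases hyA : y.1 ∈ A
          · have : y ∉ {y : V × ℤ | |y.2| < 2 * (h' : ℤ)} := fun h => hy ⟨h, hyA⟩
            rw [hit_of_notMem hyU this]; exact hτ0
          · exact hτ y hyA) le_rfl z
      refine h2.trans (add_le_add ?_ le_rfl)
      exact (hit_mono_set subset_rfl (fun y hy => hy.2) n z).trans (huA hlt z hz)
    -- Here `2h'` is already the far height, so the intermediate excursions disappear.
    · have heq : h' = h := by omega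
      rw [hM, if_neg hlt, hit_of_notMem]
      · intro hyU
        rw [hfloor y hyU, abs_zero] at hy
        omega
      · have : ¬ |y.2| < 2 * (h : ℤ) := by rw [← heq]; omega
        exact this
  have h1 := hit_le_hit_add (G := G) (U := floorSet W) (D := Set.univ)
    (D' := {y | |y.2| < 2 * (h' : ℤ)}) (n := n) (add_nonneg hM0 hρ0)
    (fun y hy _ => hhigh y (by simpa using hy)) le_rfl x
  exact h1.trans (add_le_add (hτ x hx) le_rfl)

/-- From hitting a floor to hitting a box. -/
lemma hit_box_le {n w : ℕ} {ρ : ℝ}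
    (hρ : ∀ x : V × ℤ, x.1 ∉ A → hit G (floorSet W) Set.univ n x ≤ ρ) {x : V × ℤ}
    (hx : x.1 ∉ A) : hit G (box W w) Set.univ n x ≤ (2 * w + 1) * ρ := by
  have h1 := hit_le_sum (G := G) (U := box W w) (D := Set.univ) (Finset.Icc (-(w : ℤ)) w)
    (fun i => {y | (y.1, y.2 + i) ∈ floorSet W}) (fun y hy => by
      refine ⟨-y.2, ?_, hy.1, by simp⟩
      have := abs_le.1 hy.2
      rw [Finset.mem_Icc]; omega) n x
  refine h1.trans ?_
  have h2 : ∀ i ∈ Finset.Icc (-(w : ℤ)) w,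
      hit G {y | (y.1, y.2 + i) ∈ floorSet W} Set.univ n x ≤ ρ := by
    intro i _
    have := hit_shift (G := G) (U := floorSet W) (D := Set.univ) i n x
    have huniv : {y : V × ℤ | (y.1, y.2 + i) ∈ (Set.univ : Set (V × ℤ))} = Set.univ := by
      ext; simp
    rw [huniv] at this
    rw [this]
    exact hρ _ hx
  refine (Finset.sum_le_card_nsmul _ _ _ h2).trans (le_of_eq ?_)
  rw [Int.card_Icc, nsmul_eq_mul]
  congr 1
  have : ((w : ℤ) + 1 - -w).toNat = 2 * w + 1 := by omega
  rw [this]; push_cast; ring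

end Pocket

/-! ### The killed Green function on the line -/

section LineGreen

/-- Decay rate of the Green function of the walk on `ℤ` killed at rate `s`. -/
def greenRatio (s : ℝ) : ℝ := (2 + s - √(s ^ 2 + 4 * s)) / 2

/-- Green function of the walk on `ℤ` killed at rate `s`. -/
def lineGreen (s : ℝ) (z : ℤ) : ℝ := greenRatio s ^ z.natAbs / √(s ^ 2 + 4 * s)

variable {s : ℝ}

/-- The characteristic equation: powers of its root solve the homogeneous killed equation away from
the origin. -/
lemma greenRatio_quadratic (hs : 0 < s) : greenRatio s ^ 2 + 1 = (2 + s) * greenRatio s := by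
  have h : √(s ^ 2 + 4 * s) ^ 2 = s ^ 2 + 4 * s := Real.sq_sqrt (by positivity)
  unfold greenRatio
  nlinarith

lemma greenRatio_pos (hs : 0 < s) : 0 < greenRatio s := by
  have h : √(s ^ 2 + 4 * s) < 2 + s := by
    rw [Real.sqrt_lt' (by positivity)]
    nlinarith
  unfold greenRatio
  linarith

lemma greenRatio_lt_one (hs : 0 < s) : greenRatio s < 1 := by
  have h : s < √(s ^ 2 + 4 * s) := by
    rw [Real.lt_sqrt hs.le]
    nlinarith
  unfold greenRatio
  linarith

/-- The quadratic reads `(1 - r)² = s r ≥ s r²`, whence `√s r ≤ 1 - r`. -/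
lemma greenRatio_le (hs : 0 < s) : greenRatio s ≤ 1 / (1 + √s) := by
  have h1 := greenRatio_quadratic hs
  have h2 := greenRatio_pos hs
  have h3 := greenRatio_lt_one hs
  have h4 : √s ^ 2 = s := Real.sq_sqrt hs.le
  have h5 : 0 < √s := Real.sqrt_pos.2 hs
  rw [le_div_iff₀ (by positivity)]
  have h6 : (√s * greenRatio s) ^ 2 ≤ (1 - greenRatio s) ^ 2 := by
    rw [mul_pow, h4]
    nlinarith
  have h7 := abs_le_of_sq_le_sq' h6 (by linarith)
  linarith [h7.2]

lemma two_mul_sqrt_le (hs : 0 < s) : 2 * √s ≤ √(s ^ 2 + 4 * s) := by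
  rw [Real.le_sqrt (by positivity) (by positivity), mul_pow, Real.sq_sqrt hs.le]
  nlinarith

lemma lineGreen_nonneg (hs : 0 < s) (z : ℤ) : 0 ≤ lineGreen s z :=
  div_nonneg (pow_nonneg (greenRatio_pos hs).le _) (Real.sqrt_nonneg _)

lemma lineGreen_le {s₀ : ℝ} (hs₀ : 0 < s₀) (hs : s₀ ≤ s) (z : ℤ) :
    lineGreen s z ≤ (1 / (1 + √s₀)) ^ z.natAbs / (2 * √s₀) := by
  have hs' : 0 < s := hs₀.trans_le hs
  have h1 := Real.sqrt_le_sqrt hs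
  have h2 := two_mul_sqrt_le hs'
  have h3 : 0 < √s₀ := Real.sqrt_pos.2 hs₀
  have h4 : greenRatio s ≤ 1 / (1 + √s₀) := (greenRatio_le hs').trans (by gcongr)
  have h5 := (greenRatio_pos hs').le
  unfold lineGreen
  gcongr
  linarith

lemma lineGreen_le' (hs : 0 < s) (z : ℤ) : lineGreen s z ≤ 1 / (2 * √s) := by
  refine (lineGreen_le hs le_rfl z).trans ?_
  have h3 : 0 < √s := Real.sqrt_pos.2 hs
  gcongr
  refine pow_le_one₀ (by positivity) ?_
  rw [div_le_one (by positivity)]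
  linarith

lemma lineGreen_equation (hs : 0 < s) (z : ℤ) :
    (s + 2) * lineGreen s z - lineGreen s (z + 1) - lineGreen s (z - 1) =
      if z = 0 then 1 else 0 := by
  have h0 := greenRatio_quadratic hs
  have hD : 0 < √(s ^ 2 + 4 * s) := Real.sqrt_pos.2 (by positivity)
  unfold lineGreen
  set r := greenRatio s with hr
  rw [← mul_div_assoc, ← sub_div, ← sub_div]
  split_ifs with hz
  · subst hz
    rw [div_eq_one_iff_eq hD.ne']
    simp only [Int.natAbs_zero, pow_zero, zero_add, Int.natAbs_one, pow_one, zero_sub,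
      Int.natAbs_neg]
    rw [hr]
    unfold greenRatio
    ring
  · rw [div_eq_zero_iff]
    left
    obtain ⟨k, hk⟩ : ∃ k, z.natAbs = k + 1 := ⟨z.natAbs - 1, by omega⟩
    rcases lt_or_gt_of_ne hz with hneg | hpos
    · have h1 : (z + 1).natAbs = k := by omega
      have h2 : (z - 1).natAbs = k + 2 := by omega
      rw [hk, h1, h2]
      linear_combination (-r ^ k) * h0
    · have h1 : (z + 1).natAbs = k + 2 := by omega
      have h2 : (z - 1).natAbs = k := by omega
      rw [hk, h1, h2]
      linear_combination (-r ^ k) * h0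

end LineGreen

/-! ### Hitting from far away by a spectral resolvent -/

section Resolvent

variable {V : Type*} [Fintype V] {G : SimpleGraph V}

/-- Multiplied by `deg + 2`, the generator is a sum of the base and vertical Laplacians. Variables
then separate even when the degrees are not constant. -/
lemma avg_eq_sub_lap (F : V × ℤ → ℝ) (x : V × ℤ) :
    ((nbrs G x.1).card + 2) * avg G F x = ((nbrs G x.1).card + 2) * F x -
      lap G (fun g => F (g, x.2)) x.1 - (2 * F x - F (x.1, x.2 + 1) - F (x.1, x.2 - 1)) := by
  have := avg_pos_denom (G := G) x.1
  rw [avg, mul_div_cancel₀ _ this.ne', lap, Finset.sum_sub_distrib, Finset.sum_const,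
    nsmul_eq_mul]
  ring

open Classical in
/-- A bounded solution of the resolvent equation is nonnegative. -/
lemma resolvent_nonneg {F : V × ℤ → ℝ} {κ c : ℝ} (hκ : 0 < κ) (hbdd : ∀ x, |F x| ≤ c)
    {U : Set (V × ℤ)} (heq : ∀ x, ((nbrs G x.1).card + 2) * avg G F x =
      ((nbrs G x.1).card + 2 + κ) * F x - if x ∈ U then 1 else 0) (x : V × ℤ) : 0 ≤ F x := by
  have hne : Nonempty (V × ℤ) := ⟨x⟩
  have hbelow : BddBelow (Set.range F) :=
    ⟨-c, by rintro _ ⟨y, rfl⟩; exact (abs_le.1 (hbdd y)).1⟩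
  set B := ⨅ y, F y with hB
  have hBle : ∀ y, B ≤ F y := fun y => ciInf_le hbelow y
  suffices h : 0 ≤ B from h.trans (hBle x)
  by_contra hneg
  push Not at hneg
  set D : ℝ := Fintype.card V + 2 with hD
  have hD0 : 0 < D := by positivity
  -- The infimum need not be attained. Killing gains a uniform factor below one at every vertex,
  -- which is impossible for a negative infimum.
  have key : ∀ y, D / (D + κ) * B ≤ F y := by
    intro y
    set d : ℝ := (nbrs G y.1).card + 2 with hd
    have hd0 : 0 < d := avg_pos_denom y.1
    have hdD : d ≤ D := by
      have : (nbrs G y.1).card ≤ Fintype.card V := Finset.card_le_univ _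
      have : ((nbrs G y.1).card : ℝ) ≤ Fintype.card V := by exact_mod_cast this
      linarith
    have h1 : B ≤ avg G F y := by
      have := avg_mono (G := G) (F := fun _ => B) hBle y
      rwa [avg_const] at this
    have h2 : d * B ≤ (d + κ) * F y := by
      have h3 := heq y
      have h4 : (0 : ℝ) ≤ if y ∈ U then 1 else 0 := by split_ifs <;> norm_num
      have h5 := mul_le_mul_of_nonneg_left h1 hd0.le
      linarith
    have h6 : d / (d + κ) * B ≤ F y := by
      rw [div_mul_eq_mul_div, div_le_iff₀ (by linarith)]
      linarith
    refine le_trans (mul_le_mul_of_nonpos_right ?_ hneg.le) h6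
    rw [div_le_div_iff₀ (by linarith) (by linarith)]
    nlinarith
  have h1 : D / (D + κ) * B ≤ B := le_ciInf key
  have h2 : D / (D + κ) < 1 := by rw [div_lt_one (by linarith)]; linarith
  nlinarith

/-- Hitting probabilities are bounded by solutions of the resolvent equation. -/
lemma hit_le_resolvent {F : V × ℤ → ℝ} {κ : ℝ} (hκ : 0 ≤ κ) (hκ1 : κ ≤ 1) (hF : ∀ x, 0 ≤ F x)
    {U : Set (V × ℤ)} {d₀ : ℕ} (hdeg : ∀ g, (nbrs G g).card ≤ d₀)
    (heq : ∀ x, ((nbrs G x.1).card + 2) * avg G F x =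
      ((nbrs G x.1).card + 2 + κ) * F x - (open Classical in if x ∈ U then 1 else 0))
    (k : ℕ) (x : V × ℤ) :
    hit G U Set.univ k x ≤ (1 + κ) ^ k * ((d₀ + 3) * F x) := by
  have hdc : ∀ g, ((nbrs G g).card : ℝ) ≤ d₀ := fun g => by exact_mod_cast hdeg g
  have hone : ∀ k : ℕ, (1 : ℝ) ≤ (1 + κ) ^ k := fun k => one_le_pow₀ (by linarith)
  -- On `U` the source gives `(deg + 2 + κ) F ≥ 1`; the factor `d₀ + 3` comes from here. Off `U`
  -- each step costs a factor at most `1 + κ`.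
  have hU : ∀ k : ℕ, ∀ x ∈ U, 1 ≤ (1 + κ) ^ k * ((d₀ + 3) * F x) := by
    intro k x hx
    have h1 := heq x
    rw [if_pos hx] at h1
    have h2 := avg_nonneg (G := G) hF x
    have h3 : (0 : ℝ) ≤ (nbrs G x.1).card := by positivity
    have h4 : 1 ≤ ((nbrs G x.1).card + 2 + κ) * F x := by nlinarith
    have h5 : ((nbrs G x.1).card + 2 + κ) * F x ≤ (d₀ + 3) * F x :=
      mul_le_mul_of_nonneg_right (by linarith [hdc x.1]) (hF x)
    nlinarith [hone k]
  induction k generalizing x with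
  | zero =>
    by_cases hx : x ∈ U
    · rw [hit_of_mem hx]; exact hU 0 x hx
    · rw [hit_zero_of_notMem hx]
      have := hF x
      positivity
  | succ k ih =>
    by_cases hx : x ∈ U
    · rw [hit_of_mem hx]; exact hU _ x hx
    · rw [hit_succ hx (Set.mem_univ x)]
      refine (avg_mono ih x).trans ?_
      rw [avg_mul_left, avg_mul_left, pow_succ, mul_assoc]
      refine mul_le_mul_of_nonneg_left ?_ (by linarith [hone k])
      have h1 := heq x
      rw [if_neg hx, sub_zero] at h1
      have hd := avg_pos_denom (G := G) x.1
      have h2 : avg G F x ≤ (1 + κ) * F x := by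
        have h3 : ((nbrs G x.1).card + 2) * avg G F x ≤
            ((nbrs G x.1).card + 2) * ((1 + κ) * F x) := by
          rw [h1]
          have h4 : 0 ≤ κ * F x := mul_nonneg hκ (hF x)
          have h5 : (0 : ℝ) ≤ (nbrs G x.1).card := by positivity
          nlinarith
        exact le_of_mul_le_mul_left h3 hd
      nlinarith [h2]

/-- Hitting probability of a horizontal set from far away, up to a long time. -/
lemma hit_floorSet_le_of_far (hG : G.Connected) {d₀ : ℕ}
    (hdeg : ∀ g, (nbrs G g).card ≤ d₀) (hgap : 0 < spectralGap G) (W : Finset V) {n : ℕ}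
    (hn : 1 ≤ n) (x : V × ℤ) :
    hit G (floorSet W) Set.univ n x ≤ 3 * (d₀ + 3) *
      (W.card / Fintype.card V * (√n / 2) +
        (W.card + 1) / 2 * ((1 / (1 + √(spectralGap G))) ^ x.2.natAbs /
          (2 * √(spectralGap G)))) := by
  classical
  obtain ⟨μ, φ, heig, horth, hcomp, hμ⟩ := exists_eigenbasis G
  have hne : Nonempty V := hG.nonempty
  have hN : (0 : ℝ) < Fintype.card V := by exact_mod_cast Fintype.card_pos
  have hn1 : (1 : ℝ) ≤ n := by exact_mod_cast hn
  -- Killing at rate `1/n` costs only `(1 + 1/n)^n ≤ 3` over the time horizon.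
  set κ : ℝ := 1 / n with hκdef
  have hκ : 0 < κ := by positivity
  have hκ1 : κ ≤ 1 := by rw [hκdef, div_le_one (by linarith)]; exact hn1
  have hs : ∀ i, 0 < κ + μ i := fun i => by linarith [hμ i]
  let c : V → ℝ := fun i => ∑ y ∈ W, φ i y
  let F : V × ℤ → ℝ := fun y => ∑ i, c i * φ i y.1 * lineGreen (κ + μ i) y.2
  have hsource : ∀ g, ∑ i, c i * φ i g = if g ∈ W then 1 else 0 := by
    intro g
    simp only [c, Finset.sum_mul]
    rw [Finset.sum_comm]
    simp only [hcomp]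
    simp
  have heq : ∀ y, ((nbrs G y.1).card + 2) * avg G F y =
      ((nbrs G y.1).card + 2 + κ) * F y - if y ∈ floorSet W then 1 else 0 := by
    intro y
    have h1 : lap G (fun g => F (g, y.2)) y.1 =
        ∑ i, c i * φ i y.1 * (μ i * lineGreen (κ + μ i) y.2) := by
      have : (fun g => F (g, y.2)) =
          fun g => ∑ i, (c i * lineGreen (κ + μ i) y.2) * φ i g := by
        funext g
        exact Finset.sum_congr rfl fun i _ => by ring
      rw [this, lap_sum_smul]
      refine Finset.sum_congr rfl fun i _ => ?_
      rw [heig]; ring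
    have h2 : κ * F y + lap G (fun g => F (g, y.2)) y.1 +
        (2 * F y - F (y.1, y.2 + 1) - F (y.1, y.2 - 1)) =
        ∑ i, c i * φ i y.1 * (if y.2 = 0 then 1 else 0) := by
      rw [h1]
      simp only [F, Finset.mul_sum]
      rw [← Finset.sum_sub_distrib, ← Finset.sum_sub_distrib, ← Finset.sum_add_distrib,
        ← Finset.sum_add_distrib]
      refine Finset.sum_congr rfl fun i _ => ?_
      rw [← lineGreen_equation (hs i) y.2]
      ring
    rw [← Finset.sum_mul, hsource] at h2
    have h3 : (if y.1 ∈ W then (1 : ℝ) else 0) * (if y.2 = 0 then 1 else 0) =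
        if y ∈ floorSet W then 1 else 0 := by
      by_cases ha : y.1 ∈ W <;> by_cases hb : y.2 = 0 <;> simp [floorSet, ha, hb]
    rw [avg_eq_sub_lap, ← h3, ← h2]
    ring
  have hbdd : ∀ y, |F y| ≤ ∑ g, ∑ i, |c i * φ i g| * (1 / (2 * √(κ + μ i))) := by
    intro y
    have h1 : |F y| ≤ ∑ i, |c i * φ i y.1| * (1 / (2 * √(κ + μ i))) := by
      refine (Finset.abs_sum_le_sum_abs _ _).trans (Finset.sum_le_sum fun i _ => ?_)
      rw [abs_mul, abs_of_nonneg (lineGreen_nonneg (hs i) _)]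
      exact mul_le_mul_of_nonneg_left (lineGreen_le' (hs i) _) (abs_nonneg _)
    exact h1.trans (Finset.single_le_sum
      (f := fun g => ∑ i, |c i * φ i g| * (1 / (2 * √(κ + μ i))))
      (fun g _ => Finset.sum_nonneg fun i _ => by positivity) (Finset.mem_univ y.1))
  have hF0 := resolvent_nonneg (G := G) hκ hbdd heq
  have hhit := hit_le_resolvent hκ.le hκ1 hF0 hdeg heq n x
  have hexp : (1 + κ) ^ n ≤ 3 := by
    have h1 : 1 + κ ≤ Real.exp κ := by linarith [Real.add_one_le_exp κ]
    calc (1 + κ) ^ n ≤ Real.exp κ ^ n := by gcongr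
      _ = Real.exp (n * κ) := (Real.exp_nat_mul κ n).symm
      _ = Real.exp 1 := by rw [hκdef]; congr 1; field_simp
      _ ≤ 3 := by linarith [Real.exp_one_lt_d9]
  refine hhit.trans ?_
  rw [mul_assoc]
  refine mul_le_mul hexp (mul_le_mul_of_nonneg_left ?_ (by positivity))
    (mul_nonneg (by positivity) (hF0 x)) (by norm_num)
  let S : Finset V := Finset.univ.filter fun i => ¬ ∃ b, ∀ g, φ i g = b
  set γ := (1 / (1 + √(spectralGap G))) ^ x.2.natAbs / (2 * √(spectralGap G)) with hγ
  have hγ0 : 0 ≤ γ := by positivity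
  -- By orthonormality there is at most one constant mode; it carries the equilibrium weight `|W| /
  -- |V|` and no decay in height. All other modes decay at a rate set by the spectral gap.
  have hFS : F x = ∑ i ∈ Sᶜ, c i * φ i x.1 * lineGreen (κ + μ i) x.2 +
      ∑ i ∈ S, c i * φ i x.1 * lineGreen (κ + μ i) x.2 := by
    rw [add_comm, Finset.sum_add_sum_compl]
  have hconst : ∀ i ∈ Sᶜ, ∃ b, ∀ g, φ i g = b := by
    intro i hi
    rw [Finset.mem_compl, Finset.mem_filter] at hi
    push Not at hi
    exact hi (Finset.mem_univ i)
  have hcard : Sᶜ.card ≤ 1 := by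
    rw [Finset.card_le_one]
    intro i hi j hj
    by_contra hij
    obtain ⟨b, hb⟩ := hconst i hi
    obtain ⟨b', hb'⟩ := hconst j hj
    have h1 := horth i i
    have h2 := horth j j
    have h3 := horth i j
    rw [if_pos rfl] at h1 h2
    rw [if_neg hij] at h3
    simp only [hb, hb', Finset.sum_const, Finset.card_univ, nsmul_eq_mul] at h1 h2 h3
    rcases mul_eq_zero.1 h3 with h | h
    · exact hN.ne' h
    · rcases mul_eq_zero.1 h with h | h
      · rw [h] at h1; simp at h1
      · rw [h] at h2; simp at h2
  have hpart1 : ∑ i ∈ Sᶜ, c i * φ i x.1 * lineGreen (κ + μ i) x.2 ≤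
      W.card / Fintype.card V * (√n / 2) := by
    have h1 : ∀ i ∈ Sᶜ, c i * φ i x.1 * lineGreen (κ + μ i) x.2 ≤
        W.card / Fintype.card V * (√n / 2) := by
      intro i hi
      obtain ⟨b, hb⟩ := hconst i hi
      have h2 := horth i i
      rw [if_pos rfl] at h2
      simp only [hb, Finset.sum_const, Finset.card_univ, nsmul_eq_mul] at h2
      have h3 : c i * φ i x.1 = W.card / Fintype.card V := by
        simp only [c, hb, Finset.sum_const, nsmul_eq_mul]
        field_simp
        linear_combination (W.card : ℝ) * h2
      rw [h3]
      refine mul_le_mul_of_nonneg_left ?_ (by positivity)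
      refine (lineGreen_le' (hs i) _).trans ?_
      have h4 : √κ ≤ √(κ + μ i) := Real.sqrt_le_sqrt (by linarith [hμ i])
      have h5 : 0 < √κ := Real.sqrt_pos.2 hκ
      calc 1 / (2 * √(κ + μ i)) ≤ 1 / (2 * √κ) := by gcongr
        _ = √n / 2 := by
          rw [hκdef, Real.sqrt_div zero_le_one, Real.sqrt_one]
          have : 0 < √(n : ℝ) := Real.sqrt_pos.2 (by linarith)
          field_simp
    have h0 : (0 : ℝ) ≤ W.card / Fintype.card V * (√n / 2) := by positivity
    have h2 := Finset.sum_le_card_nsmul _ _ _ h1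
    rw [nsmul_eq_mul] at h2
    have h3 : (Sᶜ.card : ℝ) ≤ 1 := by exact_mod_cast hcard
    nlinarith
  have hpart2 : ∑ i ∈ S, c i * φ i x.1 * lineGreen (κ + μ i) x.2 ≤ (W.card + 1) / 2 * γ := by
    -- Separates the coefficients so that Parseval sums them: `∑ c i ^ 2 = |W|` and `∑ φ i x.1 ^ 2 =
    -- 1`.
    have h1 : ∀ i ∈ S, c i * φ i x.1 * lineGreen (κ + μ i) x.2 ≤
        (c i ^ 2 + φ i x.1 ^ 2) / 2 * γ := by
      intro i hi
      have hgap' : spectralGap G ≤ κ + μ i := by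
        have := spectralGap_le_eigenvalue hG (hμ i) (Finset.mem_filter.1 hi).2 (heig i)
        linarith
      have h2 := lineGreen_le hgap hgap' x.2
      have h3 := lineGreen_nonneg (hs i) x.2
      have h4 : c i * φ i x.1 ≤ (c i ^ 2 + φ i x.1 ^ 2) / 2 := by
        nlinarith [sq_nonneg (c i - φ i x.1)]
      exact mul_le_mul h4 h2 h3 (by positivity)
    refine (Finset.sum_le_sum h1).trans ?_
    rw [← Finset.sum_mul]
    refine mul_le_mul_of_nonneg_right ?_ hγ0
    rw [← Finset.sum_div]
    refine div_le_div_of_nonneg_right ?_ (by norm_num)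
    refine (Finset.sum_le_sum_of_subset_of_nonneg (Finset.subset_univ S)
      fun i _ _ => by positivity).trans ?_
    rw [Finset.sum_add_distrib]
    have h5 : ∑ i, φ i x.1 ^ 2 = 1 := by
      have := hcomp x.1 x.1
      rw [if_pos rfl] at this
      rw [← this]
      exact Finset.sum_congr rfl fun i _ => by ring
    have h6 : ∑ i, c i ^ 2 = W.card := by
      have : ∀ i, c i ^ 2 = ∑ y ∈ W, c i * φ i y := fun i => by
        rw [sq, ← Finset.mul_sum]
      simp only [this]
      rw [Finset.sum_comm]
      simp only [hsource]
      simp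
    rw [h5, h6]
  rw [hFS]
  exact add_le_add hpart1 hpart2

end Resolvent

/-! ### Degrees and an upper bound for the spectral gap -/

section Basic

variable {V : Type*} [Fintype V] {G : SimpleGraph V}

lemma nbrs_nonempty (hG : G.Connected) (hV : 2 ≤ Fintype.card V) (g : V) : (nbrs G g).Nonempty := by
  have : Nontrivial V := Fintype.one_lt_card_iff_nontrivial.1 hV
  obtain ⟨g', hg'⟩ := hG.preconnected.exists_adj_of_nontrivial g
  exact ⟨g', (mem_nbrs G).2 hg'⟩

lemma card_nbrs (g : V) : (nbrs G g).card = (G.neighborSet g).ncard := by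
  rw [← Set.ncard_coe_finset]
  congr 1
  ext g'
  simp [mem_nbrs]

/-- The indicator function of a vertex as a test function. -/
lemma spectralGap_le (hV : 2 ≤ Fintype.card V) {d₀ : ℕ} (hdeg : ∀ g, (nbrs G g).card ≤ d₀) :
    spectralGap G ≤ 2 * d₀ := by
  classical
  have : Nontrivial V := Fintype.one_lt_card_iff_nontrivial.1 hV
  obtain ⟨v, v', hvv'⟩ := exists_pair_ne V
  set N : ℝ := (Fintype.card V : ℝ) with hN
  have hN2 : (2 : ℝ) ≤ N := by rw [hN]; exact_mod_cast hV
  set f : V → ℝ := fun g => if g = v then 1 else 0 with hf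
  have hfc : ¬ ∃ c, ∀ g, f g = c := by
    rintro ⟨c, hc⟩
    have h1 := hc v
    have h2 := hc v'
    simp [hf, hvv'.symm] at h1 h2
    linarith
  have hsum : ∑ g, f g = 1 := by simp [hf]
  have hvar : unifVar f = 1 / N * (1 - 1 / N) := by
    have h1 : ∀ g, (f g - unifMean f) ^ 2 = f g * (1 - 2 * unifMean f) + unifMean f ^ 2 := by
      intro g
      simp only [hf]
      split_ifs <;> ring
    have h2 : unifMean f = 1 / N := by rw [unifMean, hsum, mul_one]
    rw [unifVar, Finset.sum_congr rfl fun g _ => h1 g, Finset.sum_add_distrib, ← Finset.sum_mul, hsum,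
      Finset.sum_const, Finset.card_univ, nsmul_eq_mul, ← hN, h2]
    field_simp
    ring
  have hdir : dirichletForm G f ≤ d₀ / N := by
    have h1 : ∀ g g', (if G.Adj g g' then (f g' - f g) ^ 2 else 0) ≤
        (if g = v ∧ G.Adj v g' then (1 : ℝ) else 0) + (if g' = v ∧ G.Adj v g then 1 else 0) := by
      intro g g'
      by_cases h : G.Adj g g'
      · by_cases hg : g = v
        · subst hg
          have : g' ≠ g := fun h' => G.loopless.irrefl _ (h' ▸ h)
          simp [hf, h, this]
        · by_cases hg' : g' = v
          · subst hg'
            simp [hf, h, h.symm, hg]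
          · simp [hf, h, hg, hg']
      · simp only [h, if_false]
        positivity
    have h2 : ∑ g, ∑ g', (if g = v ∧ G.Adj v g' then (1 : ℝ) else 0) = (nbrs G v).card := by
      rw [Finset.sum_eq_single v (fun b _ hb => by simp [hb]) (by simp)]
      simp [nbrs, Finset.sum_boole]
    have h3 : ∑ g, ∑ g', (if g' = v ∧ G.Adj v g then (1 : ℝ) else 0) = (nbrs G v).card := by
      rw [Finset.sum_comm, h2]
    have h4 : ∑ g, ∑ g', (if G.Adj g g' then (f g' - f g) ^ 2 else 0) ≤ 2 * (d₀ : ℝ) := by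
      refine (Finset.sum_le_sum fun g _ => Finset.sum_le_sum fun g' _ => h1 g g').trans ?_
      simp only [Finset.sum_add_distrib, h2, h3]
      have : ((nbrs G v).card : ℝ) ≤ d₀ := by exact_mod_cast hdeg v
      linarith
    rw [dirichletForm, ← hN, div_mul_eq_mul_div, one_mul, div_le_div_iff₀ (by positivity) (by positivity)]
    have : (0:ℝ) ≤ N := by positivity
    have h5 := mul_le_mul_of_nonneg_right h4 this
    convert (h5.trans_eq (by ring : _ = d₀ * (2 * N))) using 2
  refine (spectralGap_le_div hfc).trans ?_
  rw [hvar, div_le_iff₀ (mul_pos (by positivity) (by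
    rw [sub_pos, div_lt_one (by positivity)]; linarith))]
  refine hdir.trans ?_
  have h6 : 1 / N ≤ 1 / 2 := one_div_le_one_div_of_le (by norm_num) hN2
  have h7 : (d₀ : ℝ) / N = 2 * d₀ * (1 / N * (1 / 2)) := by ring
  rw [h7]
  gcongr
  linarith

end Basic

/-! ### Descending inside the pocket, and visits to the box -/

section Climb

variable {V : Type*} [Fintype V] [DecidableEq V] {G : SimpleGraph V} {A W : Finset V} {γ K : ℝ}

/-- The killed walk is unlikely to come down from height `R` to the floor of the pocket. -/
lemma hit_floorSet_pocket_le (hγ : 1 < γ) (hK : 0 ≤ K)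
    (hp : ∀ k : ℕ, 2 ≤ k → ∀ g, killedProb G A W k g ≤ K * (k : ℝ) ^ (-γ)) (hWA : W ⊆ A)
    (hpos : ∀ g, (nbrs G g).Nonempty) {ℓ : ℝ} (hℓ : 1 ≤ ℓ) {R : ℕ} (hR : 64 * ℓ ≤ R) (n : ℕ)
    {x : V × ℤ} (hx : |x.2| = R) :
    hit G (floorSet W) {y | y.1 ∈ A} n x ≤
      24 * R * Real.exp (-ℓ / 2) + 12 * K / (γ - 1) * (256 * ℓ) ^ (γ - 1) * (R : ℝ) ^ (1 - 2 * γ) := by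
  -- Averaging over the upper half of the heights gains a factor of order `1/R` in
  -- `hit_floorSet_le`.
  set r : ℕ := R / 2 with hr
  have hR0 : (0 : ℝ) < R := by linarith
  have hr1 : (R : ℝ) / 4 ≤ r := by
    have : R ≤ 4 * r := by
      have : 64 ≤ R := by exact_mod_cast (by linarith : (64 : ℝ) ≤ R)
      omega
    have : (R : ℝ) ≤ 4 * r := by exact_mod_cast this
    linarith
  have hr2 : (r : ℝ) ≤ R / 2 := by
    have : 2 * r ≤ R := by omega
    have : 2 * (r : ℝ) ≤ R := by exact_mod_cast this
    linarith
  have hr0 : (0 : ℝ) < r := by linarith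
  have hrℓ : 16 * ℓ ≤ r := by linarith
  have hγ1 : 0 < γ - 1 := by linarith
  set θ : ℝ := ℓ / r with hθ
  have hθ0 : 0 < θ := by positivity
  have hθr : θ * r = ℓ := by rw [hθ]; field_simp
  have hθ1 : |θ| ≤ 1 / 2 := by
    rw [abs_of_pos hθ0, hθ, div_le_iff₀ hr0]
    linarith
  have hq : 16 * ℓ * (16 * ℓ) ≤ (r : ℝ) ^ 2 := by
    rw [sq]
    gcongr
  -- With `θ r = ℓ`, this is the time up to which `4 θ² k ≤ ℓ / 2`, so that the profile stays below
  -- `2 exp (-ℓ / 2)`. Later contributions come from the heat kernel tail, of order `k₀ ^ (1 - γ)`.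
  set k₀ : ℕ := ⌊(r : ℝ) ^ 2 / (8 * ℓ)⌋₊ with hk₀
  have hk1 : (k₀ : ℝ) ≤ r ^ 2 / (8 * ℓ) := Nat.floor_le (by positivity)
  have hk2 : (r : ℝ) ^ 2 / (8 * ℓ) < k₀ + 1 := Nat.lt_floor_add_one _
  have hq2 : 32 ≤ (r : ℝ) ^ 2 / (8 * ℓ) := by
    rw [le_div_iff₀ (by positivity)]
    nlinarith
  have hk3 : 2 ≤ k₀ := by
    have : (2 : ℝ) ≤ k₀ := by linarith
    exact_mod_cast this
  have hk4 : (R : ℝ) ^ 2 / (256 * ℓ) ≤ k₀ - 1 := by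
    have h1 : (R : ℝ) ^ 2 / (256 * ℓ) ≤ (r : ℝ) ^ 2 / (8 * ℓ) / 2 := by
      rw [div_div, div_le_div_iff₀ (by positivity) (by positivity)]
      have : (R : ℝ) ^ 2 ≤ 16 * r ^ 2 := by nlinarith
      nlinarith
    linarith
  have hk5 : (k₀ : ℝ) ≤ R ^ 2 := by
    refine hk1.trans ((div_le_self (by positivity) (by linarith)).trans ?_)
    gcongr
    omega
  have hb : IsProfile (climbProfile θ r) := isProfile_climbProfile hθ1
  have hsuper : ∀ y : V × ℤ, y.1 ∈ A → (open Classical in if y.1 ∈ W ∧ y.2 ≤ -(r : ℤ) then (1 : ℝ) else 0) +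
      avg G (greenBarrier G A W (climbProfile θ r)) y ≤ greenBarrier G A W (climbProfile θ r) y := by
    intro y hy
    refine le_trans ?_ (greenBarrier_supersolution hγ hK hp hb hWA hpos hy)
    gcongr
    by_cases hyW : y.1 ∈ W
    · simp only [hyW, true_and, if_true]
      split_ifs with hyr
      · rw [climbProfile, le_min_iff]
        refine ⟨le_rfl, ?_⟩
        -- The prefactor 2 in `climbProfile` makes it equal to one at time 0 on all levels at or
        -- below `-r`.
        have h1 : Real.exp (θ * r) ≤ 2 * Real.cosh (θ * y.2) := by
          have h2 : θ * r ≤ -(θ * y.2) := by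
            have : (y.2 : ℝ) ≤ -r := by exact_mod_cast hyr
            nlinarith
          have h3 := Real.exp_le_exp.2 h2
          rw [Real.cosh_eq]
          have := Real.exp_pos (θ * y.2)
          linarith
        have h4 : Real.exp (-θ * r) * Real.exp (θ * r) = 1 := by
          rw [← Real.exp_add]
          simp
        have h5 := mul_le_mul_of_nonneg_left h1 (Real.exp_pos (-θ * r)).le
        simp only [CharP.cast_eq_zero, mul_zero, Real.exp_zero, mul_one]
        linarith
      · rw [climbProfile]
        have := Real.cosh_pos (θ * y.2)
        positivity
    · simp [hyW]
  refine (hit_floorSet_le (greenBarrier_nonneg hb) (r := r) (R := R) (by positivity)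
    (by omega) hWA (fun y hy => by convert hsuper y hy) n hx).trans ?_
  have hB := greenBarrier_le (G := G) (A := A) (W := W) hγ hK hp hb hk3 (x.1, 0)
  have hsum : ∑ k ∈ Finset.range k₀, climbProfile θ r (k + 1) 0 ≤ R ^ 2 * (2 * Real.exp (-ℓ / 2)) := by
    have h1 : ∀ k ∈ Finset.range k₀, climbProfile θ r (k + 1) 0 ≤ 2 * Real.exp (-ℓ / 2) := by
      intro k hk
      refine (min_le_right _ _).trans ?_
      simp only [Int.cast_zero, mul_zero, Real.cosh_zero, mul_one]
      rw [mul_assoc, ← Real.exp_add]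
      gcongr
      have h2 : ((k + 1 : ℕ) : ℝ) ≤ r ^ 2 / (8 * ℓ) := by
        refine le_trans ?_ hk1
        exact_mod_cast Finset.mem_range.1 hk
      have h3 : 4 * θ ^ 2 * ((k + 1 : ℕ) : ℝ) ≤ 4 * θ ^ 2 * (r ^ 2 / (8 * ℓ)) := by gcongr
      have h4 : 4 * θ ^ 2 * (r ^ 2 / (8 * ℓ)) = ℓ / 2 := by
        rw [hθ]
        field_simp
        norm_num
      linarith
    refine (Finset.sum_le_card_nsmul _ _ _ h1).trans ?_
    rw [Finset.card_range, nsmul_eq_mul]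
    gcongr
  have hpow : ((k₀ : ℝ) - 1) ^ (1 - γ) ≤ (256 * ℓ) ^ (γ - 1) * (R : ℝ) ^ (2 - 2 * γ) := by
    have h1 : ((k₀ : ℝ) - 1) ^ (1 - γ) ≤ ((R : ℝ) ^ 2 / (256 * ℓ)) ^ (1 - γ) :=
      Real.rpow_le_rpow_of_nonpos (by positivity) hk4 (by linarith)
    refine h1.trans_eq ?_
    rw [Real.div_rpow (by positivity) (by positivity), div_eq_mul_inv, ← Real.rpow_neg (by positivity),
      ← Real.rpow_natCast, ← Real.rpow_mul hR0.le, mul_comm]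
    congr 2
    · ring
    · push_cast; ring
  have hden : (R : ℝ) / 2 ≤ ((R : ℤ) : ℝ) - ((r : ℤ) : ℝ) + 1 := by
    push_cast
    linarith
  have hB0 : greenBarrier G A W (climbProfile θ r) (x.1, 0) ≤
      3 * (R ^ 2 * (2 * Real.exp (-ℓ / 2)) +
        K * ((256 * ℓ) ^ (γ - 1) * (R : ℝ) ^ (2 - 2 * γ)) / (γ - 1)) := by
    refine hB.trans ?_
    gcongr
  calc 2 * greenBarrier G A W (climbProfile θ r) (x.1, 0) / (((R : ℤ) : ℝ) - ((r : ℤ) : ℝ) + 1)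
      ≤ 2 * (3 * (R ^ 2 * (2 * Real.exp (-ℓ / 2)) +
        K * ((256 * ℓ) ^ (γ - 1) * (R : ℝ) ^ (2 - 2 * γ)) / (γ - 1))) / (R / 2) := by
        gcongr
    _ = _ := by
        have h1 : (R : ℝ) ^ (2 - 2 * γ) = R ^ (1 - 2 * γ) * R := by
          rw [← Real.rpow_add_one hR0.ne']
          ring_nf
        rw [h1]
        field_simp
        ring

/-- Expected number of visits to the box over a set on which the killed walk is transient. -/
lemma visits_box_le (hγ : 1 < γ) {K' : ℝ} (hK' : 0 ≤ K') (hW : 1 ≤ W.card)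
    (hp : ∀ k : ℕ, 2 ≤ k → ∀ g, killedProb G A W k g ≤ W.card * K' * (k : ℝ) ^ (-γ)) (hWA : W ⊆ A)
    (hpos : ∀ g, (nbrs G g).Nonempty) {n : ℕ}
    (hexit : ∀ x : V × ℤ, x.1 ∉ A → hit G (box W W.card) Set.univ n x ≤ 1 / 2) (x : V × ℤ) :
    visits G (box W W.card) n x ≤ 6 * (3 + K' / (γ - 1)) * (W.card : ℝ) ^ (1 / γ) := by
  have hγ1 : 0 < γ - 1 := by linarith
  set w : ℝ := (W.card : ℝ) with hw
  have hw1 : 1 ≤ w := by rw [hw]; exact_mod_cast hW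
  -- The balancing time: the first `q` terms contribute order `q`, and the tail `w q ^ (1 - γ)`
  -- equals `q` exactly.
  set q : ℝ := w ^ (1 / γ) with hq
  have hq1 : 1 ≤ q := Real.one_le_rpow hw1 (by positivity)
  have hqγ : w * q ^ (1 - γ) = q := by
    rw [hq, ← Real.rpow_mul (by positivity)]
    nth_rewrite 1 [← Real.rpow_one w]
    rw [← Real.rpow_add (by positivity)]
    congr 1
    field_simp
    ring
  set k₀ : ℕ := ⌈q⌉₊ + 1 with hk₀
  have hk1 : q ≤ (k₀ : ℝ) - 1 := by
    rw [hk₀]; push_cast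
    linarith [Nat.le_ceil q]
  have hk2 : (k₀ : ℝ) ≤ 3 * q := by
    rw [hk₀]; push_cast
    linarith [(Nat.ceil_lt_add_one (by positivity : 0 ≤ q)).le]
  have hk3 : 2 ≤ k₀ := by
    have : 1 ≤ ⌈q⌉₊ := Nat.one_le_ceil_iff.2 (by positivity)
    omega
  have hM : ∀ y, greenBarrier G A W (fun _ _ => 1) y ≤ 3 * (3 + K' / (γ - 1)) * q := by
    intro y
    refine (greenBarrier_le (G := G) (A := A) (W := W) hγ (by positivity) hp isProfile_one hk3 y).trans ?_
    have h1 : ((k₀ : ℝ) - 1) ^ (1 - γ) ≤ q ^ (1 - γ) :=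
      Real.rpow_le_rpow_of_nonpos (by positivity) hk1 (by linarith)
    have h2 : w * K' * ((k₀ : ℝ) - 1) ^ (1 - γ) / (γ - 1) ≤ K' / (γ - 1) * q := by
      calc w * K' * ((k₀ : ℝ) - 1) ^ (1 - γ) / (γ - 1) ≤ w * K' * q ^ (1 - γ) / (γ - 1) := by gcongr
        _ = K' / (γ - 1) * (w * q ^ (1 - γ)) := by ring
        _ = _ := by rw [hqγ]
    simp only [Finset.sum_const, Finset.card_range, nsmul_eq_mul, mul_one]
    nlinarith
  have := visits_le_two_mul (G := G) (C := box W W.card) (D := {y : V × ℤ | y.1 ∈ A}) (n := n)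
    (greenBarrier_nonneg isProfile_one) hM (fun y hy => by
      refine le_trans ?_ (greenBarrier_supersolution hγ (by positivity) hp isProfile_one hWA hpos hy)
      gcongr
      by_cases hyW : y.1 ∈ W
      · simp only [hyW, if_true]
        exact Set.indicator_le_self' (fun _ _ => zero_le_one) y
      · rw [Set.indicator_of_notMem (fun h => hyW h.1)]
        simp [hyW]) hexit x
  linarith

end Climb

/-! ### The height beyond which the base has mixed -/

section Height

variable {V : Type*} [Fintype V] {G : SimpleGraph V}

lemma one_le_height : 1 ≤ height G := by
  rw [height]
  omega

lemma sqrt_relaxScale (hgap : 0 < spectralGap G) :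
    √(relaxScale G) = (√(spectralGap G))⁻¹ * √(Real.log (2 * Fintype.card V)) := by
  rw [relaxScale, Real.sqrt_mul (by positivity), Real.sqrt_inv]

/-- An upper bound `D` on the gap makes `√D / √λ_G ≥ 1`, which absorbs the rounding in the
definition of `height`. -/
lemma height_le {D : ℝ} (hgap : 0 < spectralGap G) (hD : spectralGap G ≤ D)
    (hL : 2 ≤ Real.log (Fintype.card V)) :
    (height G : ℝ) ≤ (2 + 2 * √D) * Real.log (Fintype.card V) ^ 3 * (√(spectralGap G))⁻¹ := by
  set L := Real.log (Fintype.card V) with hLd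
  set σ := (√(spectralGap G))⁻¹ with hσ
  have hs : 0 < √(spectralGap G) := Real.sqrt_pos.2 hgap
  have hσ0 : 0 < σ := by positivity
  have hN0 : (Fintype.card V : ℝ) ≠ 0 := by
    intro h
    rw [hLd, h, Real.log_zero] at hL
    linarith
  have hlog : √(Real.log (2 * Fintype.card V)) ≤ L := by
    rw [Real.sqrt_le_left (by linarith), Real.log_mul (by norm_num) hN0, ← hLd]
    have := Real.log_two_lt_d9
    nlinarith
  have hone : 1 ≤ √D * σ := by
    rw [hσ, ← div_eq_mul_inv, le_div_iff₀ hs, one_mul]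
    exact Real.sqrt_le_sqrt hD
  have hfl := Nat.floor_le (a := √(relaxScale G) * L ^ 2) (by positivity)
  have hL3 : 1 ≤ L ^ 3 := one_le_pow₀ (by linarith)
  have h1 : √(relaxScale G) * L ^ 2 ≤ σ * L ^ 3 := by
    rw [sqrt_relaxScale hgap]
    calc σ * √(Real.log (2 * Fintype.card V)) * L ^ 2 ≤ σ * L * L ^ 2 := by gcongr
      _ = _ := by ring
  rw [height]
  push_cast
  have h2 : 1 ≤ √D * σ * L ^ 3 := by nlinarith
  nlinarith

/-- Here `2h` is at least `4 (log |V|)² / √λ_G`, while each level contributes a rate `log (1 + s) ≥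
s / (1 + s)` with `s = √λ_G`. -/
lemma pow_le_exp_neg_of_height_le {D : ℝ} (hgap : 0 < spectralGap G) (hD : spectralGap G ≤ D)
    (hL : 2 ≤ Real.log (Fintype.card V)) {k : ℕ} (hk : 2 * height G ≤ k) :
    (1 / (1 + √(spectralGap G))) ^ k ≤
      Real.exp (-(4 * Real.log (Fintype.card V) ^ 2 / (1 + √D))) := by
  set L := Real.log (Fintype.card V) with hLd
  set s := √(spectralGap G) with hs'
  have hs : 0 < s := Real.sqrt_pos.2 hgap
  have hsD : s ≤ √D := Real.sqrt_le_sqrt hD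
  have hN0 : (Fintype.card V : ℝ) ≠ 0 := by
    intro h
    rw [hLd, h, Real.log_zero] at hL
    linarith
  have hlog : 1 ≤ √(Real.log (2 * Fintype.card V)) := by
    rw [Real.one_le_sqrt, Real.log_mul (by norm_num) hN0, ← hLd]
    have := Real.log_pos (show (1 : ℝ) < 2 by norm_num)
    linarith
  have hk' : 4 * s⁻¹ * L ^ 2 ≤ k := by
    have h1 := (Nat.lt_floor_add_one (√(relaxScale G) * L ^ 2)).le
    have h2 : s⁻¹ * 1 * L ^ 2 ≤ √(relaxScale G) * L ^ 2 := by
      rw [sqrt_relaxScale hgap]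
      gcongr
    have h3 : (2 * height G : ℝ) ≤ k := by exact_mod_cast hk
    rw [height] at h3
    push_cast at h3
    linarith
  have hlog2 : s / (1 + s) ≤ Real.log (1 + s) := by
    have := Real.one_sub_inv_le_log_of_pos (show 0 < 1 + s by positivity)
    refine le_trans (le_of_eq ?_) this
    field_simp
    ring
  rw [one_div, inv_pow, ← Real.rpow_natCast, ← Real.rpow_neg (by positivity),
    Real.rpow_def_of_pos (by positivity)]
  gcongr
  have h4 : 4 * L ^ 2 / (1 + √D) ≤ Real.log (1 + s) * k := by
    calc 4 * L ^ 2 / (1 + √D) ≤ 4 * L ^ 2 / (1 + s) := by gcongr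
      _ = s / (1 + s) * (4 * s⁻¹ * L ^ 2) := by field_simp
      _ ≤ _ := mul_le_mul hlog2 hk' (by positivity) (hlog2.trans' (by positivity))
  linarith

end Height

/-- Conditions on the number of vertices under which the asymptotic estimates below hold. -/
structure LargeCard (d₀ : ℕ) (δ γ a N : ℝ) : Prop where
  six_le_log : 6 ≤ Real.log N
  decay : 3 * (1 + √(2 * d₀)) ≤ 4 * Real.log N
  const_le : 400 ≤ N ^ (δ / 64)
  height_const_le : (2 + 2 * √(2 * d₀)) * Real.log N ^ 3 ≤ N ^ (δ / 64)
  degree_const_le : 3 * ((d₀ : ℝ) + 3) ≤ N ^ (δ / 64)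
  climb_const_le :
    24 * (d₀ * a * 2 ^ γ) / (γ - 1) * (256 * Real.log N ^ 2) ^ (γ - 1) ≤ N ^ (δ / 64)
  pocket_const_le : (64 * Real.log N ^ 2 + 1) ^ (2 * γ) ≤ N ^ (δ / 64)

/-! ### Powers of the number of vertices dominate its logarithms -/

section Asymptotics

lemma eventually_mul_log_rpow_le (c p : ℝ) {q : ℝ} (hq : 0 < q) :
    ∀ᶠ N : ℝ in atTop, c * Real.log N ^ p ≤ N ^ q := by
  have h := (isLittleO_log_rpow_rpow_atTop p hq).const_mul_left c
  filter_upwards [h.bound one_pos, eventually_ge_atTop 1] with N hN hN1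
  rw [one_mul, Real.norm_of_nonneg (Real.rpow_nonneg (by linarith) q)] at hN
  exact (le_abs_self _).trans hN

lemma eventually_largeCard (d₀ : ℕ) {δ γ : ℝ} (a : ℝ) (hδ : 0 < δ) (hγ : 1 < γ) :
    ∀ᶠ N : ℝ in atTop, LargeCard d₀ δ γ a N := by
  have hq : 0 < δ / 64 := by positivity
  have hlog := Real.tendsto_log_atTop
  filter_upwards [hlog.eventually_ge_atTop 6, hlog.eventually_ge_atTop (3 * (1 + √(2 * d₀)) / 4),
    (tendsto_rpow_atTop hq).eventually_ge_atTop 400,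
    eventually_mul_log_rpow_le (2 + 2 * √(2 * d₀)) 3 hq,
    (tendsto_rpow_atTop hq).eventually_ge_atTop (3 * ((d₀ : ℝ) + 3)),
    eventually_mul_log_rpow_le (24 * (d₀ * a * 2 ^ γ) / (γ - 1) * 256 ^ (γ - 1)) (2 * (γ - 1)) hq,
    eventually_mul_log_rpow_le (65 ^ (2 * γ)) (2 * (2 * γ)) hq] with N h1 h2 h3 h4 h5 h6 h7
  have hL : 0 < Real.log N := by linarith
  refine ⟨h1, by linarith, h3, by exact_mod_cast h4, h5, ?_, ?_⟩
  · rwa [Real.mul_rpow (by norm_num) (by positivity), ← mul_assoc, ← Real.rpow_natCast (Real.log N),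
      ← Real.rpow_mul hL.le, Nat.cast_ofNat]
  · refine le_trans ?_ h7
    rw [Real.rpow_mul hL.le, ← Real.mul_rpow (by norm_num) (by positivity)]
    refine Real.rpow_le_rpow (by positivity) ?_ (by linarith)
    rw [Real.rpow_ofNat]
    nlinarith

end Asymptotics

/-- The final estimate on the probability of entering the box, with all scales measured in powers
of a single large parameter `T`. -/
lemma pocket_numerics {N T σ Z h h' w E c d Q m : ℝ} (hT : 400 ≤ T) (hN : 0 < N) (hw1 : 1 ≤ w)
    (hwT : w ≤ T ^ 4) (hσ0 : 0 < σ) (hσN : σ ≤ N * (T ^ 64)⁻¹ * T) (hσZ : σ * Z ≤ T * (T ^ 64)⁻¹)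
    (hZ : 0 ≤ Z) (hhσ : h ≤ σ * T) (hh'0 : 0 < h') (hh'h : h' ≤ h) (hE : 0 ≤ E) (hEZ : E ≤ Z)
    (hcT : c ≤ T) (hdT : d ≤ T) (hQ : 0 ≤ Q)
    (hm : m ≤ 0 ∨ Q ≤ T * (σ * T ^ 44)⁻¹ ∧
      m ≤ 2 * h / h' * (24 * h' * E + w * c / 2 * (h' * Q) + h' / (N * (T ^ 8)⁻¹))) :
    (2 * w + 1) * (h' / (N * (T ^ 8)⁻¹) + (m + d * (w / N * (N * (T ^ 64)⁻¹ / 2) +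
      (w + 1) / 2 * (Z * (σ / 2))))) ≤ 1 / 2 := by
  -- In the application `T = N ^ (δ/64)`, so `T ^ 64 = N ^ δ`, `σ = λ_G ^ (-1/2)`, `Q = h' ^ (-2γ)`,
  -- and `Z = N ^ (-3)` bounds both exponentially small terms. The variable `m` is the contribution
  -- of the excursions, absent when `h' = h`.
  have hT0 : 0 < T := by linarith
  have hh0 : 0 < h := by linarith
  have hτh : h / (N * (T ^ 8)⁻¹) ≤ (T ^ 54)⁻¹ := by
    calc h / (N * (T ^ 8)⁻¹) ≤ N * (T ^ 64)⁻¹ * T * T / (N * (T ^ 8)⁻¹) := by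
          gcongr
          exact hhσ.trans (by gcongr)
      _ = _ := by field_simp
  have hτ1 : h' / (N * (T ^ 8)⁻¹) ≤ (T ^ 54)⁻¹ := le_trans (by gcongr) hτh
  have hρ1 : d * (w / N * (N * (T ^ 64)⁻¹ / 2) + (w + 1) / 2 * (Z * (σ / 2))) ≤ w * (T ^ 62)⁻¹ := by
    have h1 : w / N * (N * (T ^ 64)⁻¹ / 2) = w * (T ^ 64)⁻¹ / 2 := by
      field_simp
    have h2 : (w + 1) / 2 * (Z * (σ / 2)) ≤ w * (T * (T ^ 64)⁻¹) / 2 := by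
      calc (w + 1) / 2 * (Z * (σ / 2)) = (w + 1) / 2 * (σ * Z) / 2 := by ring
        _ ≤ w * (T * (T ^ 64)⁻¹) / 2 := by
          gcongr
          linarith
    have h3 : w * (T ^ 64)⁻¹ / 2 ≤ w * (T * (T ^ 64)⁻¹) / 2 := by
      have : 1 * (T ^ 64)⁻¹ ≤ T * (T ^ 64)⁻¹ := by
        gcongr
        linarith
      rw [one_mul] at this
      gcongr
    calc _ ≤ T * (w * (T * (T ^ 64)⁻¹)) := by
          rw [h1]
          gcongr
          linarith
      _ = _ := by field_simp
  have hmid : m ≤ 48 * (T ^ 62)⁻¹ + w * (T ^ 41)⁻¹ + 2 * (T ^ 54)⁻¹ := by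
    obtain hm | ⟨hQT, hm⟩ := hm
    · exact hm.trans (by positivity)
    · have h1 : 2 * h / h' * (24 * h' * E + w * c / 2 * (h' * Q) + h' / (N * (T ^ 8)⁻¹)) =
          48 * (h * E) + w * c * (h * Q) + 2 * (h / (N * (T ^ 8)⁻¹)) := by
        field_simp
        ring
      have h3 : h * E ≤ (T ^ 62)⁻¹ := by
        calc h * E ≤ σ * T * Z := by gcongr
          _ = T * (σ * Z) := by ring
          _ ≤ T * (T * (T ^ 64)⁻¹) := by gcongr
          _ = _ := by field_simp
      have h6 : h * Q ≤ (T ^ 42)⁻¹ := by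
        calc h * Q ≤ σ * T * (T * (σ * T ^ 44)⁻¹) := by gcongr
          _ = _ := by field_simp
      have h7 : w * c * (h * Q) ≤ w * (T ^ 41)⁻¹ := by
        calc _ ≤ w * T * (T ^ 42)⁻¹ := by gcongr
          _ = _ := by field_simp
      linarith
  have hTinv : ∀ k : ℕ, 41 ≤ k → (T ^ k)⁻¹ ≤ w * (T ^ 41)⁻¹ := by
    intro k hk
    calc (T ^ k)⁻¹ ≤ (T ^ 41)⁻¹ := by
          gcongr
          linarith
      _ ≤ _ := le_mul_of_one_le_left (by positivity) hw1
  have h54 := hTinv 54 (by norm_num)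
  have h62 := hTinv 62 (by norm_num)
  have h62' : w * (T ^ 62)⁻¹ ≤ w * (T ^ 41)⁻¹ := by
    gcongr
    · linarith
    · norm_num
  -- The constant is `1 + (48 + 1 + 2) + 1`, after each term is compared with `w T^{-41}`.
  -- Multiplying by `3w` with `w ≤ T^4` leaves `159 T^{-33}`.
  have htot : h' / (N * (T ^ 8)⁻¹) + (m + d * (w / N * (N * (T ^ 64)⁻¹ / 2) +
      (w + 1) / 2 * (Z * (σ / 2)))) ≤ 53 * (w * (T ^ 41)⁻¹) := by
    linarith
  refine (mul_le_mul_of_nonneg_left htot (by positivity)).trans ?_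
  calc (2 * w + 1) * (53 * (w * (T ^ 41)⁻¹))
      ≤ (3 * w) * (53 * (w * (T ^ 41)⁻¹)) := by
        gcongr
        linarith
    _ = 159 * (w * w) * (T ^ 41)⁻¹ := by ring
    _ ≤ 159 * (T ^ 4 * T ^ 4) * (T ^ 41)⁻¹ := by gcongr
    _ = 159 * (T ^ 33)⁻¹ := by field_simp
    _ ≤ 159 * (400)⁻¹ := by
        gcongr
        exact hT.trans (le_self_pow₀ (by linarith) (by norm_num))
    _ ≤ _ := by norm_num

/-! ### The pocket hypothesis at the actual scales -/

section Pocket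

variable {V : Type*} [Fintype V] [MeasurableSpace V] [MeasurableSingletonClass V]
  {G : SimpleGraph V} {A W W' : Finset V} {d₀ : ℕ} {δ δ' γ a : ℝ}

lemma IsPocket.killedMatrix_pow_le [DecidableEq V] (hP : IsPocket d₀ δ δ' γ a G A W)
    (hpos : ∀ g, (nbrs G g).Nonempty) :
    ∀ g ∈ A, ∀ n : ℕ, 1 ≤ n → (killedMatrix G A ^ n) g g ≤ a / (n : ℝ) ^ γ := fun g hg n hn =>
  (killedMatrix_pow_le_walkLaw hpos A n hg g).trans (hP.heat_kernel g hg n hn)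

/-- Only level 0 of the inner box is used, so its vertical extent is irrelevant here; the other
levels of the target box are reached later by translation. -/
lemma IsPocket.hit_slab_le (hP : IsPocket d₀ δ δ' γ a G A W) (hW' : W' ⊆ W)
    (hh' : 1 ≤ pocketHeight G δ γ A) (n : ℕ) {x : V × ℤ} (hx : x.1 ∉ A) :
    hit G (floorSet W') {y | |y.2| < 2 * (pocketHeight G δ γ A : ℤ)} n x ≤
      pocketHeight G δ γ A / (Fintype.card V : ℝ) ^ (1 - δ / 8) := by
  set h' := pocketHeight G δ γ A with hh
  have hN : (0 : ℝ) < Fintype.card V := by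
    have : Nonempty V := ⟨x.1⟩
    exact_mod_cast Fintype.card_pos
  have hh0 : (0 : ℝ) < h' := by exact_mod_cast hh'
  have hN' : 0 < (Fintype.card V : ℝ) ^ (1 - δ / 8) := Real.rpow_pos_of_pos hN _
  have hU : innerBox W h' ⊆ slab V h' := by
    rintro y ⟨-, hy⟩
    have : |y.2| ≤ ((h' / 2 : ℕ) : ℤ) := hy.trans (by exact_mod_cast min_le_right _ _)
    show |y.2| ≤ 2 * (h' : ℤ) - 1
    omega
  have h1 : hit G (floorSet W') {y | |y.2| < 2 * (h' : ℤ)} n x ≤ hit G (innerBox W h') (slab V h') n x := by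
    refine hit_mono_set ?_ ?_ n x
    · rintro y ⟨hy1, hy2⟩
      refine ⟨hW' hy1, ?_⟩
      rw [hy2, abs_zero]
      positivity
    · intro y hy
      show |y.2| ≤ 2 * (h' : ℤ) - 1
      have : |y.2| < 2 * (h' : ℤ) := hy
      omega
  refine h1.trans ?_
  have h2 := ofReal_hit_le_entrance_lt_exit (G := G) hU n x
  have h3 : ENNReal.ofReal ((Fintype.card V : ℝ) ^ (1 - δ / 8) / h') *
      ENNReal.ofReal (hit G (innerBox W h') (slab V h') n x) ≤ 1 := by
    refine le_trans ?_ hP.rarely_entered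
    gcongr
    exact h2.trans (le_iSup₂ (f := fun (x : V × ℤ) (_ : x.1 ∉ A) => walkLaw (cylinder G) x
        {ω | entranceTime (innerBox W h') ω < exitTime (slab V h') ω}) x hx)
  rw [← ENNReal.ofReal_mul (by positivity), ENNReal.ofReal_le_one] at h3
  rw [le_div_iff₀ hN']
  rw [div_mul_eq_mul_div, div_le_one hh0] at h3
  linarith

set_option maxHeartbeats 600000 in
/-- The walk is unlikely to reach a small connected piece of the pocket from outside the pocket. -/
lemma IsPocket.hit_box_le_half (hP : IsPocket d₀ δ δ' γ a G A W) (hG : G.Connected)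
    (hV : 2 ≤ Fintype.card V) (hdeg : ∀ g, (nbrs G g).card ≤ d₀) (hgap : ¬ SmallGap G δ)
    (hlarge : LargeCard d₀ δ γ a (Fintype.card V)) (hδ : 0 < δ) (hδ_half : δ < 1 / 2) (hγ : 1 < γ)
    (ha : 0 < a) (hW' : W' ⊆ W) (hW1 : 1 ≤ W'.card)
    (hWN : (W'.card : ℝ) ≤ (Fintype.card V : ℝ) ^ (δ / 16)) {x : V × ℤ} (hx : x.1 ∉ A) :
    hit G (box W' W'.card) Set.univ ⌊(Fintype.card V : ℝ) ^ (2 * (1 - δ))⌋₊ x ≤ 1 / 2 := by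
  classical
  obtain ⟨hL6, hdecay, hT400, hheight, hdegT, hclimb, hpocket⟩ := hlarge
  set N : ℝ := (Fintype.card V : ℝ) with hN
  set L := Real.log N with hL
  set T := N ^ (δ / 64) with hT
  set lam := spectralGap G with hlam
  set σ := (√lam)⁻¹ with hσ
  set n := ⌊N ^ (2 * (1 - δ))⌋₊ with hn
  set h := height G with hh
  set h' := pocketHeight G δ γ A with hh'
  set w : ℝ := (W'.card : ℝ) with hw
  set K' : ℝ := d₀ * a * 2 ^ γ with hK'
  have hK'0 : 0 ≤ K' := by positivity
  have hw1 : 1 ≤ w := by rw [hw]; exact_mod_cast hW1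
  have hN2 : 2 ≤ N := by rw [hN]; exact_mod_cast hV
  have hN0 : 0 < N := by linarith
  have hγ1 : 0 < γ - 1 := by linarith
  have hT0 : 0 < T := by linarith
  have hpos := nbrs_nonempty hG hV
  have hTpow : ∀ k : ℕ, T ^ k = N ^ (k * (δ / 64)) := fun k => by
    rw [hT, ← Real.rpow_natCast, ← Real.rpow_mul hN0.le, mul_comm]
  have hwT : w ≤ T ^ 4 := by
    rw [hTpow]
    convert hWN using 2
    push_cast; ring
  have hNδ : N ^ (1 - δ) = N * (T ^ 64)⁻¹ := by
    rw [hTpow, ← Real.rpow_neg hN0.le]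
    nth_rewrite 2 [← Real.rpow_one N]
    rw [← Real.rpow_add hN0]
    congr 1
    push_cast; ring
  have hNδ8 : N ^ (1 - δ / 8) = N * (T ^ 8)⁻¹ := by
    rw [hTpow, ← Real.rpow_neg hN0.le]
    nth_rewrite 2 [← Real.rpow_one N]
    rw [← Real.rpow_add hN0]
    congr 1
    push_cast; ring
  have hTN : T ^ 64 ≤ N := by
    rw [hTpow]
    nth_rewrite 2 [← Real.rpow_one N]
    exact Real.rpow_le_rpow_of_exponent_le (by linarith) (by push_cast; linarith)
  -- the spectral gap
  have hgap' : N ^ (-2 * (1 - δ)) * L⁻¹ < lam := not_le.1 hgap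
  have hlam0 : 0 < lam := lt_trans (by positivity) hgap'
  have hs0 : 0 < √lam := Real.sqrt_pos.2 hlam0
  have hσ0 : 0 < σ := inv_pos.2 hs0
  have hlamD : lam ≤ 2 * d₀ := spectralGap_le hV hdeg
  have hL2 : 36 ≤ L ^ 2 := (pow_le_pow_left₀ (by norm_num) hL6 2).trans' (by norm_num)
  have hL3 : 1 ≤ L ^ 3 := one_le_pow₀ (by linarith)
  have hL3T : L ^ 3 ≤ T := by
    refine le_trans ?_ hheight
    have : 0 ≤ √(2 * (d₀ : ℝ)) * L ^ 3 := by positivity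
    linarith
  have hLT : √L ≤ T := by
    refine le_trans ?_ hL3T
    rw [Real.sqrt_le_left (by positivity)]
    rw [← pow_mul]
    exact le_self_pow₀ (by linarith) (by norm_num)
  have hσN : σ ≤ N * (T ^ 64)⁻¹ * T := by
    rw [← hNδ]
    refine le_trans ?_ (mul_le_mul_of_nonneg_left hLT (by positivity))
    have h1 : N ^ (1 - δ) * √L = √((N ^ (-2 * (1 - δ)) * L⁻¹)⁻¹) := by
      rw [mul_inv, inv_inv, Real.sqrt_mul (by positivity), ← Real.rpow_neg hN0.le]
      congr 1
      rw [Real.sqrt_eq_rpow, ← Real.rpow_mul hN0.le]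
      congr 1
      ring
    rw [h1, hσ, ← Real.sqrt_inv]
    apply Real.sqrt_le_sqrt
    gcongr
  have hσT : 1 ≤ σ * T := by
    rw [hσ, ← div_eq_inv_mul, le_div_iff₀ hs0, one_mul]
    refine (Real.sqrt_le_sqrt hlamD).trans (le_trans ?_ hheight)
    have h1 : 0 ≤ √(2 * (d₀ : ℝ)) := Real.sqrt_nonneg _
    exact (le_mul_of_one_le_right (by positivity) hL3).trans' (by linarith)
  have hhσ : (h : ℝ) ≤ σ * T := by
    refine (height_le hlam0 hlamD (by linarith)).trans ?_
    rw [mul_comm]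
    gcongr
  -- exponentially small terms
  have hexp : ∀ c : ℝ, 3 * L ≤ c → Real.exp (-c) ≤ (N ^ 3)⁻¹ := by
    intro c hc
    rw [Real.exp_neg]
    gcongr
    calc N ^ 3 = Real.exp (3 * L) := by
          rw [mul_comm, Real.exp_mul, hL, Real.exp_log hN0]
          norm_num
      _ ≤ _ := Real.exp_le_exp.2 hc
  have hexp1 : Real.exp (-L ^ 2 / 2) ≤ (N ^ 3)⁻¹ := by
    rw [neg_div]
    refine hexp _ ?_
    rw [sq]
    linarith [mul_le_mul_of_nonneg_right hL6 (show 0 ≤ L by linarith)]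
  have hexp2 : Real.exp (-(4 * L ^ 2 / (1 + √(2 * d₀)))) ≤ (N ^ 3)⁻¹ := by
    refine hexp _ ?_
    rw [le_div_iff₀ (by positivity)]
    linarith [mul_le_mul_of_nonneg_right hdecay (show 0 ≤ L by linarith)]
  have hσN3 : σ * (N ^ 3)⁻¹ ≤ T * (T ^ 64)⁻¹ := by
    have h1 : N * (N ^ 3)⁻¹ ≤ 1 := by
      rw [mul_inv_le_iff₀ (by positivity), one_mul]
      exact le_self_pow₀ (by linarith) (by norm_num)
    calc σ * (N ^ 3)⁻¹ ≤ N * (T ^ 64)⁻¹ * T * (N ^ 3)⁻¹ := by gcongr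
      _ = (N * (N ^ 3)⁻¹) * (T * (T ^ 64)⁻¹) := by ring
      _ ≤ 1 * (T * (T ^ 64)⁻¹) := by gcongr
      _ = _ := one_mul _
  -- the height of the pocket
  set y : ℝ := (√(A.card : ℝ) * N ^ (-δ / 8)) ^ (1 / γ) with hy
  have hy0 : 0 ≤ y := by positivity
  -- Since `y^{2γ} = |A| N^{-δ/4}`, the size of the pocket leaves `σ` times `N` to the power `15δ/16
  -- - δ/4 = 44δ/64`.
  have hypow : σ * T ^ 44 ≤ y ^ (2 * γ) := by
    have h1 : y ^ (2 * γ) = A.card * N ^ (-δ / 4) := by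
      rw [hy, ← Real.rpow_mul (by positivity), show 1 / γ * (2 * γ) = (2 : ℕ) by field_simp; norm_num,
        Real.rpow_natCast, mul_pow, Real.sq_sqrt (by positivity), ← Real.rpow_natCast,
        ← Real.rpow_mul hN0.le]
      congr 2
      push_cast; ring
    have h2 := hP.card_pocket
    rw [← hlam, ← hN] at h2
    have h3 : lam ^ (-(1 / 2) : ℝ) = σ := by
      rw [Real.rpow_neg hlam0.le, ← Real.sqrt_eq_rpow]
    rw [h3] at h2
    rw [h1]
    calc σ * T ^ 44 = σ * N ^ (15 * δ / 16) * N ^ (-δ / 4) := by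
          rw [mul_assoc, ← Real.rpow_add hN0, hTpow]
          congr 2
          push_cast; ring
      _ ≤ _ := by gcongr
  -- The descent estimate is applied with `ℓ = L ^ 2` and needs a height of at least `64 ℓ`; the
  -- extra 1 allows for rounding.
  have hyL : 64 * L ^ 2 + 1 ≤ y := by
    rw [← Real.rpow_le_rpow_iff (by positivity) hy0 (show 0 < 2 * γ by linarith)]
    refine hpocket.trans (le_trans ?_ hypow)
    have h1 : 1 ≤ T ^ 42 := one_le_pow₀ (by linarith)
    calc T = 1 * (T * 1) := by ring
      _ ≤ σ * T * (T * T ^ 42) := by gcongr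
      _ = _ := by ring
  have hyfl : y / 2 ≤ (⌊y⌋₊ : ℝ) := by
    have := (Nat.lt_floor_add_one y).le
    linarith
  have hfl1 : 1 ≤ ⌊y⌋₊ := by
    rw [Nat.one_le_floor_iff]
    linarith
  have hh'1 : 1 ≤ h' := by
    rw [hh', pocketHeight]
    exact le_min hfl1 one_le_height
  have hh'h : h' ≤ h := min_le_right _ _
  have hh'0 : (0 : ℝ) < h' := by exact_mod_cast hh'1
  -- the killed walk
  have hp : ∀ k : ℕ, 2 ≤ k → ∀ g, killedProb G A W' k g ≤ w * K' * (k : ℝ) ^ (-γ) := fun k hk g =>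
    killedProb_le hpos hdeg ha.le (by linarith) (hP.killedMatrix_pow_le hpos) hk g
  set uA : ℝ := 24 * h' * Real.exp (-L ^ 2 / 2) +
    12 * (w * K') / (γ - 1) * (256 * L ^ 2) ^ (γ - 1) * (h' : ℝ) ^ (1 - 2 * γ) with huA
  -- The lower bound on the pocket height through `y` is needed only when excursions occur, and then
  -- `⌊y⌋₊` realizes the minimum.
  have hflh' : h' < h → h' = ⌊y⌋₊ := by
    intro hlt
    have : h' = min ⌊y⌋₊ h := rfl
    omega
  have huA_hit : h' < h → ∀ x : V × ℤ, |x.2| = h' →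
      hit G (floorSet W') {y | y.1 ∈ A} n x ≤ uA := by
    intro hlt x hx
    refine hit_floorSet_pocket_le hγ (by positivity) hp (hW'.trans hP.subset) hpos (by linarith) ?_ n hx
    rw [hflh' hlt]
    have := (Nat.lt_floor_add_one y).le
    linarith
  set τ : ℝ := h' / N ^ (1 - δ / 8) with hτ
  set ρ : ℝ := 3 * (d₀ + 3) * (w / N * (N ^ (1 - δ) / 2) + (w + 1) / 2 * ((N ^ 3)⁻¹ * (σ / 2))) with hρ
  have hn1 : 1 ≤ n := by
    rw [hn, Nat.one_le_floor_iff]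
    exact Real.one_le_rpow (by linarith) (by linarith)
  have hfar : ∀ x : V × ℤ, 2 * (h : ℤ) ≤ |x.2| → hit G (floorSet W') Set.univ n x ≤ ρ := by
    intro x hx
    refine (hit_floorSet_le_of_far hG hdeg hlam0 W' hn1 x).trans ?_
    have h1 : √(n : ℝ) ≤ N ^ (1 - δ) := by
      rw [Real.sqrt_le_left (by positivity), ← Real.rpow_natCast, ← Real.rpow_mul hN0.le]
      refine (Nat.floor_le (by positivity)).trans_eq ?_
      congr 1
      push_cast; ring
    have h2 : (1 / (1 + √lam)) ^ x.2.natAbs ≤ (N ^ 3)⁻¹ := by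
      refine (pow_le_exp_neg_of_height_le hlam0 hlamD (by linarith) ?_).trans hexp2
      rw [hh, Int.abs_eq_natAbs] at hx
      omega
    have h3 : (1 / (1 + √lam)) ^ x.2.natAbs / (2 * √lam) ≤ (N ^ 3)⁻¹ * (σ / 2) := by
      rw [hσ]
      calc _ = (1 / (1 + √lam)) ^ x.2.natAbs * ((√lam)⁻¹ / 2) := by field_simp
        _ ≤ _ := by gcongr
    rw [hρ, ← hw, ← hN]
    gcongr
  have hmain : ∀ x : V × ℤ, x.1 ∉ A → hit G (floorSet W') Set.univ n x ≤
      τ + ((if h' < h then 2 * (h : ℝ) / h' * (uA + τ) else 0) + ρ) := fun x hx =>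
    hit_floorSet_univ_le hh'1 hh'h (by positivity) (by positivity)
      (fun x hx => hP.hit_slab_le hW' hh'1 n hx) hfar huA_hit (by positivity) hx
  refine (hit_box_le (w := W'.card) hmain hx).trans ?_
  rw [hρ, hτ, hNδ, hNδ8]
  refine pocket_numerics (Q := (h' : ℝ) ^ (-(2 * γ))) hT400 hN0 hw1 hwT hσ0 hσN hσN3 (by positivity)
    hhσ hh'0 (by exact_mod_cast hh'h) (by positivity) hexp1 hclimb hdegT (by positivity) ?_
  split_ifs with hlt
  · refine Or.inr ⟨?_, ?_⟩
    · have h5 : (2 : ℝ) ^ (2 * γ) ≤ T := by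
        refine le_trans ?_ hpocket
        exact Real.rpow_le_rpow (by norm_num) (by linarith) (by linarith)
      calc (h' : ℝ) ^ (-(2 * γ)) ≤ (y / 2) ^ (-(2 * γ)) := by
            refine Real.rpow_le_rpow_of_nonpos (by linarith) ?_ (by linarith)
            rw [hflh' hlt]
            exact hyfl
        _ = 2 ^ (2 * γ) * (y ^ (2 * γ))⁻¹ := by
            rw [Real.rpow_neg (by positivity), Real.div_rpow hy0 (by norm_num), inv_div, div_eq_mul_inv]
        _ ≤ _ := by gcongr
    · have : (h' : ℝ) ^ (1 - 2 * γ) = h' * (h' : ℝ) ^ (-(2 * γ)) := by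
        rw [sub_eq_add_neg, Real.rpow_add hh'0, Real.rpow_one]
      rw [huA, this]
      refine le_of_eq ?_
      ring
  · exact Or.inl le_rfl

end Pocket

/-! ### Probability bounds in the two cases -/

section Conclusion

variable {V : Type*} [Fintype V] [MeasurableSpace V] [MeasurableSingletonClass V]
  {G : SimpleGraph V} {A W : Finset V} {d₀ : ℕ} {δ δ' γ a : ℝ}

lemma walkLaw_disconnectionTime_le_of_smallGap (hG : G.Connected) (hV : 2 ≤ Fintype.card V)
    (hgap : SmallGap G δ) (x : V × ℤ) :
    walkLaw (cylinder G) x {ω | (disconnectionTime G ω : ℝ≥0∞) ≤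
      ENNReal.ofReal ((Fintype.card V : ℝ) ^ (2 * (1 - δ)))} ≤
      ENNReal.ofReal (2 * (Real.log (Fintype.card V))⁻¹) := by
  refine (walkLaw_disconnectionTime_le_spectralGap hG hV x _).trans ?_
  have hN : (0 : ℝ) < Fintype.card V := by exact_mod_cast (by omega : 0 < Fintype.card V)
  have hL : 0 ≤ Real.log (Fintype.card V) := Real.log_natCast_nonneg _
  gcongr
  calc spectralGap G * (⌊(Fintype.card V : ℝ) ^ (2 * (1 - δ))⌋₊ : ℝ)
      ≤ (Fintype.card V : ℝ) ^ (-2 * (1 - δ)) * (Real.log (Fintype.card V))⁻¹ *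
        (Fintype.card V : ℝ) ^ (2 * (1 - δ)) := by
        refine mul_le_mul hgap (Nat.floor_le (by positivity)) (by positivity) (by positivity)
    _ = (Real.log (Fintype.card V))⁻¹ := by
        rw [mul_right_comm, ← Real.rpow_add hN]
        ring_nf
        simp

lemma exp_le_one_add_inv_pow {t : ℝ} (ht : 0 < t) (u : ℕ) :
    Real.exp (u / (t + 1)) ≤ (1 + 1 / t) ^ u := by
  have h := Real.one_sub_inv_le_log_of_pos (show 0 < 1 + 1 / t by positivity)
  have h1 : 1 / (t + 1) ≤ Real.log (1 + 1 / t) := by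
    refine le_trans (le_of_eq ?_) h
    field_simp
    ring
  rw [← Real.exp_log (show 0 < (1 + 1 / t) ^ u by positivity), Real.log_pow]
  refine Real.exp_le_exp.2 ?_
  rw [← mul_one_div]
  gcongr

lemma IsPocket.walkLaw_disconnectionTime_le (hP : IsPocket d₀ δ δ' γ a G A W) (hG : G.Connected)
    (hV : 2 ≤ Fintype.card V) (hdeg : ∀ g, (nbrs G g).card ≤ d₀) (hgap : ¬ SmallGap G δ)
    (hd₀ : 0 < d₀) (hlarge : LargeCard d₀ δ γ a (Fintype.card V)) (hδ : 0 < δ) (hδ_half : δ < 1 / 2)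
    (hδ' : 0 < δ') (hδ'_lt : δ' < δ / 8) (hγ : 1 < γ) (ha : 0 < a)
    (hN1 : (d₀ : ℝ) ≤ (Fintype.card V : ℝ) ^ (δ' / 2))
    (hN2 : 4 ≤ (Fintype.card V : ℝ) ^ (δ' / 4))
    (hN3 : 216 * (3 + d₀ * a * 2 ^ γ / (γ - 1)) * Real.log (Fintype.card V) ≤
      (Fintype.card V : ℝ) ^ (δ' / 4 * (1 - 1 / γ))) (x : V × ℤ) :
    walkLaw (cylinder G) x {ω | (disconnectionTime G ω : ℝ≥0∞) ≤
      ENNReal.ofReal ((Fintype.card V : ℝ) ^ (2 * (1 - δ)))} ≤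
      ENNReal.ofReal (10 / Fintype.card V) := by
  classical
  set N : ℝ := (Fintype.card V : ℝ) with hN
  set L := Real.log N with hL
  have hN2' : 2 ≤ N := by rw [hN]; exact_mod_cast hV
  have hN0 : 0 < N := by linarith
  have hγ1 : 0 < γ - 1 := by linarith
  have hd₀' : (0 : ℝ) < d₀ := by exact_mod_cast hd₀
  have hpos := nbrs_nonempty hG hV
  have hsq : N ^ (δ' / 2) = N ^ (δ' / 4) * N ^ (δ' / 4) := by
    rw [← Real.rpow_add hN0]
    congr 1
    ring
  -- Below `|W| ≥ N ^ δ' / d₀`, so that a linked subset of this size exists, and below `N ^ (δ /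
  -- 16)` because `δ' < δ / 8`. Still a positive power of `N`, so `w / w ^ (1 / γ)` beats `log N`.
  set w : ℕ := ⌊N ^ (δ' / 2)⌋₊ with hw
  have hw_le : (w : ℝ) ≤ N ^ (δ' / 2) := Nat.floor_le (by positivity)
  have hw_ge : N ^ (δ' / 4) ≤ w := by
    have h1 := (Nat.lt_floor_add_one (N ^ (δ' / 2))).le
    rw [← hw] at h1
    nlinarith
  have hw4 : 4 ≤ w := by
    have : (4 : ℝ) ≤ w := hN2.trans hw_ge
    exact_mod_cast this
  have hwW : w ≤ W.card := by
    have h1 : (w : ℝ) ≤ W.card := by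
      refine hw_le.trans (le_trans ?_ hP.le_card_inner)
      rw [← hN, one_div, inv_mul_eq_div, le_div_iff₀ hd₀']
      calc N ^ (δ' / 2) * d₀ ≤ N ^ (δ' / 2) * N ^ (δ' / 2) := by gcongr
        _ = N ^ δ' := by
          rw [← Real.rpow_add hN0]
          congr 1
          ring
    exact_mod_cast h1
  obtain ⟨W', hW'W, hW'card, hW'link⟩ :=
    (linked_of_connected hP.connected).exists_subset_card (by omega) hwW
  have hWN : (W'.card : ℝ) ≤ N ^ (δ / 16) := by
    rw [hW'card]
    exact hw_le.trans (Real.rpow_le_rpow_of_exponent_le (by linarith) (by linarith))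
  set K' : ℝ := d₀ * a * 2 ^ γ with hK'
  have hK'0 : 0 ≤ K' := by positivity
  set n := ⌊N ^ (2 * (1 - δ))⌋₊ with hn
  set c : ℝ := 6 * (3 + K' / (γ - 1)) with hc
  have hc18 : 18 ≤ c := by
    have : 0 ≤ K' / (γ - 1) := by positivity
    linarith
  have hvisits : ∀ y, visits G (box W' W'.card) n y ≤ c * (w : ℝ) ^ (1 / γ) := by
    rw [← hW'card]
    exact visits_box_le hγ hK'0 (by omega) (fun k hk g =>
      killedProb_le hpos hdeg ha.le (by linarith) (hP.killedMatrix_pow_le hpos) hk g)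
      (hW'W.trans hP.subset) hpos (fun y hy => hP.hit_box_le_half hG hV hdeg hgap hlarge hδ hδ_half
        hγ ha hW'W (by omega) hWN hy)
  set m : ℝ := c * (w : ℝ) ^ (1 / γ) with hm
  have hw0 : (0 : ℝ) < w := by exact_mod_cast (by omega : 0 < w)
  have hw1 : (1 : ℝ) ≤ (w : ℝ) ^ (1 / γ) :=
    Real.one_le_rpow (by exact_mod_cast (by omega : 1 ≤ w)) (by positivity)
  have hm1 : 1 ≤ m := by nlinarith
  have hm0 : 0 < m := by linarith
  refine (DisconnectionTime.walkLaw_disconnectionTime_le x hW'link (by omega) (N ^ (2 * (1 - δ))) hm0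
    hvisits (u := w / 2) (by omega)).trans ?_
  rw [hW'card, ← hn]
  have hu : (w : ℝ) / 4 ≤ ((w / 2 : ℕ) : ℝ) := by
    have : w ≤ 4 * (w / 2) := by omega
    have : (w : ℝ) ≤ 4 * ((w / 2 : ℕ) : ℝ) := by exact_mod_cast this
    linarith
  -- At most `5 N ^ 2` translates enter the union bound, so a tail of order `N ^ (-3)` suffices.
  have hexp : N ^ 3 ≤ (1 + 1 / (2 * m)) ^ (w / 2) := by
    refine le_trans ?_ (exp_le_one_add_inv_pow (by positivity) (w / 2))
    have h1 : 3 * L ≤ ((w / 2 : ℕ) : ℝ) / (2 * m + 1) := by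
      have h2 : N ^ (δ' / 4 * (1 - 1 / γ)) ≤ w / (w : ℝ) ^ (1 / γ) := by
        nth_rewrite 1 [← Real.rpow_one (w : ℝ)]
        rw [← Real.rpow_sub hw0, Real.rpow_mul hN0.le]
        refine Real.rpow_le_rpow (by positivity) hw_ge ?_
        rw [sub_nonneg, div_le_one (by linarith)]
        exact hγ.le
      calc 3 * L = (216 * (3 + K' / (γ - 1)) * L) / (12 * c) := by
            rw [eq_div_iff (by positivity), hc]
            ring
        _ ≤ (w / (w : ℝ) ^ (1 / γ)) / (12 * c) := by
            gcongr
            exact hN3.trans h2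
        _ = w / 4 / (3 * m) := by
            rw [hm]
            field_simp
            norm_num
        _ ≤ ((w / 2 : ℕ) : ℝ) / (2 * m + 1) := by
            gcongr
            linarith
    calc N ^ 3 = Real.exp (3 * L) := by
          rw [mul_comm, Real.exp_mul, hL, Real.exp_log hN0]
          norm_num
      _ ≤ _ := Real.exp_le_exp.2 h1
  have hnN : (n : ℝ) ≤ N ^ 2 := by
    refine (Nat.floor_le (by positivity)).trans ?_
    rw [← Real.rpow_natCast]
    exact Real.rpow_le_rpow_of_exponent_le (by linarith) (by push_cast; linarith)
  have hwN : (w : ℝ) ≤ N := by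
    refine hw_le.trans ?_
    nth_rewrite 2 [← Real.rpow_one N]
    exact Real.rpow_le_rpow_of_exponent_le (by linarith) (by linarith)
  gcongr
  calc (2 * ((n : ℝ) + w) + 1) * (2 / (1 + 1 / (2 * m)) ^ (w / 2)) ≤ (5 * N ^ 2) * (2 / N ^ 3) := by
        gcongr
        nlinarith
    _ = 10 / N := by
        field_simp
        norm_num

end Conclusion

end DisconnectionTime

end

theorem theorem4p1 (d₀ : ℕ) (hd₀ : 2 ≤ d₀) (δ δ' γ a : ℝ) (hδ : 0 < δ) (hδ_half : δ < 1 / 2)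
    (hδ' : 0 < δ') (hδ'_lt : δ' < δ / 8) (hγ : 1 < γ) (ha : 0 < a) :
    ∀ ε : ℝ, 0 < ε → ∃ N : ℕ, ∀ (V : Type*) [Fintype V] [MeasurableSpace V]
      [MeasurableSingletonClass V] (G : SimpleGraph V),
      DisconnectionTime.InClass d₀ δ δ' γ a G → N ≤ Fintype.card V →
        (⨆ x : V × ℤ, DisconnectionTime.walkLaw (DisconnectionTime.cylinder G) x
          {ω | (DisconnectionTime.disconnectionTime G ω : ℝ≥0∞) ≤
            ENNReal.ofReal ((Fintype.card V : ℝ) ^ (2 * (1 - δ)))}) ≤ ENNReal.ofReal ε := by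
  intro ε hε
  have hq : 0 < δ' / 4 * (1 - 1 / γ) := by
    have : 1 / γ < 1 := by rw [div_lt_one (by linarith)]; exact hγ
    exact mul_pos (by positivity) (by linarith)
  -- All largeness conditions involve only the number of vertices, the fixed parameters and `ε`,
  -- which makes the threshold uniform over the class. The last two serve the two cases of the
  -- dichotomy.
  have hev := (DisconnectionTime.eventually_largeCard d₀ a hδ hγ).and
    (((tendsto_rpow_atTop (show 0 < δ' / 2 by positivity)).eventually_ge_atTop (d₀ : ℝ)).and
    (((tendsto_rpow_atTop (show 0 < δ' / 4 by positivity)).eventually_ge_atTop 4).and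
    ((DisconnectionTime.eventually_mul_log_rpow_le (216 * (3 + d₀ * a * 2 ^ γ / (γ - 1))) 1 hq).and
    ((Real.tendsto_log_atTop.eventually_ge_atTop (2 / ε)).and (eventually_ge_atTop (10 / ε))))))
  obtain ⟨N, hN⟩ := eventually_atTop.1 (tendsto_natCast_atTop_atTop.eventually hev)
  refine ⟨N, fun V _ _ _ G hG hNV => iSup_le fun x => ?_⟩
  obtain ⟨h1, h2, h3, h4, h5, h6⟩ := hN _ hNV
  have hcard : (0 : ℝ) < Fintype.card V := by
    exact_mod_cast (show 0 < Fintype.card V by have := hG.two_le_card; omega)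
  obtain hgap | ⟨hgap, A, W, hP⟩ := hG.gap_or_pocket
  · refine (DisconnectionTime.walkLaw_disconnectionTime_le_of_smallGap hG.connected hG.two_le_card hgap x).trans ?_
    gcongr
    have hL : 0 < Real.log (Fintype.card V) := lt_of_lt_of_le (by positivity) h5
    rw [← div_eq_mul_inv, div_le_iff₀ hL]
    rw [div_le_iff₀ hε] at h5
    linarith
  · rw [Real.rpow_one] at h4
    refine (hP.walkLaw_disconnectionTime_le hG.connected hG.two_le_card
      (fun g => (DisconnectionTime.card_nbrs g).trans_le (hG.degree_le g)) hgap (by omega) h1 hδ hδ_half hδ' hδ'_lt hγ ha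
      h2 h3 h4 x).trans ?_
    gcongr
    rw [div_le_iff₀ hcard]
    rw [div_le_iff₀ hε] at h6
    linarith
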